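/- Let $V\in C^1([0,\infty))$ be non-increasing and put $W(w)=V(1/w)$ for $w>0$. Let $\Phi:[0,\infty)\to[0,\infty)$ be non-increasing with $\int_0^\infty\Phi(z)\,dz=1$ and $\int_0^\infty z\,\Phi(z)\,dz<\infty$; for $\alpha>0$ put $\Phi_\alpha(z)=\frac1\alpha\Phi\left(\frac z\alpha\right)$ and $\overline{h}^{\alpha}(z)=\int_0^\infty\Phi_\alpha(\zeta)\,h(z+\zeta)\,d\zeta$. Let $y_0:\mathbb R\to\mathbb R$ have bounded variation (finite total variation after modification on a null set; $y_0$ need not be integrable) with $y_0\ge 1$ a.e., and let $T>0$. Test functions below range over $C_0^\infty(\mathbb R\times[0,T])$, the restrictions to $\mathbb R\times[0,T]$ of functions in $C_c^\infty(\mathbb R^2)$. As $W$ is defined on $(0,\infty)$, all solutions are required to be bounded below by a positive constant (everywhere for filtered solutions, a.e. for the local equation). A filtered solution for $\alpha>0$ is a Lipschitz continuous function $w_\alpha:\mathbb R\times[0,T]\to\mathbb R$ with $w_\alpha(\cdot,0)=\overline{y_0}^{\alpha}$ that solves $\partial_t w_\alpha=\partial_z\overline{W(w_\alpha)}^{\alpha}$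 weakly, i.e. for all test functions $\varphi$ $$\int_0^T\!\!\int_{\mathbb R} w_\alpha\,\partial_t\varphi-\overline{W(w_\alpha)}^{\alpha}\,\partial_z\varphi\,dz\,dt=\int_{\mathbb R}w_\alpha(z,T)\varphi(z,T)-w_\alpha(z,0)\varphi(z,0)\,dz .$$ An entropy solution of the local Lagrangian LWR law $\partial_t w=\partial_z W(w)$, $w(\cdot,0)=y_0$, is a function $w\in C([0,T];L^1_{\mathrm{loc}}(\mathbb R))\cap L^\infty(\mathbb R\times[0,T])$ such that for all test functions $\varphi$ $$\int_0^T\!\!\int_{\mathbb R} w\,\partial_t\varphi-W(w)\,\partial_z\varphi\,dz\,dt=\int_{\mathbb R}w(z,T)\varphi(z,T)-y_0(z)\varphi(z,0)\,dz ,$$ and such that for all convex $\eta\in C^2(\mathbb R)$, all $Q$ with $Q'=\eta'W'$ on $(0,\infty)$, and all test functions $\varphi\ge0$ $$\int_0^T\!\!\int_{\mathbb R} \eta(w)\,\partial_t\varphi-Q(w)\,\partial_z\varphi\,dz\,dt\ge\int_{\mathbb R}\eta(w(z,T))\varphi(z,T)-\eta(y_0(z))\varphi(z,0)\,dz .$$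 Theorem. For every $\alpha>0$ there is exactly one filtered solution $w_\alpha$. There is exactly one entropy solution $w$ of the local law (uniqueness: any two agree, for every $t\in[0,T]$, at a.e. $z$). As $\alpha\to0^+$ the whole family $(w_\alpha)$ converges to $w$ in $C([0,T];L^1_{\mathrm{loc}}(\mathbb R))$, that is, for every compact $K\subset\mathbb R$, $$\sup_{t\in[0,T]}\int_K|w_\alpha(z,t)-w(z,t)|\,dz\longrightarrow0 .$$ -/

import Mathlib

open MeasureTheory Set Filter Topology
open scoped ContDiff

noncomputable section

namespace LagrangianLWR

/-- The Lagrangian flux `W(w) = V(1/w)`, meaningful for `w > 0`. -/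
def flux (V : ℝ → ℝ) (w : ℝ) : ℝ := V (1 / w)

/-- A kernel `Φ : [0,∞) → [0,∞)`: non-negative, non-increasing, of unit mass and with finite
first moment. Only the values of `Φ` on `[0,∞)` matter. -/
structure IsKernel (Φ : ℝ → ℝ) : Prop where
  nonneg : ∀ z, 0 ≤ z → 0 ≤ Φ z
  antitone : AntitoneOn Φ (Ici 0)
  integrable : IntegrableOn Φ (Ioi 0)
  mass : ∫ z in Ioi (0 : ℝ), Φ z = 1
  moment : IntegrableOn (fun z => z * Φ z) (Ioi 0)

/-- The rescaled kernel `Φ_α(z) = α⁻¹ Φ(z/α)`. -/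
def scaled (Φ : ℝ → ℝ) (α : ℝ) (z : ℝ) : ℝ := (1 / α) * Φ (z / α)

/-- The downstream average `∫₀^∞ Φ_α(ζ) h(z + ζ) dζ` of `h`. -/
def average (Φ : ℝ → ℝ) (α : ℝ) (h : ℝ → ℝ) (z : ℝ) : ℝ :=
  ∫ ζ in Ioi (0 : ℝ), scaled Φ α ζ * h (z + ζ)

/-- `y` has finite total variation on the line, up to modification on a null set. (No
integrability over the line is required.) -/
def IsBV (y : ℝ → ℝ) : Prop :=
  ∃ g : ℝ → ℝ, BoundedVariationOn g univ ∧ y =ᵐ[volume] g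

/-- Test functions on `ℝ × [0,T]` (space first, time second): restrictions of smooth compactly
supported functions on the plane. They need not vanish at `t = 0` and `t = T`. -/
def IsTest (φ : ℝ × ℝ → ℝ) : Prop := ContDiff ℝ ∞ φ ∧ HasCompactSupport φ

/-- `∫₀ᵀ ∫ A ∂ₜφ - F ∂_zφ dz dt - ∫ A(z,T) φ(z,T) - a(z) φ(z,0) dz`, the weak form of
`∂_z F - ∂ₜ A` with initial value `a` tested against `φ`. -/
def weakForm (T : ℝ) (A F : ℝ → ℝ → ℝ) (a : ℝ → ℝ) (φ : ℝ × ℝ → ℝ) : ℝ :=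
  (∫ t in (0 : ℝ)..T, ∫ z : ℝ,
      (A z t * deriv (fun s => φ (z, s)) t - F z t * deriv (fun x => φ (x, t)) z))
    - ∫ z : ℝ, (A z T * φ (z, T) - a z * φ (z, 0))

/-- `w` is a Lipschitz continuous weak solution on `ℝ × [0,T]` of the filtered equation
`∂ₜ w = ∂_z (average of W(w))`, `w(·,0) = average of y₀`. Since `W` is defined on `(0,∞)`,
the values of `w` are bounded away from `0`. -/
structure IsFilteredSolution (V Φ y₀ : ℝ → ℝ) (α T : ℝ) (w : ℝ → ℝ → ℝ) : Prop where
  lipschitz : ∃ K, LipschitzOnWith K (fun p : ℝ × ℝ => w p.1 p.2) (univ ×ˢ Icc 0 T)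
  pos : ∃ m > 0, ∀ z, ∀ t ∈ Icc 0 T, m ≤ w z t
  initial : ∀ z, w z 0 = average Φ α y₀ z
  weak : ∀ φ, IsTest φ →
    weakForm T w (fun z t => average Φ α (fun x => flux V (w x t)) z) (fun z => w z 0) φ = 0

/-- `w ∈ C([0,T]; L¹_loc(ℝ))`. -/
def ContinuousInL1loc (T : ℝ) (w : ℝ → ℝ → ℝ) : Prop :=
  (∀ t ∈ Icc 0 T, LocallyIntegrable (fun z => w z t)) ∧
  ∀ K : Set ℝ, IsCompact K → ∀ t₀ ∈ Icc 0 T,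
    Tendsto (fun t => ∫⁻ z in K, ‖w z t - w z t₀‖ₑ) (𝓝[Icc 0 T] t₀) (𝓝 0)

/-- `w` is a weak solution on `ℝ × [0,T]` of `∂ₜ w = ∂_z W(w)`, `w(·,0) = y₀`, in the class
`C([0,T]; L¹_loc) ∩ L^∞`, with values bounded away from `0`. -/
structure IsWeakSolution (V y₀ : ℝ → ℝ) (T : ℝ) (w : ℝ → ℝ → ℝ) : Prop where
  cont : ContinuousInL1loc T w
  bdd : MemLp (fun p : ℝ × ℝ => w p.1 p.2) ⊤ (volume.restrict (univ ×ˢ Icc 0 T))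
  pos : ∃ m > 0, ∀ᵐ p : ℝ × ℝ ∂(volume.restrict (univ ×ˢ Icc 0 T)), m ≤ w p.1 p.2
  weak : ∀ φ, IsTest φ → weakForm T w (fun z t => flux V (w z t)) y₀ φ = 0

/-- Entropy/entropy-flux pairs: `η` is convex and `C²`, and `Q' = η' W'` on the domain `(0,∞)`
of `W`. -/
structure IsEntropyPair (V η Q : ℝ → ℝ) : Prop where
  convex : ConvexOn ℝ univ η
  smooth : ContDiff ℝ 2 η
  flux_deriv : ∀ w, 0 < w → HasDerivAt Q (deriv η w * deriv (flux V) w) w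

/-- Entropy solutions of `∂ₜ w = ∂_z W(w)`, `w(·,0) = y₀`, on `ℝ × [0,T]`. -/
structure IsEntropySolution (V y₀ : ℝ → ℝ) (T : ℝ) (w : ℝ → ℝ → ℝ) : Prop
    extends IsWeakSolution V y₀ T w where
  entropy : ∀ η Q, IsEntropyPair V η Q → ∀ φ, IsTest φ → (∀ p, 0 ≤ φ p) →
    0 ≤ weakForm T (fun z t => η (w z t)) (fun z t => Q (w z t)) (fun z => η (y₀ z)) φ

end LagrangianLWR

end

namespace LagrangianLWR

open scoped BoundedContinuousFunction NNReal ENNReal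

/-! ### Kernels and averages -/

/-! Since a kernel is non-increasing, it is the tail function of a finite measure ν = -dΨ on (0,∞),
and the derivative of an average is a jump generator: ∂_z avg(h)(z) = ∫ (h(z+ζ) - h(z)) dν(ζ)
(`IsKernel.hasDerivAt_avg`). With `G` the flux truncated to the range of the data, the filtered law
becomes an ordinary differential equation u' = J(G(u)) in the space of bounded continuous functions,
with a bounded Lipschitz field. Picard-Lindelöf gives existence. Any filtered solution, tested
against products χ(z)τ(t), satisfies the corresponding integral equation, so ODE uniqueness gives
uniqueness (`IsFilteredSolution.eq_flow`).

As `V` is non-increasing, `G` is non-decreasing, and a small Euler step u - δcG(u) + δ∫G(u(· +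
ζ))dν, with c the mass of ν, is non-decreasing in every value of u. Hence the bounds and the L¹
translation modulus of the data persist, uniformly in α (`jump_trajectory_mem_regularSet`), and |u -
k| obeys a Kruzhkov inequality with averaged flux. Removing the average costs, in L¹, at most the
modulus times the first moment of the kernel, which is O(α). So w_α is an entropy solution up to an
error O(α) (`jump_trajectory_diniEntropy`).

The core is `stability`: two approximate entropy solutions, one of which has a translation modulus,
stay close in L¹_loc if their errors and initial distance are small. It doubles the space variable
only. Time is handled by right Dini derivatives and Gronwall, and a weight with |ψ'| ≤ ψ + κ takes
the place of finite propagation speed.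

Applied to two flows, stability shows that the whole family is Cauchy in C([0,T]; L¹_loc), so no
compactness argument is needed. The limit inherits the entropy inequalities, which the flows satisfy
with averaged entropy flux (`IsFlow.weakForm_nonneg`). Applied to a flow and an arbitrary entropy
solution, which has error 0 and need not be of bounded variation, it shows that every entropy
solution is that same limit. -/

/-- The downstream average against an unscaled kernel. -/
noncomputable def avg (Ψ h : ℝ → ℝ) (z : ℝ) : ℝ := ∫ ζ in Ioi (0 : ℝ), Ψ ζ * h (z + ζ)

lemma average_eq_avg (Φ : ℝ → ℝ) (α : ℝ) (h : ℝ → ℝ) :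
    average Φ α h = avg (scaled Φ α) h := rfl

/-- The first moment of a kernel. -/
noncomputable def firstMoment (Ψ : ℝ → ℝ) : ℝ := ∫ z in Ioi (0 : ℝ), z * Ψ z

/-- `h` is Lipschitz as a map from translations to `L¹`, as functions of bounded variation are. -/
def HasModulus (C : ℝ) (h : ℝ → ℝ) : Prop :=
  ∀ x, ∫⁻ z, ‖h (z + x) - h z‖ₑ ≤ ENNReal.ofReal (C * |x|)

namespace IsKernel

variable {Φ Ψ : ℝ → ℝ}

lemma isKernel_scaled (hΦ : IsKernel Φ) {α : ℝ} (hα : 0 < α) : IsKernel (scaled Φ α) where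
  nonneg z hz := mul_nonneg (by positivity) (hΦ.nonneg _ (by positivity))
  antitone := fun x hx y hy hxy => mul_le_mul_of_nonneg_left
    (hΦ.antitone (div_nonneg hx hα.le) (div_nonneg hy hα.le) (by gcongr)) (by positivity)
  integrable := by
    have := (integrableOn_Ioi_comp_mul_left_iff Φ 0 (a := α⁻¹) (by positivity)).2
      (by simpa using hΦ.integrable)
    have h2 := this.const_mul (1 / α)
    simp only [← div_eq_inv_mul] at h2
    exact h2
  mass := by
    have := integral_comp_mul_left_Ioi Φ 0 (b := α⁻¹) (by positivity)
    simp only [scaled, div_eq_inv_mul, integral_const_mul]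
    rw [this]
    simp [hΦ.mass, hα.ne']
  moment := by
    have := (integrableOn_Ioi_comp_mul_left_iff (fun z => z * Φ z) 0 (a := α⁻¹) (by positivity)).2
      (by simpa using hΦ.moment)
    refine this.congr_fun (fun z _ => ?_) measurableSet_Ioi
    simp only [scaled, div_eq_inv_mul]; ring

lemma firstMoment_scaled {α : ℝ} (hα : 0 < α) :
    firstMoment (scaled Φ α) = α * firstMoment Φ := by
  have := integral_comp_mul_left_Ioi (fun z => z * Φ z) 0 (b := α⁻¹) (by positivity)
  simp only [mul_zero, inv_inv, smul_eq_mul] at this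
  rw [firstMoment, firstMoment, ← this]
  refine setIntegral_congr_fun measurableSet_Ioi (fun z _ => ?_)
  simp only [scaled, div_eq_inv_mul]; ring

lemma firstMoment_nonneg (hΨ : IsKernel Ψ) : 0 ≤ firstMoment Ψ :=
  setIntegral_nonneg measurableSet_Ioi fun z hz =>
    mul_nonneg (le_of_lt hz) (hΨ.nonneg z (le_of_lt hz))

/-- Monotonicity and unit mass give z Ψ(z) ≤ ∫₀^z Ψ ≤ 1. -/
lemma tendsto_atTop (hΨ : IsKernel Ψ) : Tendsto Ψ atTop (𝓝 0) := by
  have h1 : ∀ z, 0 < z → Ψ z ≤ z⁻¹ := by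
    intro z hz
    have h2 : ∫ x in Ioc 0 z, Ψ z ≤ ∫ x in Ioi (0 : ℝ), Ψ x := by
      calc ∫ x in Ioc 0 z, Ψ z ≤ ∫ x in Ioc 0 z, Ψ x :=
            setIntegral_mono_on (by simp) (hΨ.integrable.mono_set Ioc_subset_Ioi_self)
              measurableSet_Ioc fun x hx => hΨ.antitone hx.1.le hz.le hx.2
        _ ≤ _ := setIntegral_mono_set hΨ.integrable
            ((ae_restrict_mem measurableSet_Ioi).mono fun x hx => hΨ.nonneg x (le_of_lt hx))
            Ioc_subset_Ioi_self.eventuallyLE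
    rw [hΨ.mass] at h2
    simp only [integral_const, smul_eq_mul, measureReal_restrict_apply_univ, Real.volume_real_Ioc,
      sub_zero, max_eq_left hz.le] at h2
    rw [← one_div, le_div_iff₀ hz]; linarith
  refine tendsto_of_tendsto_of_tendsto_of_le_of_le' tendsto_const_nhds tendsto_inv_atTop_zero ?_ ?_
  · filter_upwards [eventually_ge_atTop 0] with z hz using hΨ.nonneg z hz
  · filter_upwards [eventually_gt_atTop 0] with z hz using h1 z hz

/-- The kernel is the tail function of a finite measure `ν = -dΨ`. -/
lemma exists_measure (hΨ : IsKernel Ψ) : ∃ ν : Measure ℝ, IsFiniteMeasure ν ∧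
    (∀ᵐ ζ ∂ν, 0 < ζ) ∧ ∀ᵐ x ∂(volume.restrict (Ioi (0 : ℝ))), ν.real (Ioi x) = Ψ x := by
  -- Freezing the kernel at `Ψ 0` on the negative axis gives a monotone function on the whole line,
  -- as a Stieltjes measure requires.
  have hmono : Monotone fun x => -Ψ (max x 0) := fun x y hxy =>
    neg_le_neg (hΨ.antitone (mem_Ici.2 (le_max_right _ _)) (mem_Ici.2 (le_max_right _ _))
      (max_le_max_right 0 hxy))
  set f := hmono.stieltjesFunction with hf
  have hbd : ∀ x, |-Ψ (max x 0)| ≤ Ψ 0 := fun x => by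
    rw [abs_neg, abs_of_nonneg (hΨ.nonneg _ (le_max_right _ _))]
    exact hΨ.antitone self_mem_Ici (mem_Ici.2 (le_max_right _ _)) (le_max_right _ _)
  have hle : ∀ x, -Ψ (max x 0) ≤ f x := fun x => hmono.le_rightLim le_rfl
  have hle' : ∀ x, f x ≤ -Ψ (max (x + 1) 0) := fun x => hmono.rightLim_le (by linarith)
  have hfbd : ∀ x, |f x| ≤ Ψ 0 := fun x => by
    have h1 := hle x; have h2 := hle' x; have h3 := abs_le.1 (hbd x)
    have h4 := abs_le.1 (hbd (x + 1))
    exact abs_le.2 ⟨by linarith, by linarith⟩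
  have hfin := f.isFiniteMeasure_of_forall_abs_le hfbd
  have hlim : Tendsto (fun x => -Ψ (max x 0)) atTop (𝓝 0) := by
    have h1 := hΨ.tendsto_atTop.neg
    rw [neg_zero] at h1
    refine h1.congr' ?_
    filter_upwards [eventually_ge_atTop 0] with x hx
    simp [hx]
  have hlim' : Tendsto f atTop (𝓝 0) :=
    tendsto_of_tendsto_of_tendsto_of_le_of_le hlim
      (hlim.comp (tendsto_atTop_add_const_right _ 1 tendsto_id)) hle hle'
  -- The restriction discards a possible atom at 0, produced by a jump of Ψ there; tails beyond x >
  -- 0 do not see it. The tail identity holds at continuity points of Ψ, so off a countable set.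
  refine ⟨f.measure.restrict (Ioi 0), inferInstance, ae_restrict_mem measurableSet_Ioi, ?_⟩
  have hae : ∀ᵐ x : ℝ, ContinuousAt (fun x => -Ψ (max x 0)) x := by
    have := hmono.countable_not_continuousAt.ae_notMem volume
    filter_upwards [this] with x hx
    simpa using hx
  filter_upwards [ae_restrict_of_ae hae, ae_restrict_mem measurableSet_Ioi] with x hx hx0
  have hx0' : (0 : ℝ) < x := hx0
  have hfx : f x = -Ψ x := by
    rw [hf, hmono.stieltjesFunction_eq, hx.continuousWithinAt.rightLim_eq]
    simp [hx0'.le]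
  rw [measureReal_restrict_apply measurableSet_Ioi,
    inter_eq_left.2 (Ioi_subset_Ioi hx0'.le), measureReal_def, f.measure_Ioi hlim', hfx]
  simp [hΨ.nonneg x hx0'.le]

lemma integrable_mul (hΨ : IsKernel Ψ) {g : ℝ → ℝ} {C : ℝ} (hg : Measurable g)
    (hC : ∀ x, |g x| ≤ C) : IntegrableOn (fun x => Ψ x * g x) (Ioi 0) :=
  hΨ.integrable.mul_bdd hg.aestronglyMeasurable (ae_of_all _ hC)

lemma avg_const (hΨ : IsKernel Ψ) (c z : ℝ) : avg Ψ (fun _ => c) z = c := by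
  simp [avg, integral_mul_const, hΨ.mass]

lemma avg_mono (hΨ : IsKernel Ψ) {g h : ℝ → ℝ} {C : ℝ} (hg : Measurable g) (hh : Measurable h)
    (hgC : ∀ x, |g x| ≤ C) (hhC : ∀ x, |h x| ≤ C) (hgh : ∀ x, g x ≤ h x) (z : ℝ) :
    avg Ψ g z ≤ avg Ψ h z :=
  setIntegral_mono_on (hΨ.integrable_mul (hg.comp (measurable_const_add z)) fun _ => hgC _)
    (hΨ.integrable_mul (hh.comp (measurable_const_add z)) fun _ => hhC _) measurableSet_Ioi
    fun x hx => mul_le_mul_of_nonneg_left (hgh _) (hΨ.nonneg x (le_of_lt hx))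

lemma avg_mem_Icc (hΨ : IsKernel Ψ) {h : ℝ → ℝ} {m M : ℝ} (hh : Measurable h)
    (hmM : ∀ x, h x ∈ Icc m M) (z : ℝ) : avg Ψ h z ∈ Icc m M := by
  have hb : ∀ x, |h x| ≤ max |m| |M| := fun x => abs_le_max_abs_abs (hmM x).1 (hmM x).2
  have hb1 : ∀ _ : ℝ, |m| ≤ max |m| |M| := fun _ => le_max_left _ _
  have hb2 : ∀ _ : ℝ, |M| ≤ max |m| |M| := fun _ => le_max_right _ _
  constructor
  · rw [← hΨ.avg_const m z]
    exact hΨ.avg_mono measurable_const hh hb1 hb (fun x => (hmM x).1) z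
  · rw [← hΨ.avg_const M z]
    exact hΨ.avg_mono hh measurable_const hb hb2 (fun x => (hmM x).2) z

lemma avg_congr {g h : ℝ → ℝ} (hgh : g =ᵐ[volume] h) : avg Ψ g = avg Ψ h := by
  ext z
  refine integral_congr_ae (ae_restrict_of_ae ?_)
  have := (measurePreserving_add_left volume z).quasiMeasurePreserving.ae_eq_comp hgh
  filter_upwards [this] with x hx
  simp only [Function.comp_apply] at hx
  rw [hx]

/-- Layer-cake formula: write Ψ(x) = ∫ 1_{x<ζ} dν(ζ) and exchange the integrals. A weighted average
becomes a superposition of plain window integrals, which can be differentiated in z. -/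
lemma avg_eq_integral (hΨ : IsKernel Ψ) {ν : Measure ℝ} [IsFiniteMeasure ν]
    (hν : ∀ᵐ ζ ∂ν, 0 < ζ) (hνΨ : ∀ᵐ x ∂(volume.restrict (Ioi (0 : ℝ))), ν.real (Ioi x) = Ψ x)
    {h : ℝ → ℝ} {C : ℝ} (hh : Measurable h) (hC : ∀ x, |h x| ≤ C) (z : ℝ) :
    Integrable (fun ζ => ∫ x in z..z + ζ, h x) ν ∧
      avg Ψ h z = ∫ ζ, (∫ x in z..z + ζ, h x) ∂ν := by
  have hhz : Measurable fun x => h (z + x) := hh.comp (measurable_const_add z)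
  set f : ℝ → ℝ → ℝ := fun x ζ => (Ioi x).indicator (fun _ => h (z + x)) ζ with hfdef
  have hfm : Measurable (Function.uncurry f) := by
    have : Function.uncurry f = {p : ℝ × ℝ | p.1 < p.2}.indicator (fun p => h (z + p.1)) := by
      ext p; simp [f, Function.uncurry, indicator]
    rw [this]
    exact (hhz.comp measurable_fst).indicator (measurableSet_lt measurable_fst measurable_snd)
  have hnorm : ∀ x, ∫ ζ, ‖f x ζ‖ ∂ν = |h (z + x)| * ν.real (Ioi x) := fun x => by
    simp only [f, norm_indicator_eq_indicator_norm]
    rw [integral_indicator measurableSet_Ioi]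
    simp [mul_comm]
  have hint : Integrable (Function.uncurry f) ((volume.restrict (Ioi (0 : ℝ))).prod ν) := by
    rw [integrable_prod_iff hfm.aestronglyMeasurable]
    refine ⟨ae_of_all _ fun x => ?_, ?_⟩
    · exact (integrable_const (h (z + x))).indicator measurableSet_Ioi
    · simp only [Function.uncurry_apply_pair, hnorm]
      refine (hΨ.integrable_mul (g := fun x => |h (z + x)|) (C := C)
        (continuous_abs.measurable.comp hhz) (fun x => by simpa using hC _)).congr ?_
      filter_upwards [hνΨ] with x hx
      rw [hx, mul_comm]
  have hswap := integral_integral_swap hint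
  have hinner : ∀ᵐ ζ ∂ν, ∫ x in Ioi (0 : ℝ), f x ζ = ∫ x in z..z + ζ, h x := by
    filter_upwards [hν] with ζ hζ
    have h1 : ∀ x, f x ζ = (Iio ζ).indicator (fun x => h (z + x)) x := fun x => by
      simp [f, indicator]
    simp only [h1]
    rw [setIntegral_indicator measurableSet_Iio, Ioi_inter_Iio, ← integral_Ioc_eq_integral_Ioo,
      ← intervalIntegral.integral_of_le hζ.le, intervalIntegral.integral_comp_add_left]
    simp
  refine ⟨hint.integral_prod_right.congr hinner, ?_⟩
  rw [← integral_congr_ae hinner, ← hswap, avg]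
  refine integral_congr_ae ?_
  filter_upwards [hνΨ] with x hx
  simp only [f]
  rw [integral_indicator measurableSet_Ioi]
  simp [hx]

/-- Moving a window changes its integral only through two end pieces of length |x - y|. Thus
averages of merely bounded measurable data, such as the initial values, are already Lipschitz. -/
lemma avg_lipschitz (hΨ : IsKernel Ψ) {h : ℝ → ℝ} {C : ℝ} (hh : Measurable h)
    (hC : ∀ x, |h x| ≤ C) : ∃ K, LipschitzWith K (avg Ψ h) := by
  obtain ⟨ν, hfin, hν, hνΨ⟩ := hΨ.exists_measure
  have hC0 : 0 ≤ C := (abs_nonneg _).trans (hC 0)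
  have hint : ∀ a b, IntervalIntegrable h volume a b := fun a b =>
    (intervalIntegrable_const (c := C)).mono_fun hh.aestronglyMeasurable
      (ae_of_all _ fun x => by simpa [abs_of_nonneg hC0] using hC x)
  refine ⟨(2 * C * ν.real univ).toNNReal, LipschitzWith.of_dist_le_mul fun x y => ?_⟩
  rw [Real.coe_toNNReal _ (by positivity), Real.dist_eq, Real.dist_eq,
    (hΨ.avg_eq_integral hν hνΨ hh hC x).2, (hΨ.avg_eq_integral hν hνΨ hh hC y).2,
    ← integral_sub (hΨ.avg_eq_integral hν hνΨ hh hC x).1 (hΨ.avg_eq_integral hν hνΨ hh hC y).1]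
  have key : ∀ ζ, ‖(∫ t in x..x + ζ, h t) - ∫ t in y..y + ζ, h t‖ ≤ 2 * C * |x - y| := fun ζ => by
    have h1 : (∫ t in x..x + ζ, h t) - ∫ t in y..y + ζ, h t
        = (∫ t in x..y, h t) - ∫ t in x + ζ..y + ζ, h t := by
      rw [intervalIntegral.integral_interval_sub_interval_comm] <;> simp [hint]
    rw [h1]
    have b1 := intervalIntegral.norm_integral_le_of_norm_le_const (a := x) (b := y) (f := h)
      (C := C) fun t _ => hC t
    have b2 := intervalIntegral.norm_integral_le_of_norm_le_const (a := x + ζ) (b := y + ζ) (f := h)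
      (C := C) fun t _ => hC t
    have e : y + ζ - (x + ζ) = y - x := by ring
    rw [e] at b2
    rw [abs_sub_comm] at b1 b2
    calc _ ≤ _ := norm_sub_le _ _
      _ ≤ _ := by linarith
  calc _ ≤ 2 * C * |x - y| * ν.real univ := norm_integral_le_of_norm_le_const (ae_of_all _ key)
    _ = _ := by ring

/-- Differentiation of the window integrals under ν. This identity turns the filtered conservation
law into an ordinary differential equation. -/
lemma hasDerivAt_avg (hΨ : IsKernel Ψ) {ν : Measure ℝ} [IsFiniteMeasure ν]
    (hν : ∀ᵐ ζ ∂ν, 0 < ζ) (hνΨ : ∀ᵐ x ∂(volume.restrict (Ioi (0 : ℝ))), ν.real (Ioi x) = Ψ x)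
    {h : ℝ → ℝ} {C : ℝ} (hh : Continuous h) (hC : ∀ x, |h x| ≤ C) (z : ℝ) :
    HasDerivAt (avg Ψ h) (∫ ζ, (h (z + ζ) - h z) ∂ν) z := by
  have e : avg Ψ h = fun z => ∫ ζ, (∫ x in z..z + ζ, h x) ∂ν :=
    funext fun z => (hΨ.avg_eq_integral hν hνΨ hh.measurable hC z).2
  rw [e]
  refine (hasDerivAt_integral_of_dominated_loc_of_deriv_le (s := univ) (bound := fun _ => 2 * C)
    (F' := fun z ζ => h (z + ζ) - h z) univ_mem
    (Eventually.of_forall fun z =>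
      (hΨ.avg_eq_integral hν hνΨ hh.measurable hC z).1.aestronglyMeasurable)
    (hΨ.avg_eq_integral hν hνΨ hh.measurable hC z).1
    (by fun_prop) ?_ (integrable_const _) ?_).2
  · refine ae_of_all _ fun ζ x _ => (norm_sub_le _ _).trans ?_
    have := hC (x + ζ); have := hC x
    simp only [Real.norm_eq_abs]; linarith
  · refine ae_of_all _ fun ζ x _ => ?_
    have hi : ∀ a b, IntervalIntegrable h volume a b := fun a b => hh.intervalIntegrable a b
    have h1 : (fun z => ∫ x in z..z + ζ, h x)
        = fun z => (∫ x in (0 : ℝ)..z + ζ, h x) - ∫ x in (0 : ℝ)..z, h x :=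
      funext fun z => (intervalIntegral.integral_interval_sub_left (hi _ _) (hi _ _)).symm
    rw [h1]
    have h2 : HasDerivAt (fun z => ∫ x in (0 : ℝ)..z + ζ, h x) (h (x + ζ)) x := by
      simpa using (intervalIntegral.integral_hasDerivAt_right (hi 0 (x + ζ))
        (hh.stronglyMeasurableAtFilter _ _) hh.continuousAt).comp_add_const x ζ
    exact h2.sub (intervalIntegral.integral_hasDerivAt_right (hi 0 x)
        (hh.stronglyMeasurableAtFilter _ _) hh.continuousAt)

lemma aestronglyMeasurable (hΨ : IsKernel Ψ) :
    AEStronglyMeasurable Ψ (volume.restrict (Ioi (0 : ℝ))) := hΨ.integrable.aestronglyMeasurable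

lemma lintegral_eq_one (hΨ : IsKernel Ψ) : ∫⁻ ζ in Ioi (0 : ℝ), ‖Ψ ζ‖ₑ = 1 := by
  rw [← ofReal_integral_norm_eq_lintegral_enorm hΨ.integrable]
  have : ∫ ζ in Ioi (0 : ℝ), ‖Ψ ζ‖ = ∫ ζ in Ioi (0 : ℝ), Ψ ζ :=
    setIntegral_congr_fun measurableSet_Ioi fun x hx => by
      simp [abs_of_nonneg (hΨ.nonneg x (le_of_lt hx))]
  rw [this, hΨ.mass]; simp

/-- Averages of shifted functions in `L¹`, by Minkowski's integral inequality. -/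
lemma lintegral_avg_le (hΨ : IsKernel Ψ) {k : ℝ → ℝ → ℝ} (hk : Measurable (Function.uncurry k)) :
    ∫⁻ z, ‖∫ ζ in Ioi (0 : ℝ), Ψ ζ * k z ζ‖ₑ
      ≤ ∫⁻ ζ in Ioi (0 : ℝ), ‖Ψ ζ‖ₑ * ∫⁻ z, ‖k z ζ‖ₑ := by
  calc ∫⁻ z, ‖∫ ζ in Ioi (0 : ℝ), Ψ ζ * k z ζ‖ₑ
      ≤ ∫⁻ z, ∫⁻ ζ in Ioi (0 : ℝ), ‖Ψ ζ‖ₑ * ‖k z ζ‖ₑ :=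
        lintegral_mono fun z => (enorm_integral_le_lintegral_enorm _).trans_eq (by simp)
    _ = ∫⁻ ζ in Ioi (0 : ℝ), ∫⁻ z, ‖Ψ ζ‖ₑ * ‖k z ζ‖ₑ := by
        refine lintegral_lintegral_swap ?_
        exact (hΨ.aestronglyMeasurable.enorm.comp_snd).mul hk.enorm.aemeasurable
    _ = _ := by
        refine lintegral_congr fun ζ => ?_
        exact lintegral_const_mul _ (hk.comp (measurable_id.prodMk measurable_const)).enorm

lemma avg_hasModulus (hΨ : IsKernel Ψ) {h : ℝ → ℝ} {C V : ℝ} (hh : Measurable h)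
    (hC : ∀ x, |h x| ≤ C) (hV : HasModulus V h) : HasModulus V (avg Ψ h) := by
  intro x
  have h1 : ∀ z, avg Ψ h (z + x) - avg Ψ h z
      = ∫ ζ in Ioi (0 : ℝ), Ψ ζ * (h (z + ζ + x) - h (z + ζ)) := fun z => by
    rw [avg, avg, ← integral_sub
      (hΨ.integrable_mul (g := fun ζ => h (z + x + ζ)) (by fun_prop) fun x => hC _)
      (hΨ.integrable_mul (g := fun ζ => h (z + ζ)) (by fun_prop) fun x => hC _)]
    congr 1; ext ζ; rw [← mul_sub, add_right_comm]
  simp only [h1]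
  refine (hΨ.lintegral_avg_le (k := fun z ζ => h (z + ζ + x) - h (z + ζ))
    (by simp only [Function.uncurry_def]; fun_prop)).trans ?_
  calc ∫⁻ ζ in Ioi (0 : ℝ), ‖Ψ ζ‖ₑ * ∫⁻ z, ‖h (z + ζ + x) - h (z + ζ)‖ₑ
      ≤ ∫⁻ ζ in Ioi (0 : ℝ), ‖Ψ ζ‖ₑ * ENNReal.ofReal (V * |x|) := by
        refine lintegral_mono fun ζ => mul_le_mul_right ?_ _
        exact (lintegral_add_right_eq_self (fun z => ‖h (z + x) - h z‖ₑ) ζ).trans_le (hV x)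
    _ = _ := by
        rw [lintegral_mul_const'' _ hΨ.aestronglyMeasurable.enorm, hΨ.lintegral_eq_one, one_mul]

/-- A shift by ζ costs at most Vζ in L¹, and the kernel weights these costs to V times the first
moment. For `scaled Φ α` this is of order α; all convergence as α → 0 rests on this estimate. -/
lemma lintegral_avg_sub_le (hΨ : IsKernel Ψ) {h : ℝ → ℝ} {C V : ℝ} (hh : Measurable h)
    (hC : ∀ x, |h x| ≤ C) (hV0 : 0 ≤ V) (hV : HasModulus V h) :
    ∫⁻ z, ‖avg Ψ h z - h z‖ₑ ≤ ENNReal.ofReal (V * firstMoment Ψ) := by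
  have h1 : ∀ z, avg Ψ h z - h z = ∫ ζ in Ioi (0 : ℝ), Ψ ζ * (h (z + ζ) - h z) := fun z => by
    have h2 : avg Ψ h z - h z = avg Ψ h z - avg Ψ (fun _ => h z) z := by rw [hΨ.avg_const]
    rw [h2, avg, avg, ← integral_sub
      (hΨ.integrable_mul (g := fun ζ => h (z + ζ)) (by fun_prop) fun x => hC _)
      (hΨ.integrable_mul measurable_const fun _ => hC z)]
    simp only [mul_sub]
  simp only [h1]
  refine (hΨ.lintegral_avg_le (k := fun z ζ => h (z + ζ) - h z)
    (by simp only [Function.uncurry_def]; fun_prop)).trans ?_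
  calc ∫⁻ ζ in Ioi (0 : ℝ), ‖Ψ ζ‖ₑ * ∫⁻ z, ‖h (z + ζ) - h z‖ₑ
      ≤ ∫⁻ ζ in Ioi (0 : ℝ), ENNReal.ofReal (V * (ζ * Ψ ζ)) := by
        refine setLIntegral_mono' measurableSet_Ioi fun ζ hζ => ?_
        have hζ0 : 0 < ζ := hζ
        refine (mul_le_mul_right (hV ζ) _).trans_eq ?_
        rw [Real.enorm_of_nonneg (hΨ.nonneg ζ hζ0.le), ← ENNReal.ofReal_mul (hΨ.nonneg ζ hζ0.le),
          abs_of_pos hζ0]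
        congr 1; ring
    _ = _ := by
        rw [← ofReal_integral_eq_lintegral_ofReal (hΨ.moment.const_mul V), integral_const_mul,
          firstMoment]
        filter_upwards [ae_restrict_mem measurableSet_Ioi] with ζ hζ
        have hζ0 : (0 : ℝ) < ζ := hζ
        exact mul_nonneg hV0 (mul_nonneg hζ0.le (hΨ.nonneg ζ hζ0.le))

end IsKernel

/-! ### Translation moduli -/

lemma HasModulus.comp {h G : ℝ → ℝ} {V : ℝ} {L : NNReal} (hV : HasModulus V h)
    (hG : LipschitzWith L G) : HasModulus (L * V) fun z => G (h z) := by
  intro x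
  calc ∫⁻ z, ‖G (h (z + x)) - G (h z)‖ₑ ≤ ∫⁻ z, L * ‖h (z + x) - h z‖ₑ :=
        lintegral_mono fun z => by simpa [edist_eq_enorm_sub] using hG (h (z + x)) (h z)
    _ = L * ∫⁻ z, ‖h (z + x) - h z‖ₑ := lintegral_const_mul' _ _ (by simp)
    _ ≤ L * ENNReal.ofReal (V * |x|) := by gcongr; exact hV x
    _ = _ := by
      rw [mul_assoc, ENNReal.ofReal_mul (p := (L : ℝ)) L.coe_nonneg, ENNReal.ofReal_coe_nnreal]

/-- Increments of g are dominated by those of its variation function F, which is monotone and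
bounded by the total variation B. Integrals of increments of F telescope. -/
lemma hasModulus_of_boundedVariation {g : ℝ → ℝ} (hg : BoundedVariationOn g univ) :
    ∃ V, 0 ≤ V ∧ HasModulus V g := by
  have hloc := hg.locallyBoundedVariationOn
  set F := variationOnFromTo g univ 0 with hF
  have hmono : Monotone F := by
    have := variationOnFromTo.monotoneOn hloc (mem_univ (0 : ℝ))
    exact monotoneOn_univ.1 this
  set B := (eVariationOn g univ).toReal with hB
  have hFB : ∀ x, |F x| ≤ B := fun x => by
    have key : ∀ a b, (eVariationOn g (univ ∩ Icc a b)).toReal ≤ B := fun a b =>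
      ENNReal.toReal_mono hg (eVariationOn.mono _ inter_subset_left)
    rcases le_total 0 x with h | h
    · rw [hF, variationOnFromTo.eq_of_le _ _ h, abs_of_nonneg ENNReal.toReal_nonneg]
      exact key _ _
    · rw [hF, variationOnFromTo.eq_of_ge _ _ h, abs_neg, abs_of_nonneg ENNReal.toReal_nonneg]
      exact key _ _
  have hgF : ∀ a b, a ≤ b → |g b - g a| ≤ F b - F a := fun a b hab => by
    have h1 : F b - F a = variationOnFromTo g univ a b := by
      rw [hF, ← variationOnFromTo.add hloc (mem_univ (0 : ℝ)) (mem_univ a) (mem_univ b)]; ring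
    rw [h1]
    rw [variationOnFromTo.eq_of_le _ _ hab, ← Real.dist_eq, dist_edist]
    refine ENNReal.toReal_mono (hloc a b (mem_univ _) (mem_univ _)) ?_
    exact eVariationOn.edist_le _ (by simp [hab]) (by simp [hab])
  have hB0 : 0 ≤ B := ENNReal.toReal_nonneg
  have hgm : Measurable g := by
    obtain ⟨p, q, hp, hq, rfl⟩ := hloc.exists_monotoneOn_sub_monotoneOn
    exact (monotoneOn_univ.1 hp).measurable.sub (monotoneOn_univ.1 hq).measurable
  have hi : ∀ a b, IntervalIntegrable F volume a b := fun a b => hmono.intervalIntegrable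
  have pos : ∀ x, 0 ≤ x → ∫⁻ z, ‖g (z + x) - g z‖ₑ ≤ ENNReal.ofReal (2 * B * |x|) := by
    intro x hx
    have hlim := (aecover_Ioc (μ := (volume : Measure ℝ)) tendsto_neg_atTop_atBot
      tendsto_id).lintegral_tendsto_of_countably_generated
      (f := fun z => ‖g (z + x) - g z‖ₑ) (by fun_prop)
    refine le_of_tendsto hlim ?_
    filter_upwards [eventually_ge_atTop (0 : ℝ)] with R hR
    have hRR : -R ≤ R := by linarith
    have hix : IntervalIntegrable (fun z => F (z + x)) volume (-R) R := by
      have : Monotone fun z => F (z + x) := fun a b h => hmono (by linarith)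
      exact this.intervalIntegrable
    calc ∫⁻ z in Ioc (-R) (id R), ‖g (z + x) - g z‖ₑ
        ≤ ∫⁻ z in Ioc (-R) R, ENNReal.ofReal (F (z + x) - F z) := by
          refine lintegral_mono fun z => ?_
          rw [← ofReal_norm]
          exact ENNReal.ofReal_le_ofReal (hgF _ _ (by linarith))
      _ = ENNReal.ofReal (∫ z in (-R)..R, (F (z + x) - F z)) := by
          rw [intervalIntegral.integral_of_le hRR, ofReal_integral_eq_lintegral_ofReal]
          · exact (hix.sub (hi _ _)).1
          · exact ae_of_all _ fun z => sub_nonneg.2 (hmono (by linarith))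
      _ ≤ _ := by
          refine ENNReal.ofReal_le_ofReal ?_
          -- After telescoping, only two intervals of length x at the ends of [-R, R] remain. Each
          -- contributes at most B x, whence the constant 2B, independent of R.
          rw [intervalIntegral.integral_sub hix (hi _ _),
            intervalIntegral.integral_comp_add_right,
            intervalIntegral.integral_interval_sub_interval_comm' (hi _ _) (hi _ _) (hi _ _)]
          have b1 := intervalIntegral.norm_integral_le_of_norm_le_const (a := R) (b := R + x)
            (f := F) (C := B) fun t _ => hFB t
          have b2 := intervalIntegral.norm_integral_le_of_norm_le_const (a := -R) (b := -R + x)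
            (f := F) (C := B) fun t _ => hFB t
          simp only [add_sub_cancel_left, Real.norm_eq_abs] at b1 b2
          have c1 := (abs_le.1 b1).2
          have c2 := (abs_le.1 b2).1
          linarith
  refine ⟨2 * B, by positivity, fun x => ?_⟩
  rcases le_total 0 x with hx | hx
  · exact pos x hx
  · have := pos (-x) (by linarith)
    rw [abs_neg] at this
    rw [← lintegral_add_right_eq_self _ x] at this
    refine le_trans (le_of_eq ?_) this
    refine lintegral_congr fun z => ?_
    rw [← enorm_neg]; simp

/-! ### Right Dini derivatives -/

lemma tendsto_add_nhdsGT {t T : ℝ} (ht : t ∈ Ico 0 T) :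
    Tendsto (fun h => t + h) (𝓝[>] 0) (𝓝[Icc 0 T] t) := by
  refine tendsto_nhdsWithin_iff.2 ⟨?_, ?_⟩
  · have : Tendsto (fun h => t + h) (𝓝 0) (𝓝 t) :=
      (continuous_const.add continuous_id).tendsto' 0 t (by simp)
    exact this.mono_left nhdsWithin_le_nhds
  · filter_upwards [Ioo_mem_nhdsGT (sub_pos.2 ht.2)] with h hh
    exact ⟨by linarith [ht.1, hh.1], by linarith [hh.2]⟩

lemma eventually_norm_sub_smul_le {E : Type*} [NormedAddCommGroup E] [NormedSpace ℝ E]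
    {u : ℝ → E} {u' : E} {t T : ℝ} (ht : t ∈ Ico 0 T) (hu : HasDerivWithinAt u u' (Icc 0 T) t)
    {ε : ℝ} (hε : 0 < ε) :
    ∀ᶠ h in 𝓝[>] (0 : ℝ), ‖u (t + h) - u t - h • u'‖ ≤ h * ε := by
  have h1 := (hasDerivWithinAt_iff_tendsto.1 hu).comp (tendsto_add_nhdsGT ht)
  filter_upwards [h1.eventually (gt_mem_nhds hε), self_mem_nhdsWithin] with h hh h0
  have h0' : 0 < h := h0
  simp only [Function.comp_apply, add_sub_cancel_left, Real.norm_eq_abs, abs_of_pos h0'] at hh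
  rw [inv_mul_lt_iff₀ h0'] at hh
  exact hh.le

/-- Gronwall for functions that need not be differentiable: the differential inequality is required
only for small forward increments and up to an arbitrary ε. Both the invariance argument and the
doubling argument end here. -/
lemma le_of_right_dini {f : ℝ → ℝ} {K e T : ℝ} (hK : 0 < K) (he : 0 ≤ e)
    (hf : ContinuousOn f (Icc 0 T))
    (hd : ∀ t ∈ Ico 0 T, ∀ ε > 0, ∀ᶠ h in 𝓝[>] (0 : ℝ), f (t + h) ≤ f t + h * (K * f t + e + ε)) :
    ∀ t ∈ Icc 0 T, f t ≤ (f 0 + e * t) * Real.exp (K * t) := by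
  intro t ht
  have key := le_gronwallBound_of_liminf_deriv_right_le (f' := fun t => K * f t + e) (δ := f 0)
    (K := K) (ε := e) hf ?_ le_rfl (fun _ _ => le_rfl) t ht
  · rw [sub_zero, gronwallBound_of_K_ne_0 hK.ne'] at key
    have h1 := Real.add_one_le_exp (-(K * t))
    -- From 1 - exp(-Kt) ≤ Kt; it trades the factor 1/K of Gronwall's bound for t.
    have h2 : Real.exp (K * t) - 1 ≤ K * t * Real.exp (K * t) := by
      have h3 := mul_le_mul_of_nonneg_right h1 (Real.exp_pos (K * t)).le
      rw [← Real.exp_add] at h3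
      simp only [neg_add_cancel, Real.exp_zero] at h3
      linarith
    have h4 : e / K * (Real.exp (K * t) - 1) ≤ e / K * (K * t * Real.exp (K * t)) :=
      mul_le_mul_of_nonneg_left h2 (by positivity)
    have h5 : e / K * (K * t * Real.exp (K * t)) = e * t * Real.exp (K * t) := by
      field_simp
    simp only at key
    linarith
  · intro x hx r hr
    refine Eventually.frequently ?_
    have h1 := hd x hx ((r - (K * f x + e)) / 2) (by linarith)
    have h2 : Tendsto (fun z => z - x) (𝓝[>] x) (𝓝[>] 0) := by
      refine tendsto_nhdsWithin_iff.2 ⟨?_, ?_⟩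
      · have : Tendsto (fun z => z - x) (𝓝 x) (𝓝 0) :=
          (continuous_id.sub continuous_const).tendsto' x 0 (by simp)
        exact this.mono_left nhdsWithin_le_nhds
      · filter_upwards [self_mem_nhdsWithin] with z hz
        have hz' : x < z := hz
        exact sub_pos.2 hz'
    filter_upwards [h2.eventually h1, self_mem_nhdsWithin] with z hz hz0
    have hz0' : x < z := hz0
    rw [inv_mul_lt_iff₀ (sub_pos.2 hz0')]
    rw [add_sub_cancel] at hz
    nlinarith

/-- Invariance of a closed convex set under the flow of a Lipschitz vector field `F`, if some
Euler step `x ↦ x + δ F x` leaves it invariant. -/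
lemma mem_of_euler_invariant {E : Type*} [NormedAddCommGroup E] [NormedSpace ℝ E]
    {F : E → E} {L : ℝ≥0} (hF : LipschitzWith L F) {S : Set E} (hS : IsClosed S)
    (hconv : Convex ℝ S) {δ : ℝ} (hδ : 0 < δ) (hE : ∀ x ∈ S, x + δ • F x ∈ S) {T : ℝ} {u : ℝ → E}
    (hu : ∀ t ∈ Icc 0 T, HasDerivWithinAt u (F (u t)) (Icc 0 T) t) (h0 : u 0 ∈ S) :
    ∀ t ∈ Icc 0 T, u t ∈ S := by
  have hne : S.Nonempty := ⟨_, h0⟩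
  have hc : ContinuousOn u (Icc 0 T) := fun t ht => (hu t ht).continuousWithinAt
  -- The distance d from u(t) to S obeys d(t+h) ≤ (1 + hL) d(t) + hε and starts at 0. The rate is `L
  -- + 1` because the Gronwall lemma asks for a positive one.
  have key := le_of_right_dini (f := fun t => Metric.infDist (u t) S) (K := L + 1) (e := 0)
    (T := T) (by positivity) le_rfl ((Metric.continuous_infDist_pt S).comp_continuousOn hc) ?_
  · intro t ht
    have h1 := key t ht
    simp only [Metric.infDist_zero_of_mem h0, zero_mul, add_zero] at h1
    exact (hS.mem_iff_infDist_zero hne).2 (le_antisymm h1 Metric.infDist_nonneg)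
  · intro t ht ε hε
    filter_upwards [eventually_norm_sub_smul_le ht (hu t (Ico_subset_Icc_self ht)) hε,
      Ioo_mem_nhdsGT hδ] with h hh hhδ
    have h0 := hhδ.1
    have step : ∀ p ∈ S, Metric.infDist (u (t + h)) S ≤ h * ε + (1 + h * L) * dist (u t) p := by
      intro p hp
      -- For h ≤ δ the step of size h is a convex combination of p and the full step of size δ.
      have hmem : p + h • F p ∈ S := by
        have : p + h • F p = (1 - h / δ) • p + (h / δ) • (p + δ • F p) := by
          rw [smul_add, smul_smul, div_mul_cancel₀ _ hδ.ne']; module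
        rw [this]
        exact hconv hp (hE p hp) (by rw [sub_nonneg, div_le_one hδ]; exact hhδ.2.le)
          (by positivity) (by ring)
      refine (Metric.infDist_le_dist_of_mem hmem).trans ?_
      rw [dist_eq_norm]
      have e : u (t + h) - (p + h • F p)
          = (u (t + h) - u t - h • F (u t)) + ((u t - p) + h • (F (u t) - F p)) := by module
      rw [e]
      have h2 := hF.dist_le_mul (u t) p
      rw [dist_eq_norm, dist_eq_norm] at h2
      calc _ ≤ h * ε + (‖u t - p‖ + ‖h • (F (u t) - F p)‖) :=
            (norm_add_le _ _).trans (add_le_add hh (norm_add_le _ _))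
        _ ≤ h * ε + (‖u t - p‖ + h * (L * ‖u t - p‖)) := by
            rw [norm_smul, Real.norm_of_nonneg h0.le]; gcongr
        _ = _ := by rw [dist_eq_norm]; ring
    have h3 : Metric.infDist (u (t + h)) S
        ≤ h * ε + (1 + h * L) * Metric.infDist (u t) S := by
      have h4 : (Metric.infDist (u (t + h)) S - h * ε) / (1 + h * L) ≤ Metric.infDist (u t) S := by
        rw [Metric.le_infDist hne]
        intro p hp
        rw [div_le_iff₀ (by positivity)]
        linarith [step p hp]
      rw [div_le_iff₀ (by positivity)] at h4
      linarith
    have h5 : 0 ≤ Metric.infDist (u t) S := Metric.infDist_nonneg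
    nlinarith

/-! ### The filtered equation as an ordinary differential equation -/

section Jump

variable (ν : Measure ℝ) [IsFiniteMeasure ν]

lemma continuous_integral_shift (h : ℝ →ᵇ ℝ) : Continuous fun z => ∫ ζ, h (z + ζ) ∂ν :=
  continuous_of_dominated (bound := fun _ => ‖h‖) (fun z => by fun_prop)
    (fun z => ae_of_all _ fun ζ => h.norm_coe_le_norm _) (integrable_const _)
    (ae_of_all _ fun ζ => by fun_prop)

lemma integrable_shift (h : ℝ →ᵇ ℝ) (z : ℝ) : Integrable (fun ζ => h (z + ζ)) ν :=
  (integrable_const ‖h‖).mono' (by fun_prop) (ae_of_all _ fun ζ => h.norm_coe_le_norm _)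

/-- The generator `h ↦ ∫ (h(· + ζ) - h) dν(ζ)` of the jump process with jump measure `ν`. -/
noncomputable def jump (h : ℝ →ᵇ ℝ) : ℝ →ᵇ ℝ :=
  BoundedContinuousFunction.ofNormedAddCommGroup
    (fun z => (∫ ζ, h (z + ζ) ∂ν) - ν.real univ * h z)
    ((continuous_integral_shift ν h).sub (h.continuous.const_mul _)) (2 * ν.real univ * ‖h‖) (by
      intro z
      have h1 : ‖∫ ζ, h (z + ζ) ∂ν‖ ≤ ‖h‖ * ν.real univ :=
        norm_integral_le_of_norm_le_const (ae_of_all _ fun ζ => h.norm_coe_le_norm _)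
      have h2 : ‖ν.real univ * h z‖ ≤ ν.real univ * ‖h‖ := by
        rw [norm_mul, Real.norm_of_nonneg measureReal_nonneg]
        exact mul_le_mul_of_nonneg_left (h.norm_coe_le_norm z) measureReal_nonneg
      calc _ ≤ _ := norm_sub_le _ _
        _ ≤ _ := by linarith)

lemma jump_apply (h : ℝ →ᵇ ℝ) (z : ℝ) :
    jump ν h z = (∫ ζ, h (z + ζ) ∂ν) - ν.real univ * h z := rfl

lemma jump_apply' (h : ℝ →ᵇ ℝ) (z : ℝ) : jump ν h z = ∫ ζ, (h (z + ζ) - h z) ∂ν := by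
  rw [jump_apply, integral_sub (integrable_shift ν h z) (integrable_const _)]
  simp

lemma norm_jump_le (h : ℝ →ᵇ ℝ) : ‖jump ν h‖ ≤ 2 * ν.real univ * ‖h‖ :=
  BoundedContinuousFunction.norm_ofNormedAddCommGroup_le _ (by positivity) _

lemma jump_sub (g h : ℝ →ᵇ ℝ) : jump ν (g - h) = jump ν g - jump ν h := by
  ext z
  simp only [jump_apply, BoundedContinuousFunction.coe_sub, Pi.sub_apply]
  rw [integral_sub (integrable_shift ν g z) (integrable_shift ν h z)]
  ring

lemma lipschitz_jump : LipschitzWith (2 * ν.real univ).toNNReal (jump ν) :=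
  LipschitzWith.of_dist_le_mul fun g h => by
    rw [dist_eq_norm, dist_eq_norm, ← jump_sub, Real.coe_toNNReal _ (by positivity)]
    exact norm_jump_le ν _

variable {G : ℝ → ℝ} {L : ℝ≥0} (hG : LipschitzWith L G)

/-- The vector field `u ↦ ∫ (G(u(· + ζ)) - G(u)) dν(ζ)` of the filtered equation. -/
noncomputable def jumpField (u : ℝ →ᵇ ℝ) : ℝ →ᵇ ℝ := jump ν (u.comp G hG)

lemma lipschitz_jumpField : LipschitzWith ((2 * ν.real univ).toNNReal * L) (jumpField ν hG) :=
  (lipschitz_jump ν).comp (BoundedContinuousFunction.lipschitz_comp hG)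

lemma norm_jumpField_le {C : ℝ} (hC : ∀ x, |G x| ≤ C) (u : ℝ →ᵇ ℝ) :
    ‖jumpField ν hG u‖ ≤ 2 * ν.real univ * C := by
  refine (norm_jump_le ν _).trans (mul_le_mul_of_nonneg_left ?_ (by positivity))
  exact (BoundedContinuousFunction.norm_le ((abs_nonneg _).trans (hC 0))).2 fun x => hC _

/-- The field is bounded, so a ball of radius speed times T cannot be left before time T and
Picard-Lindelöf reaches the end of the interval at once. -/
lemma exists_jump_trajectory {C : ℝ} (hC : ∀ x, |G x| ≤ C) {T : ℝ} (hT : 0 ≤ T) (u₀ : ℝ →ᵇ ℝ) :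
    ∃ u : ℝ → ℝ →ᵇ ℝ, u 0 = u₀ ∧
      ∀ t ∈ Icc 0 T, HasDerivWithinAt u (jumpField ν hG (u t)) (Icc 0 T) t := by
  have hC0 : 0 ≤ C := (abs_nonneg _).trans (hC 0)
  have hpl : IsPicardLindelof (fun _ => jumpField ν hG) (tmin := 0) (tmax := T)
      ⟨0, left_mem_Icc.2 hT⟩ u₀ (2 * ν.real univ * C * T).toNNReal 0 (2 * ν.real univ * C).toNNReal
      ((2 * ν.real univ).toNNReal * L) := by
    refine ⟨fun t _ => (lipschitz_jumpField ν hG).lipschitzOnWith, fun x _ => continuousOn_const,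
      fun t _ x _ => ?_, ?_⟩
    · rw [Real.coe_toNNReal _ (by positivity)]
      exact norm_jumpField_le ν hG hC x
    · rw [Real.coe_toNNReal _ (by positivity), Real.coe_toNNReal _ (by positivity)]
      simp [hT]
  exact hpl.exists_eq_forall_mem_Icc_hasDerivWithinAt₀

/-- The bounds `a ≤ u ≤ b` and the translation modulus `V`. -/
def regularSet (a b V : ℝ) : Set (ℝ →ᵇ ℝ) := {u | (∀ z, u z ∈ Icc a b) ∧ HasModulus V u}

lemma convex_regularSet {a b V : ℝ} : Convex ℝ (regularSet a b V) := by
  intro u hu v hv s t hs ht hst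
  refine ⟨fun z => convex_Icc a b (hu.1 z) (hv.1 z) hs ht hst, fun x => ?_⟩
  calc ∫⁻ z, ‖(s • u + t • v) (z + x) - (s • u + t • v) z‖ₑ
      ≤ ∫⁻ z, (‖s‖ₑ * ‖u (z + x) - u z‖ₑ + ‖t‖ₑ * ‖v (z + x) - v z‖ₑ) := by
        refine lintegral_mono fun z => ?_
        have : (s • u + t • v) (z + x) - (s • u + t • v) z
            = s * (u (z + x) - u z) + t * (v (z + x) - v z) := by
          simp; ring
        rw [this]
        exact (enorm_add_le _ _).trans (by rw [enorm_mul, enorm_mul])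
    _ = ‖s‖ₑ * (∫⁻ z, ‖u (z + x) - u z‖ₑ) + ‖t‖ₑ * ∫⁻ z, ‖v (z + x) - v z‖ₑ := by
        rw [lintegral_add_left (by fun_prop), lintegral_const_mul' _ _ (by simp),
          lintegral_const_mul' _ _ (by simp)]
    _ ≤ ‖s‖ₑ * ENNReal.ofReal (V * |x|) + ‖t‖ₑ * ENNReal.ofReal (V * |x|) := by
        gcongr
        exacts [hu.2 x, hv.2 x]
    _ = _ := by
        rw [← add_mul, Real.enorm_of_nonneg hs, Real.enorm_of_nonneg ht, ← ENNReal.ofReal_add hs ht,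
          hst]
        simp

/-- Fatou's lemma applied to the increments. -/
lemma hasModulus_of_tendsto {u : ℕ → ℝ → ℝ} {v : ℝ → ℝ} {V : ℝ} (hu : ∀ n, HasModulus V (u n))
    (hm : ∀ n, Measurable (u n)) (hlim : ∀ᵐ z, Tendsto (fun n => u n z) atTop (𝓝 (v z))) :
    HasModulus V v := by
  intro x
  have h1 : ∀ᵐ z, Tendsto (fun n => u n (z + x)) atTop (𝓝 (v (z + x))) :=
    (measurePreserving_add_right volume x).quasiMeasurePreserving.ae hlim
  calc ∫⁻ z, ‖v (z + x) - v z‖ₑ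
      = ∫⁻ z, liminf (fun n => ‖u n (z + x) - u n z‖ₑ) atTop := by
        refine lintegral_congr_ae ?_
        filter_upwards [hlim, h1] with z hz hz1
        exact ((hz1.sub hz).enorm.liminf_eq).symm
    _ ≤ liminf (fun n => ∫⁻ z, ‖u n (z + x) - u n z‖ₑ) atTop :=
        lintegral_liminf_le fun n => by have := hm n; fun_prop
    _ ≤ _ := by
        refine liminf_le_of_frequently_le' (Frequently.of_forall fun n => hu n x)

lemma isClosed_regularSet {a b V : ℝ} : IsClosed (regularSet a b V) := by
  refine IsSeqClosed.isClosed fun u v hu huv => ?_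
  have hpt : ∀ z, Tendsto (fun n => u n z) atTop (𝓝 (v z)) := fun z =>
    ((BoundedContinuousFunction.evalCLM ℝ (β := ℝ) z).continuous.tendsto v).comp huv
  exact ⟨fun z => isClosed_Icc.mem_of_tendsto (hpt z) (Eventually.of_forall fun n => (hu n).1 z),
    hasModulus_of_tendsto (fun n => (hu n).2) (fun n => (u n).continuous.measurable)
      (ae_of_all _ hpt)⟩

/-- Under the step restriction sL ≤ 1 both x - sG(x) and sG(x) are non-decreasing, so their
increments have the same sign and the absolute values add up exactly. This equality carries both the
L¹ contraction of Euler steps and the Kruzhkov inequality. -/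
lemma abs_sub_smul_add {G : ℝ → ℝ} {L : ℝ≥0} (hG : LipschitzWith L G) (hmono : Monotone G) {s : ℝ} (hs : 0 ≤ s) (hsL : s * L ≤ 1) (a b : ℝ) :
    |(a - s * G a) - (b - s * G b)| + s * |G a - G b| = |a - b| := by
  wlog hab : b ≤ a generalizing a b
  · rw [abs_sub_comm a b, ← this b a (le_of_not_ge hab), abs_sub_comm, abs_sub_comm (G a)]
  have h1 : G b ≤ G a := hmono hab
  have h2 : G a - G b ≤ L * (a - b) := by
    have := hG.dist_le_mul a b
    rwa [Real.dist_eq, Real.dist_eq, abs_of_nonneg (sub_nonneg.2 h1),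
      abs_of_nonneg (sub_nonneg.2 hab)] at this
  have h3 : s * (G a - G b) ≤ a - b := by
    calc _ ≤ s * (L * (a - b)) := mul_le_mul_of_nonneg_left h2 hs
      _ = s * L * (a - b) := by ring
      _ ≤ 1 * (a - b) := mul_le_mul_of_nonneg_right hsL (sub_nonneg.2 hab)
      _ = _ := one_mul _
  rw [abs_of_nonneg (by linarith), abs_of_nonneg (sub_nonneg.2 h1), abs_of_nonneg (by linarith)]
  ring

/-- The step is u - δcG(u) plus δ∫G(u(· + ζ))dν. What the first part loses in the increment at z,
the jump part restores, after integration over z, by translation invariance. -/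
lemma euler_mem_regularSet (hmono : Monotone G) {a b V δ : ℝ} (hδ : 0 ≤ δ)
    (hδL : δ * ν.real univ * L ≤ 1) {u : ℝ →ᵇ ℝ} (hu : u ∈ regularSet a b V) :
    u + δ • jumpField ν hG u ∈ regularSet a b V := by
  set c := ν.real univ with hc
  have hc0 : 0 ≤ c := measureReal_nonneg
  have hSu : ∀ z, (u + δ • jumpField ν hG u) z
      = (u z - δ * c * G (u z)) + δ * ∫ ζ, G (u (z + ζ)) ∂ν := fun z => by
    simp only [jumpField, BoundedContinuousFunction.coe_add, BoundedContinuousFunction.coe_smul,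
      Pi.add_apply, jump_apply, BoundedContinuousFunction.comp_apply, smul_eq_mul]
    ring
  have hint : ∀ z, Integrable (fun ζ => G (u (z + ζ))) ν := fun z =>
    integrable_shift ν (u.comp G hG) z
  refine ⟨fun z => ?_, fun x => ?_⟩
  · rw [hSu]
    have hz := hu.1 z
    have h1 : c * G a ≤ ∫ ζ, G (u (z + ζ)) ∂ν := by
      have := integral_mono (integrable_const (G a)) (hint z) fun ζ => hmono (hu.1 (z + ζ)).1
      simpa using this
    have h2 : ∫ ζ, G (u (z + ζ)) ∂ν ≤ c * G b := by
      have := integral_mono (hint z) (integrable_const (G b)) fun ζ => hmono (hu.1 (z + ζ)).2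
      simpa using this
    have k : ∀ x y, x ≤ y → δ * c * (G y - G x) ≤ y - x := fun x y hxy => by
      have := abs_sub_smul_add hG hmono (s := δ * c) (by positivity) hδL y x
      rw [abs_of_nonneg (sub_nonneg.2 (hmono hxy)), abs_of_nonneg (sub_nonneg.2 hxy)] at this
      linarith [abs_nonneg (y - δ * c * G y - (x - δ * c * G x))]
    have k1 := k _ _ hz.1
    have k2 := k _ _ hz.2
    have h1' := mul_le_mul_of_nonneg_left h1 hδ
    have h2' := mul_le_mul_of_nonneg_left h2 hδ
    constructor <;> nlinarith
  · set k : ℝ → ℝ := fun z => G (u (z + x)) - G (u z) with hk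
    have hkm : Measurable k := by
      have := hG.continuous
      have : Continuous k := by fun_prop
      exact this.measurable
    calc ∫⁻ z, ‖(u + δ • jumpField ν hG u) (z + x) - (u + δ • jumpField ν hG u) z‖ₑ
        ≤ ∫⁻ z, (‖(u (z + x) - δ * c * G (u (z + x))) - (u z - δ * c * G (u z))‖ₑ
            + ENNReal.ofReal δ * ∫⁻ ζ, ‖k (z + ζ)‖ₑ ∂ν) := by
          refine lintegral_mono fun z => ?_
          have e : (u + δ • jumpField ν hG u) (z + x) - (u + δ • jumpField ν hG u) z
              = ((u (z + x) - δ * c * G (u (z + x))) - (u z - δ * c * G (u z)))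
                + δ * ∫ ζ, k (z + ζ) ∂ν := by
            have : ∫ ζ, k (z + ζ) ∂ν
                = (∫ ζ, G (u (z + x + ζ)) ∂ν) - ∫ ζ, G (u (z + ζ)) ∂ν := by
              rw [← integral_sub (hint _) (hint _)]
              simp only [hk, add_right_comm]
            rw [hSu, hSu, this]; ring
          rw [e]
          refine (enorm_add_le _ _).trans ?_
          gcongr
          rw [enorm_mul, Real.enorm_of_nonneg hδ]
          gcongr
          exact enorm_integral_le_lintegral_enorm _
      _ = (∫⁻ z, ‖(u (z + x) - δ * c * G (u (z + x))) - (u z - δ * c * G (u z))‖ₑ)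
            + ENNReal.ofReal δ * ∫⁻ z, ∫⁻ ζ, ‖k (z + ζ)‖ₑ ∂ν := by
          rw [lintegral_add_left, lintegral_const_mul' _ _ (by simp)]
          have := hG.continuous
          fun_prop
      _ = (∫⁻ z, ‖(u (z + x) - δ * c * G (u (z + x))) - (u z - δ * c * G (u z))‖ₑ)
            + ∫⁻ z, ENNReal.ofReal (δ * c) * ‖k z‖ₑ := by
          congr 1
          -- Each shift by ζ leaves the L¹ norm of k unchanged, so the integral over ν contributes
          -- just its mass c.
          rw [lintegral_lintegral_swap (by fun_prop)]
          have : ∀ ζ, ∫⁻ z, ‖k (z + ζ)‖ₑ = ∫⁻ z, ‖k z‖ₑ := fun ζ =>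
            lintegral_add_right_eq_self (fun z => ‖k z‖ₑ) ζ
          simp only [this]
          rw [lintegral_const, lintegral_const_mul' _ _ (by simp), ENNReal.ofReal_mul hδ, hc,
            ofReal_measureReal]
          ring
      _ = ∫⁻ z, ‖u (z + x) - u z‖ₑ := by
          rw [← lintegral_add_right _ (by fun_prop)]
          refine lintegral_congr fun z => ?_
          rw [← ofReal_norm, ← ofReal_norm, ← ofReal_norm,
            ← ENNReal.ofReal_mul (by positivity), ← ENNReal.ofReal_add (by positivity)
            (by positivity)]
          congr 1
          exact abs_sub_smul_add hG hmono (s := δ * c) (by positivity) hδL _ _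
      _ ≤ _ := hu.2 x

lemma jump_trajectory_mem_regularSet (hmono : Monotone G) {a b V T : ℝ} {u : ℝ → ℝ →ᵇ ℝ}
    (hu : ∀ t ∈ Icc 0 T, HasDerivWithinAt u (jumpField ν hG (u t)) (Icc 0 T) t)
    (h0 : u 0 ∈ regularSet a b V) : ∀ t ∈ Icc 0 T, u t ∈ regularSet a b V := by
  refine mem_of_euler_invariant (lipschitz_jumpField ν hG) isClosed_regularSet convex_regularSet
    -- This size satisfies δ c L ≤ 1; the summand 1 covers c L = 0.
    (δ := (ν.real univ * L + 1)⁻¹) (by positivity)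
    (fun x hx => euler_mem_regularSet ν hG hmono (by positivity) ?_ hx) hu h0
  rw [mul_assoc, inv_mul_le_iff₀ (by positivity)]
  linarith

/-- The field commutes with translations, so a translate of a trajectory is a trajectory. Continuous
dependence on the data then propagates the Lipschitz constant with a factor exp(ΛT). -/
lemma jump_trajectory_lipschitz {T : ℝ} {u : ℝ → ℝ →ᵇ ℝ}
    (hu : ∀ t ∈ Icc 0 T, HasDerivWithinAt u (jumpField ν hG (u t)) (Icc 0 T) t) {K : ℝ≥0}
    (h0 : LipschitzWith K (u 0)) : ∃ K', ∀ t ∈ Icc 0 T, LipschitzWith K' (u t) := by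
  obtain ⟨Λ, hΛ⟩ : ∃ Λ, LipschitzWith Λ (jumpField ν hG) := ⟨_, lipschitz_jumpField ν hG⟩
  have hc : ContinuousOn u (Icc 0 T) := fun t ht => (hu t ht).continuousWithinAt
  have hu' : ∀ t ∈ Ico 0 T, HasDerivWithinAt u (jumpField ν hG (u t)) (Ici t) t := fun t ht =>
    (hu t (Ico_subset_Icc_self ht)).mono_of_mem_nhdsWithin (Icc_mem_nhdsGE_of_mem ht)
  refine ⟨K * (Real.exp (Λ * T)).toNNReal, fun t ht =>
    LipschitzWith.of_dist_le_mul fun x y => ?_⟩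
  set τ := BoundedContinuousFunction.compContinuousCLM (𝕜 := ℝ) (β := ℝ)
    (⟨fun z => z + (x - y), by fun_prop⟩ : C(ℝ, ℝ)) with hτ
  have hτa : ∀ (f : ℝ →ᵇ ℝ) z, τ f z = f (z + (x - y)) := fun f z => rfl
  have hcomm : ∀ f : ℝ →ᵇ ℝ, τ (jumpField ν hG f) = jumpField ν hG (τ f) := fun f => by
    ext z
    simp only [jumpField, hτa, jump_apply, BoundedContinuousFunction.comp_apply, add_right_comm]
  have key := dist_le_of_trajectories_ODE (v := fun _ => jumpField ν hG) (K := Λ)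
    (δ := K * |x - y|) (f := fun t => τ (u t)) (g := u) (a := 0) (b := T)
    (fun _ => hΛ)
    (τ.continuous.comp_continuousOn hc)
    (fun s hs => by
      rw [← hcomm]
      exact τ.hasFDerivAt.comp_hasDerivWithinAt s (hu' s hs))
    hc hu' ?_ t ht
  · have h1 := BoundedContinuousFunction.dist_coe_le_dist (f := τ (u t)) (g := u t) y
    rw [hτa, add_sub_cancel] at h1
    refine h1.trans (key.trans ?_)
    rw [NNReal.coe_mul, Real.coe_toNNReal _ (Real.exp_pos _).le, sub_zero, Real.dist_eq x]
    have : Real.exp (Λ * t) ≤ Real.exp (Λ * T) := by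
      apply Real.exp_le_exp.2; gcongr; exact ht.2
    calc _ ≤ K * |x - y| * Real.exp (Λ * T) := by gcongr
      _ = _ := by ring
  · refine (BoundedContinuousFunction.dist_le (by positivity)).2 fun z => ?_
    rw [hτa]
    have := h0.dist_le_mul (z + (x - y)) z
    simpa [Real.dist_eq] using this

end Jump

/-! ### Kruzhkov inequalities in Dini form -/

lemma integrable_bdd_mul {X : Type*} [TopologicalSpace X] [MeasurableSpace X]
    [OpensMeasurableSpace X] {μ : Measure X} [IsFiniteMeasureOnCompacts μ] {f K : X → ℝ} {C : ℝ}
    (hf : AEStronglyMeasurable f μ) (hC : ∀ x, |f x| ≤ C) (hK : Continuous K)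
    (hKc : HasCompactSupport K) : Integrable (fun x => f x * K x) μ :=
  (hK.integrable_of_hasCompactSupport hKc).bdd_mul hf (ae_of_all _ hC)

/-- Curves of measurable functions with values in `[m, M]` that are continuous in `L¹_loc`. -/
structure IsBoundedCurve (m M T : ℝ) (v : ℝ → ℝ → ℝ) : Prop where
  meas : ∀ t ∈ Icc 0 T, Measurable fun z => v z t
  mem : ∀ t ∈ Icc 0 T, ∀ z, v z t ∈ Icc m M
  cont : ∀ t ∈ Icc 0 T, ∀ R > 0, ∀ ε > 0, ∀ᶠ s in 𝓝[Icc 0 T] t,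
    ∫ z in Icc (-R) R, |v z s - v z t| ≤ ε

/-- `∂ₜ|v - k| ≤ ∂_z |G(v) - G(k)|` in the weak sense, as an upper bound for the right Dini
derivatives in time, up to an error `e`. -/
def DiniEntropy (G : ℝ → ℝ) (m M e T : ℝ) (v : ℝ → ℝ → ℝ) : Prop :=
  ∀ t ∈ Ico 0 T, ∀ R > 0, ∀ ε > 0, ∀ᶠ h in 𝓝[>] (0 : ℝ), ∀ k ∈ Icc m M, ∀ χ : ℝ → ℝ,
    ContDiff ℝ ∞ χ → (∀ x, 0 ≤ χ x) → tsupport χ ⊆ Icc (-R) R → ∀ B, (∀ x, χ x ≤ B) →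
    (∀ x, |deriv χ x| ≤ B) →
    ∫ z, |v z (t + h) - k| * χ z ≤ (∫ z, |v z t - k| * χ z)
      - h * (∫ z, |G (v z t) - G k| * deriv χ z) + h * ((e + ε) * B)

lemma lipschitzWith_abs_sub {G : ℝ → ℝ} {L : ℝ≥0} (hG : LipschitzWith L G) (k : ℝ) :
    LipschitzWith L fun x => |G x - k| :=
  LipschitzWith.of_dist_le_mul fun x y => by
    have h1 := hG.dist_le_mul x y
    rw [Real.dist_eq] at h1 ⊢
    refine (abs_abs_sub_abs_le _ _).trans ?_
    simpa using h1

lemma hasCompactSupport_of_tsupport_subset {χ : ℝ → ℝ} {a b : ℝ} (h : tsupport χ ⊆ Icc a b) :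
    HasCompactSupport χ := isCompact_Icc.of_isClosed_subset (isClosed_tsupport χ) h

/-- Integration by parts, with `jump ν h` as the derivative of the average. -/
lemma integral_jump_mul {Ψ : ℝ → ℝ} (hΨ : IsKernel Ψ) {ν : Measure ℝ} [IsFiniteMeasure ν]
    (hν : ∀ᵐ ζ ∂ν, 0 < ζ) (hνΨ : ∀ᵐ x ∂(volume.restrict (Ioi (0 : ℝ))), ν.real (Ioi x) = Ψ x)
    (h : ℝ →ᵇ ℝ) {χ : ℝ → ℝ} (hχ : ContDiff ℝ 1 χ) (hχc : HasCompactSupport χ) :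
    ∫ z, jump ν h z * χ z = -∫ z, avg Ψ h z * deriv χ z := by
  have hb : ∀ x, |h x| ≤ ‖h‖ := h.norm_coe_le_norm
  have hd : ∀ z, HasDerivAt (avg Ψ h) (jump ν h z) z := fun z => by
    rw [jump_apply']
    exact hΨ.hasDerivAt_avg hν hνΨ h.continuous hb z
  have hcont : Continuous (avg Ψ h) := continuous_iff_continuousAt.2 fun z => (hd z).continuousAt
  have hχ' : Continuous (deriv χ) := hχ.continuous_deriv le_rfl
  rw [integral_mul_deriv_eq_deriv_mul_of_integrable (u := avg Ψ h) (v := χ) (u' := jump ν h)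
    (v' := deriv χ) (fun z _ => hd z) (fun z _ => (hχ.differentiable one_ne_zero z).hasDerivAt)
    ((hcont.mul hχ').integrable_of_hasCompactSupport hχc.deriv.mul_left)
    (((jump ν h).continuous.mul hχ.continuous).integrable_of_hasCompactSupport hχc.mul_left)
    ((hcont.mul hχ.continuous).integrable_of_hasCompactSupport hχc.mul_left), neg_neg]

/-- Monotonicity of the Euler step gives |u(t+h) - k| ≤ |u(t) - k| + h J(q) + o(h) pointwise, where
q = |G(u) - G(k)|. Tested against χ, J(q) becomes -∫ avg(q) χ', and replacing avg(q) by q produces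
the error L V `firstMoment Ψ`, because q inherits the modulus LV. -/
lemma jump_trajectory_diniEntropy {Ψ : ℝ → ℝ} (hΨ : IsKernel Ψ) {ν : Measure ℝ}
    [IsFiniteMeasure ν] (hν : ∀ᵐ ζ ∂ν, 0 < ζ)
    (hνΨ : ∀ᵐ x ∂(volume.restrict (Ioi (0 : ℝ))), ν.real (Ioi x) = Ψ x)
    {G : ℝ → ℝ} {L : ℝ≥0} (hG : LipschitzWith L G) (hmono : Monotone G) {m M V T : ℝ} (hV : 0 ≤ V)
    {u : ℝ → ℝ →ᵇ ℝ}
    (hu : ∀ t ∈ Icc 0 T, HasDerivWithinAt u (jumpField ν hG (u t)) (Icc 0 T) t)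
    (hreg : ∀ t ∈ Icc 0 T, u t ∈ regularSet m M V) :
    DiniEntropy G m M (L * V * firstMoment Ψ) T (fun z t => u t z) := by
  intro t ht R hR ε hε
  set c := ν.real univ with hc
  have hc0 : 0 ≤ c := measureReal_nonneg
  -- The uniform remainder h ε/(2R), integrated against χ ≤ B on an interval of length 2R, yields at
  -- most h ε B. The second condition on h ensures h c L ≤ 1.
  filter_upwards [eventually_norm_sub_smul_le ht (hu t (Ico_subset_Icc_self ht))
    (ε := ε / (2 * R)) (by positivity),
    Ioo_mem_nhdsGT (show (0 : ℝ) < (c * L + 1)⁻¹ by positivity)] with h hh hhδ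
  intro k _ χ hχ hχ0 hχR B hχB hχB'
  have h0 : 0 < h := hhδ.1
  have hB : 0 ≤ B := (hχ0 0).trans (hχB 0)
  have hχc := hasCompactSupport_of_tsupport_subset hχR
  have hhc : h * c * L ≤ 1 := by
    have h1 := mul_le_mul_of_nonneg_right hhδ.2.le (show 0 ≤ c * L + 1 by positivity)
    rw [inv_mul_cancel₀ (by positivity)] at h1
    nlinarith
  have hqL := lipschitzWith_abs_sub hG (G k)
  set q : ℝ →ᵇ ℝ := (u t).comp (fun x => |G x - G k|) hqL with hq
  have hqz : ∀ z, q z = |G (u t z) - G k| := fun z => rfl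
  have hpt : ∀ z, |u (t + h) z - k| ≤ |u t z - k| + h * jump ν q z + h * (ε / (2 * R)) := by
    intro z
    have h1 : |u (t + h) z - u t z - h * jumpField ν hG (u t) z| ≤ h * (ε / (2 * R)) := by
      have := (BoundedContinuousFunction.norm_coe_le_norm
        (u (t + h) - u t - h • jumpField ν hG (u t)) z).trans hh
      simpa using this
    -- Discrete Kruzhkov inequality. Constants are fixed by the Euler step, so k may be split in the
    -- same way as u(z), and `abs_sub_smul_add` turns the local part into |u - k| - h c q(z).
    have h2 : |u t z + h * jumpField ν hG (u t) z - k| ≤ |u t z - k| + h * jump ν q z := by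
      have e1 : u t z + h * jumpField ν hG (u t) z - k
          = ((u t z - h * c * G (u t z)) - (k - h * c * G k))
            + h * ∫ ζ, (G (u t (z + ζ)) - G k) ∂ν := by
        have e0 : Integrable (fun ζ => G (u t (z + ζ))) ν :=
          integrable_shift ν ((u t).comp G hG) z
        rw [integral_sub e0 (integrable_const _), jumpField, jump_apply]
        simp only [BoundedContinuousFunction.comp_apply, integral_const, smul_eq_mul]
        ring
      have e2 := abs_sub_smul_add hG hmono (s := h * c) (by positivity) hhc (u t z) k
      have e3 : |∫ ζ, (G (u t (z + ζ)) - G k) ∂ν| ≤ ∫ ζ, q (z + ζ) ∂ν := abs_integral_le_integral_abs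
      rw [e1, jump_apply, hqz]
      calc _ ≤ |(u t z - h * c * G (u t z)) - (k - h * c * G k)|
            + h * |∫ ζ, (G (u t (z + ζ)) - G k) ∂ν| := by
              refine (abs_add_le _ _).trans_eq ?_
              rw [abs_mul, abs_of_pos h0]
        _ ≤ |(u t z - h * c * G (u t z)) - (k - h * c * G k)| + h * ∫ ζ, q (z + ζ) ∂ν := by gcongr
        _ = _ := by rw [← e2]; ring
    have e4 : u (t + h) z - k = (u (t + h) z - u t z - h * jumpField ν hG (u t) z)
        + (u t z + h * jumpField ν hG (u t) z - k) := by ring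
    rw [e4]
    exact (abs_add_le _ _).trans (by linarith)
  have hcχ := hχ.continuous
  have hcχ' : Continuous (deriv χ) := hχ.continuous_deriv (by simp)
  have i1 : ∀ s, Integrable fun z => |u s z - k| * χ z := fun s =>
    (((u s).continuous.sub continuous_const).abs.mul hcχ).integrable_of_hasCompactSupport
      hχc.mul_left
  have i2 : Integrable fun z => jump ν q z * χ z :=
    ((jump ν q).continuous.mul hcχ).integrable_of_hasCompactSupport hχc.mul_left
  have i3 : Integrable χ := hcχ.integrable_of_hasCompactSupport hχc
  have step1 : ∫ z, |u (t + h) z - k| * χ z ≤ (∫ z, |u t z - k| * χ z)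
      + h * (∫ z, jump ν q z * χ z) + h * (ε / (2 * R)) * ∫ z, χ z := by
    have i7 : Integrable fun z => |u t z - k| * χ z + h * (jump ν q z * χ z) :=
      (i1 t).add (i2.const_mul h)
    rw [← integral_const_mul, ← integral_const_mul, ← integral_add (i1 t) (i2.const_mul h),
      ← integral_add i7 (i3.const_mul _)]
    refine integral_mono (i1 _) (i7.add (i3.const_mul _)) fun z => ?_
    have := mul_le_mul_of_nonneg_right (hpt z) (hχ0 z)
    simp only
    linarith
  have hχint : ∫ z, χ z ≤ 2 * R * B := by
    rw [← setIntegral_eq_integral_of_forall_compl_eq_zero (s := Icc (-R) R)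
      (fun z hz => image_eq_zero_of_notMem_tsupport fun h => hz (hχR h))]
    calc _ ≤ ∫ _z in Icc (-R) R, B := setIntegral_mono i3.integrableOn (by simp) hχB
      _ = _ := by
        simp only [integral_const, smul_eq_mul, measureReal_restrict_apply_univ,
          Real.volume_real_Icc]
        rw [max_eq_left (by linarith)]; ring
  have hqb : ∀ x, |q x| ≤ ‖q‖ := q.norm_coe_le_norm
  have hqmod : HasModulus (L * V) q := (hreg t (Ico_subset_Icc_self ht)).2.comp hqL
  have hl := hΨ.lintegral_avg_sub_le q.continuous.measurable hqb (by positivity) hqmod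
  obtain ⟨Ka, hKa⟩ := hΨ.avg_lipschitz q.continuous.measurable hqb
  have i4 : Integrable fun z => avg Ψ q z - q z :=
    ⟨(hKa.continuous.sub q.continuous).aestronglyMeasurable, hl.trans_lt ENNReal.ofReal_lt_top⟩
  have hl' : ∫ z, |avg Ψ q z - q z| ≤ L * V * firstMoment Ψ := by
    have := (ofReal_integral_norm_eq_lintegral_enorm i4).trans_le hl
    exact (ENNReal.ofReal_le_ofReal_iff (by have := hΨ.firstMoment_nonneg; positivity)).1 this
  have i5 : Integrable fun z => avg Ψ q z * deriv χ z :=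
    (hKa.continuous.mul hcχ').integrable_of_hasCompactSupport hχc.deriv.mul_left
  have i6 : Integrable fun z => q z * deriv χ z :=
    (q.continuous.mul hcχ').integrable_of_hasCompactSupport hχc.deriv.mul_left
  have step2 : ∫ z, jump ν q z * χ z
      ≤ -(∫ z, q z * deriv χ z) + L * V * firstMoment Ψ * B := by
    rw [integral_jump_mul hΨ hν hνΨ q (hχ.of_le (by simp)) hχc]
    have h1 : (∫ z, q z * deriv χ z) - (∫ z, avg Ψ q z * deriv χ z)
        ≤ (∫ z, |avg Ψ q z - q z|) * B := by
      rw [← integral_sub i6 i5, ← integral_mul_const]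
      refine integral_mono (i6.sub i5) (i4.abs.mul_const B) fun z => ?_
      simp only
      rw [← sub_mul]
      calc _ ≤ |(q z - avg Ψ q z) * deriv χ z| := le_abs_self _
        _ = |avg Ψ q z - q z| * |deriv χ z| := by rw [abs_mul, abs_sub_comm]
        _ ≤ _ := by gcongr; exact hχB' z
    have h2 := mul_le_mul_of_nonneg_right hl' hB
    linarith
  have step3 : h * (ε / (2 * R)) * ∫ z, χ z ≤ h * (ε * B) := by
    calc _ ≤ h * (ε / (2 * R)) * (2 * R * B) := by gcongr
      _ = _ := by field_simp
  have step4 := mul_le_mul_of_nonneg_left step2 h0.le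
  simp only [hqz] at step4
  calc _ ≤ _ := step1
    _ ≤ _ := by nlinarith

/-! ### Doubling of the space variable -/

lemma abs_sub_le_of_mem_Icc {m M a b : ℝ} (ha : a ∈ Icc m M) (hb : b ∈ Icc m M) :
    |a - b| ≤ M - m :=
  abs_le.2 ⟨by linarith [ha.1, hb.2], by linarith [ha.2, hb.1]⟩

lemma integrable_doubled {G : ℝ → ℝ} {L : ℝ≥0} (hG : LipschitzWith L G) {m M : ℝ} {f g : ℝ → ℝ}
    (hf : Measurable f) (hg : Measurable g) (hfm : ∀ z, f z ∈ Icc m M) (hgm : ∀ z, g z ∈ Icc m M)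
    {K : ℝ × ℝ → ℝ} (hK : Continuous K) (hKc : HasCompactSupport K) :
    Integrable fun p : ℝ × ℝ => |G (f p.1) - G (g p.2)| * K p := by
  have hGm := hG.continuous.measurable
  refine integrable_bdd_mul (C := L * (M - m)) ?_ (fun p => ?_) hK hKc
  · exact Measurable.aestronglyMeasurable (by fun_prop)
  · rw [abs_abs]
    have := hG.dist_le_mul (f p.1) (g p.2)
    rw [Real.dist_eq, Real.dist_eq] at this
    exact this.trans (mul_le_mul_of_nonneg_left (abs_sub_le_of_mem_Icc (hfm _) (hgm _)) L.coe_nonneg)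

lemma hasCompactSupport_of_box {R : ℝ} {K : ℝ × ℝ → ℝ}
    (hKR : ∀ p, p ∉ Icc (-R) R ×ˢ Icc (-R) R → K p = 0) : HasCompactSupport K :=
  HasCompactSupport.intro (isCompact_Icc.prod isCompact_Icc) fun p hp => hKR p hp

/-- Integrated form of the Kruzhkov inequality with a variable constant `k = g y`. -/
lemma DiniEntropy.doubled {G : ℝ → ℝ} {L : ℝ≥0} (hG : LipschitzWith L G) {m M e T : ℝ}
    {v : ℝ → ℝ → ℝ} (hv : IsBoundedCurve m M T v) (hd : DiniEntropy G m M e T v)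
    {t : ℝ} (ht : t ∈ Ico 0 T) {R B : ℝ} (hR : 0 < R) {K K' : ℝ × ℝ → ℝ} (hK : ContDiff ℝ ∞ K)
    (hK0 : ∀ p, 0 ≤ K p) (hKR : ∀ p, p ∉ Icc (-R) R ×ˢ Icc (-R) R → K p = 0)
    (hKd : ∀ z y, HasDerivAt (fun x => K (x, y)) (K' (z, y)) z)
    (hK' : Continuous K') (hKR' : ∀ p, p ∉ Icc (-R) R ×ˢ Icc (-R) R → K' p = 0)
    (hB : ∀ p, K p ≤ B) (hB' : ∀ p, |K' p| ≤ B) {ε : ℝ} (hε : 0 < ε) :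
    ∀ᶠ h in 𝓝[>] (0 : ℝ), ∀ g : ℝ → ℝ, Measurable g → (∀ z, g z ∈ Icc m M) →
      ∫ p : ℝ × ℝ, |v p.1 (t + h) - g p.2| * K p ≤ (∫ p : ℝ × ℝ, |v p.1 t - g p.2| * K p)
        - h * (∫ p : ℝ × ℝ, |G (v p.1 t) - G (g p.2)| * K' p)
        + h * ((e + ε) * B) * (2 * R) := by
  have hKc := hasCompactSupport_of_box hKR
  have hKc' := hasCompactSupport_of_box hKR'
  have htI := Ico_subset_Icc_self ht
  filter_upwards [hd t ht R hR ε hε, self_mem_nhdsWithin,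
    (tendsto_add_nhdsGT ht).eventually self_mem_nhdsWithin] with h hh _ htI' g hg hgm
  have hid : LipschitzWith 1 (id : ℝ → ℝ) := LipschitzWith.id
  have i1 : Integrable fun p : ℝ × ℝ => |v p.1 (t + h) - g p.2| * K p :=
    integrable_doubled hid (hv.meas _ htI') hg (hv.mem _ htI') hgm hK.continuous hKc
  have i2 : Integrable fun p : ℝ × ℝ => |v p.1 t - g p.2| * K p :=
    integrable_doubled hid (hv.meas _ htI) hg (hv.mem _ htI) hgm hK.continuous hKc
  have i3 : Integrable fun p : ℝ × ℝ => |G (v p.1 t) - G (g p.2)| * K' p :=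
    integrable_doubled hG (hv.meas _ htI) hg (hv.mem _ htI) hgm hK' hKc'
  have e1 := integral_prod_symm _ i1
  have e2 := integral_prod_symm _ i2
  have e3 := integral_prod_symm _ i3
  rw [Measure.volume_eq_prod, e1, e2, e3]
  set c := h * ((e + ε) * B) with hc
  -- Only y in [-R, R] contribute, so the error, constant in y, integrates to the factor 2R.
  have hind : Integrable ((Icc (-R) R).indicator fun _ : ℝ => c) :=
    (integrable_indicator_iff measurableSet_Icc).2 (by simp)
  have e4 : ∫ y, (Icc (-R) R).indicator (fun _ : ℝ => c) y = c * (2 * R) := by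
    rw [integral_indicator measurableSet_Icc]
    simp only [integral_const, smul_eq_mul, measureReal_restrict_apply_univ, Real.volume_real_Icc]
    rw [max_eq_left (by linarith)]; ring
  have j2 := i2.integral_prod_right
  have j3 := i3.integral_prod_right.const_mul h
  have j23 : Integrable fun y => (∫ x, |v x t - g y| * K (x, y))
      - h * ∫ x, |G (v x t) - G (g y)| * K' (x, y) := j2.sub j3
  rw [← e4, ← integral_const_mul, ← integral_sub j2 j3, ← integral_add j23 hind]
  refine integral_mono i1.integral_prod_right (j23.add hind) fun y => ?_
  have hderiv : deriv (fun z => K (z, y)) = fun z => K' (z, y) := funext fun z => (hKd z y).deriv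
  by_cases hy : y ∈ Icc (-R) R
  · rw [indicator_of_mem hy]
    -- In `DiniEntropy` the threshold for h is chosen before k and χ, so one h serves every y, with
    -- k = g(y) and χ = K(·, y).
    have := hh (g y) (hgm y) (fun z => K (z, y)) (hK.comp (by fun_prop)) (fun z => hK0 _)
      (closure_minimal (fun z hz => by
        by_contra hzR
        exact hz (hKR _ fun hp => hzR hp.1)) isClosed_Icc) B (fun z => hB _)
      (fun z => by rw [hderiv]; exact hB' _)
    rw [hderiv] at this
    exact this
  · rw [indicator_of_notMem hy]
    have z1 : ∀ z, K (z, y) = 0 := fun z => hKR _ fun hp => hy hp.2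
    have z2 : ∀ z, K' (z, y) = 0 := fun z => hKR' _ fun hp => hy hp.2
    simp [z1, z2]

/-- A smooth probability density supported in `[-r, r]`. -/
structure IsMollifier (ρ : ℝ → ℝ) (r : ℝ) : Prop where
  smooth : ContDiff ℝ ∞ ρ
  nonneg : ∀ x, 0 ≤ ρ x
  eq_zero : ∀ x, x ∉ Icc (-r) r → ρ x = 0
  integral_eq : ∫ x, ρ x = 1

lemma deriv_eq_zero_of_notMem_Icc {ρ : ℝ → ℝ} {a b : ℝ}
    (h0 : ∀ x, x ∉ Icc a b → ρ x = 0) : ∀ x, x ∉ Icc a b → deriv ρ x = 0 := by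
  intro x hx
  have : ρ =ᶠ[𝓝 x] fun _ => 0 := by
    filter_upwards [isClosed_Icc.isOpen_compl.mem_nhds hx] with y hy using h0 y hy
  rw [this.deriv_eq]; simp

lemma exists_isMollifier {r : ℝ} (hr : 0 < r) : ∃ ρ, IsMollifier ρ r := by
  let b : ContDiffBump (0 : ℝ) := ⟨r / 2, r, by linarith, by linarith⟩
  refine ⟨b.normed volume, b.contDiff_normed, fun x => b.nonneg_normed x, fun x hx => ?_,
    b.integral_normed⟩
  by_contra h
  have h1 : x ∈ Function.support (b.normed volume) := h
  rw [b.support_normed_eq, Real.ball_eq_Ioo] at h1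
  have h2 : b.rOut = r := rfl
  rw [h2] at h1
  exact hx ⟨by linarith [h1.1], by linarith [h1.2]⟩

/-- A smooth non-negative weight supported in `[-R, R]` with `|ψ'| ≤ ψ + κ`. -/
structure IsWeight (ψ : ℝ → ℝ) (R κ : ℝ) : Prop where
  smooth : ContDiff ℝ ∞ ψ
  nonneg : ∀ x, 0 ≤ ψ x
  le_one : ∀ x, ψ x ≤ 1
  eq_zero : ∀ x, x ∉ Icc (-R) R → ψ x = 0
  deriv_le : ∀ x, |deriv ψ x| ≤ ψ x + κ

section Doubling

variable {G : ℝ → ℝ} {L : ℝ≥0} {m M T r R κ e₁ e₂ B : ℝ} {ρ ψ : ℝ → ℝ} {v w : ℝ → ℝ → ℝ}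

/-- The doubled distance `∫∫ |f(z) - g(y)| ρ(z - y) ψ(z) dz dy`. -/
noncomputable def doubled (ρ ψ f g : ℝ → ℝ) : ℝ :=
  ∫ p : ℝ × ℝ, |f p.1 - g p.2| * (ρ (p.1 - p.2) * ψ p.1)

lemma mul_eq_zero_of_notMem_box {ρ ψ : ℝ → ℝ} {r R : ℝ} (hr : 0 ≤ r)
    (hρ : ∀ x, x ∉ Icc (-r) r → ρ x = 0) (hψ : ∀ x, x ∉ Icc (-R) R → ψ x = 0) (p : ℝ × ℝ)
    (hp : p ∉ Icc (-(R + r)) (R + r) ×ˢ Icc (-(R + r)) (R + r)) : ρ (p.1 - p.2) * ψ p.1 = 0 := by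
  by_cases h1 : p.1 ∈ Icc (-R) R
  · by_cases h2 : p.1 - p.2 ∈ Icc (-r) r
    · exact absurd ⟨⟨by linarith [h1.1], by linarith [h1.2]⟩,
        ⟨by linarith [h1.1, h2.2], by linarith [h1.2, h2.1]⟩⟩ hp
    · rw [hρ _ h2, zero_mul]
  · rw [hψ _ h1, mul_zero]

lemma volume_real_box (R : ℝ) (hR : 0 ≤ R) :
    (volume : Measure (ℝ × ℝ)).real (Icc (-R) R ×ˢ Icc (-R) R) = (2 * R) ^ 2 := by
  rw [Measure.volume_eq_prod, measureReal_prod_prod, Real.volume_real_Icc,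
    max_eq_left (by linarith)]
  ring

/-- The change of a doubled flux term when `f` is replaced by `f'`. -/
lemma integral_doubled_sub_le (hG : LipschitzWith L G) {f f' g : ℝ → ℝ}
    (hf : Measurable f) (hf' : Measurable f') (hg : Measurable g) (hfm : ∀ z, f z ∈ Icc m M)
    (hfm' : ∀ z, f' z ∈ Icc m M) (hgm : ∀ z, g z ∈ Icc m M) (hR : 0 < R)
    {K : ℝ × ℝ → ℝ} (hK : Continuous K) (hKR : ∀ p, p ∉ Icc (-R) R ×ˢ Icc (-R) R → K p = 0)
    (hB : ∀ p, |K p| ≤ B) :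
    (∫ p : ℝ × ℝ, |G (f p.1) - G (g p.2)| * K p) - (∫ p : ℝ × ℝ, |G (f' p.1) - G (g p.2)| * K p)
      ≤ L * B * (2 * R) * ∫ z in Icc (-R) R, |f' z - f z| := by
  have hKc := hasCompactSupport_of_box hKR
  have hB0 : 0 ≤ B := (abs_nonneg _).trans (hB 0)
  have i1 := integrable_doubled hG hf hg hfm hgm hK hKc
  have i2 := integrable_doubled hG hf' hg hfm' hgm hK hKc
  rw [← integral_sub i1 i2, ← setIntegral_eq_integral_of_forall_compl_eq_zero
    (s := Icc (-R) R ×ˢ Icc (-R) R) (fun p hp => by simp [hKR p hp])]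
  have i3 : IntegrableOn (fun z => |f' z - f z|) (Icc (-R) R) :=
    Measure.integrableOn_of_bounded (M := M - m) (by simp) (by fun_prop)
      (ae_of_all _ fun z => by
        rw [Real.norm_eq_abs, abs_abs]; exact abs_sub_le_of_mem_Icc (hfm' z) (hfm z))
  have i4 : IntegrableOn (fun p : ℝ × ℝ => L * B * (|f' p.1 - f p.1| * 1))
      (Icc (-R) R ×ˢ Icc (-R) R) := by
    rw [IntegrableOn, Measure.volume_eq_prod, ← Measure.prod_restrict]
    exact (i3.mul_prod (g := fun _ => (1 : ℝ)) (integrable_const _)).const_mul _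
  have e1 : ∫ p in Icc (-R) R ×ˢ Icc (-R) R, L * B * (|f' p.1 - f p.1| * (1 : ℝ))
      = L * B * (2 * R) * ∫ z in Icc (-R) R, |f' z - f z| := by
    rw [integral_const_mul, Measure.volume_eq_prod,
      setIntegral_prod_mul (fun z => |f' z - f z|) (fun _ => (1 : ℝ))]
    simp only [integral_const, smul_eq_mul, measureReal_restrict_apply_univ, Real.volume_real_Icc,
      mul_one]
    rw [max_eq_left (by linarith)]; ring
  rw [← e1]
  refine setIntegral_mono (i1.sub i2).integrableOn i4 fun p => ?_
  have h1 : |G (f p.1) - G (g p.2)| - |G (f' p.1) - G (g p.2)| ∈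
      Icc (-(L * |f' p.1 - f p.1|)) (L * |f' p.1 - f p.1|) := by
    have h2 := hG.dist_le_mul (f' p.1) (f p.1)
    rw [Real.dist_eq, Real.dist_eq] at h2
    have h3 := abs_abs_sub_abs_le (G (f p.1) - G (g p.2)) (G (f' p.1) - G (g p.2))
    rw [sub_sub_sub_cancel_right] at h3
    exact abs_le.1 (h3.trans ((abs_sub_comm _ _).trans_le h2))
  simp only
  rw [← sub_mul, mul_one]
  calc _ ≤ |(|G (f p.1) - G (g p.2)| - |G (f' p.1) - G (g p.2)|) * K p| := le_abs_self _
    _ = |(|G (f p.1) - G (g p.2)| - |G (f' p.1) - G (g p.2)|)| * |K p| := abs_mul _ _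
    _ ≤ (L * |f' p.1 - f p.1|) * B := by
        gcongr
        exacts [abs_le.2 h1, hB p]
    _ = _ := by ring

lemma continuousOn_doubled (hρ : IsMollifier ρ r) (hr : 0 < r) (hψ : IsWeight ψ R κ) (hR : 0 < R)
    (hv : IsBoundedCurve m M T v) (hw : IsBoundedCurve m M T w) (hB : ∀ x, ρ x ≤ B) :
    ContinuousOn (fun t => doubled ρ ψ (fun z => v z t) fun z => w z t) (Icc 0 T) := by
  have hB0 : 0 ≤ B := (hρ.nonneg 0).trans (hB 0)
  set S := R + r with hS
  have hS0 : 0 < S := by positivity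
  have hK : Continuous fun p : ℝ × ℝ => ρ (p.1 - p.2) * ψ p.1 := by
    have := hρ.smooth.continuous; have := hψ.smooth.continuous; fun_prop
  have hKR := mul_eq_zero_of_notMem_box hr.le hρ.eq_zero hψ.eq_zero
  have hKB : ∀ p : ℝ × ℝ, |ρ (p.1 - p.2) * ψ p.1| ≤ B := fun p => by
    rw [abs_of_nonneg (mul_nonneg (hρ.nonneg _) (hψ.nonneg _))]
    calc _ ≤ B * 1 := mul_le_mul (hB _) (hψ.le_one _) (hψ.nonneg _) hB0
      _ = B := mul_one B
  have hid : LipschitzWith 1 (id : ℝ → ℝ) := LipschitzWith.id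
  have est : ∀ f f' g : ℝ → ℝ, Measurable f → Measurable f' → Measurable g →
      (∀ z, f z ∈ Icc m M) → (∀ z, f' z ∈ Icc m M) → (∀ z, g z ∈ Icc m M) →
      doubled ρ ψ f g - doubled ρ ψ f' g ≤ B * (2 * S) * ∫ z in Icc (-S) S, |f' z - f z| := by
    intro f f' g hf hf' hg hfm hfm' hgm
    have := integral_doubled_sub_le hid hf hf' hg hfm hfm' hgm hS0 hK hKR hKB
    simpa [doubled] using this
  have est' : ∀ f f' g : ℝ → ℝ, Measurable f → Measurable f' → Measurable g →
      (∀ z, f z ∈ Icc m M) → (∀ z, f' z ∈ Icc m M) → (∀ z, g z ∈ Icc m M) →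
      doubled ρ ψ g f - doubled ρ ψ g f' ≤ B * (2 * S) * ∫ z in Icc (-S) S, |f' z - f z| := by
    intro f f' g hf hf' hg hfm hfm' hgm
    have := integral_doubled_sub_le hid hf hf' hg hfm hfm' hgm hS0
      (K := fun p => ρ (p.2 - p.1) * ψ p.2) (hK.comp continuous_swap)
      (fun p hp => hKR p.swap fun h => hp ⟨h.2, h.1⟩) (fun p => hKB p.swap)
    have sw : ∀ f : ℝ → ℝ, doubled ρ ψ g f
        = ∫ p : ℝ × ℝ, |f p.1 - g p.2| * (ρ (p.2 - p.1) * ψ p.2) := fun f => by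
      rw [doubled, Measure.volume_eq_prod, ← integral_prod_swap]
      simp [abs_sub_comm]
    rw [sw, sw]
    simpa using this
  intro t ht
  refine Metric.tendsto_nhds.2 fun ε hε => ?_
  set ε' := ε / (2 * (B * (2 * S)) + 1) / 2 with hε'
  have hε0 : 0 < ε' := by positivity
  filter_upwards [hv.cont t ht S hS0 ε' hε0, hw.cont t ht S hS0 ε' hε0,
    self_mem_nhdsWithin] with s h1 h2 hs
  have h1' : ∫ z in Icc (-S) S, |v z t - v z s| ≤ ε' := by simpa only [abs_sub_comm] using h1
  have h2' : ∫ z in Icc (-S) S, |w z t - w z s| ≤ ε' := by simpa only [abs_sub_comm] using h2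
  have a1 := est _ _ _ (hv.meas s hs) (hv.meas t ht) (hw.meas s hs) (hv.mem s hs) (hv.mem t ht)
    (hw.mem s hs)
  have a2 := est _ _ _ (hv.meas t ht) (hv.meas s hs) (hw.meas s hs) (hv.mem t ht) (hv.mem s hs)
    (hw.mem s hs)
  have a3 := est' _ _ _ (hw.meas s hs) (hw.meas t ht) (hv.meas t ht) (hw.mem s hs) (hw.mem t ht)
    (hv.mem t ht)
  have a4 := est' _ _ _ (hw.meas t ht) (hw.meas s hs) (hv.meas t ht) (hw.mem t ht) (hw.mem s hs)
    (hv.mem t ht)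
  have hBS : 0 ≤ B * (2 * S) := by positivity
  have b1 := mul_le_mul_of_nonneg_left h1 hBS
  have b2 := mul_le_mul_of_nonneg_left h2 hBS
  have b3 := mul_le_mul_of_nonneg_left h1' hBS
  have b4 := mul_le_mul_of_nonneg_left h2' hBS
  have hlt : 2 * (B * (2 * S) * ε') < ε := by
    have h3 : (2 * (B * (2 * S)) + 1) * (2 * ε') = ε := by rw [hε']; field_simp
    nlinarith
  rw [Real.dist_eq, abs_lt]
  constructor <;> linarith

end Doubling

/-- The weight is exp(-√(1+z²)) times a cutoff equal to 1 on [-n, n] and supported in [-2n, 2n]. The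
exponential satisfies |E'| ≤ E. The derivative of the cutoff acts only for |z| ≥ n, where the
exponential is at most e^{-n}, so κ = C e^{-n} beats the quadratic growth of the box area. The lower
bound `a` depends on R alone, not on κ'; `stability` relies on this order of quantifiers. -/
lemma exists_isWeight {R : ℝ} (hR : 0 < R) : ∃ a > 0, ∀ κ' > 0, ∃ ψ S κ, IsWeight ψ S κ ∧ 0 < S ∧
    0 ≤ κ ∧ κ ≤ 1 ∧ κ * (S + 1) ^ 2 ≤ κ' ∧ ∀ x ∈ Icc (-R) R, a ≤ ψ x := by
  let b : ContDiffBump (0 : ℝ) := ⟨1, 2, one_pos, one_lt_two⟩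
  set s : ℝ → ℝ := fun z => √(1 + z ^ 2) with hs
  have hpos : ∀ z : ℝ, 0 < 1 + z ^ 2 := fun z => by positivity
  have hs1 : ∀ z, |z| ≤ s z := fun z => by
    rw [hs, ← Real.sqrt_sq_eq_abs]; exact Real.sqrt_le_sqrt (by linarith)
  have hs0 : ∀ z, 0 < s z := fun z => Real.sqrt_pos.2 (hpos z)
  have hsm : ContDiff ℝ ∞ s := by
    refine ContDiff.sqrt (by fun_prop) fun z => (hpos z).ne'
  have hsd : ∀ z, HasDerivAt s (z / s z) z := fun z => by
    have h1 : HasDerivAt (fun z : ℝ => 1 + z ^ 2) (2 * z) z := by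
      simpa using (hasDerivAt_pow 2 z).const_add 1
    refine (h1.sqrt (hpos z).ne').congr_deriv ?_
    rw [mul_div_mul_left _ _ two_ne_zero]
  set E : ℝ → ℝ := fun z => Real.exp (-s z) with hE
  have hE0 : ∀ z, 0 < E z := fun z => Real.exp_pos _
  have hE1 : ∀ z, E z ≤ 1 := fun z => Real.exp_le_one_iff.2 (by linarith [hs0 z])
  have hEm : ContDiff ℝ ∞ E := Real.contDiff_exp.comp hsm.neg
  have hEd : ∀ z, HasDerivAt E (E z * (-(z / s z))) z := fun z => (hsd z).neg.exp
  have hEd' : ∀ z, |E z * (-(z / s z))| ≤ E z := fun z => by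
    rw [abs_mul, abs_of_pos (hE0 z), abs_neg, abs_div, abs_of_pos (hs0 z)]
    exact mul_le_of_le_one_right (hE0 z).le ((div_le_one (hs0 z)).2 (hs1 z))
  have hbs : ContDiff ℝ ∞ b := b.contDiff
  have hbd : ∀ x, HasDerivAt b (deriv b x) x := fun x =>
    (hbs.differentiable (by simp) x).hasDerivAt
  obtain ⟨C, hC⟩ := b.hasCompactSupport.deriv.exists_bound_of_continuous
    (hbs.continuous_deriv (by simp))
  have hC0 : 0 ≤ C := (norm_nonneg _).trans (hC 0)
  refine ⟨Real.exp (-√(1 + R ^ 2)), Real.exp_pos _, fun κ' hκ' => ?_⟩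
  -- The 9 comes from (2n+1)² ≤ 9n² for n ≥ 1, where S = 2n.
  have hlim : Tendsto (fun n : ℝ => 9 * C * (n ^ 2 * Real.exp (-n))) atTop (𝓝 0) := by
    simpa using (Real.tendsto_pow_mul_exp_neg_atTop_nhds_zero 2).const_mul (9 * C)
  obtain ⟨n, hn, hnR, hn1⟩ := ((hlim.eventually (gt_mem_nhds (lt_min hκ' one_pos))).and
    ((eventually_ge_atTop R).and (eventually_ge_atTop 1))).exists
  have hn0 : 0 < n := by linarith
  have hθ0 : ∀ z, 0 ≤ b (z / n) := fun z => b.nonneg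
  have hθ1 : ∀ z, b (z / n) ≤ 1 := fun z => b.le_one
  have hθd : ∀ z, HasDerivAt (fun z => b (z / n)) (deriv b (z / n) * (1 / n)) z := fun z =>
    HasDerivAt.comp (h₂ := b) (h := fun z => z / n) z (hbd (z / n)) ((hasDerivAt_id z).div_const n)
  have hψd : ∀ z, HasDerivAt (fun z => b (z / n) * E z)
      (deriv b (z / n) * (1 / n) * E z + b (z / n) * (E z * (-(z / s z)))) z := fun z =>
    (hθd z).mul (hEd z)
  have hκ1 : C * Real.exp (-n) * (2 * n + 1) ^ 2 ≤ min κ' 1 := by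
    refine le_trans ?_ hn.le
    have h1 : (2 * n + 1) ^ 2 ≤ 9 * n ^ 2 := by nlinarith
    calc _ ≤ C * Real.exp (-n) * (9 * n ^ 2) := by gcongr
      _ = _ := by ring
  have hκ0 : 0 ≤ C * Real.exp (-n) := by positivity
  refine ⟨fun z => b (z / n) * E z, 2 * n, C * Real.exp (-n), ⟨?_, fun z => ?_, fun z => ?_,
    fun z hz => ?_, fun z => ?_⟩, by positivity, by positivity, ?_,
    hκ1.trans (min_le_left _ _), fun z hz => ?_⟩
  · exact (hbs.comp (contDiff_id.div_const n)).mul hEm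
  · exact mul_nonneg (hθ0 z) (hE0 z).le
  · exact mul_le_one₀ (hθ1 z) (hE0 z).le (hE1 z)
  · have : b (z / n) = 0 := by
      refine b.zero_of_le_dist ?_
      rw [Real.dist_eq, sub_zero, abs_div, abs_of_pos hn0, le_div_iff₀ hn0]
      by_contra h
      exact hz (abs_le.1 (not_le.1 h).le)
    simp [this]
  · rw [(hψd z).deriv]
    have h1 : |deriv b (z / n) * (1 / n) * E z| ≤ C * Real.exp (-n) := by
      -- Inside, the cutoff is locally constant and its derivative vanishes; outside, the
      -- exponential factor is small.
      by_cases hz : |z| < n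
      · have h2 : z / n ∈ Metric.ball (0 : ℝ) b.rIn := by
          rw [mem_ball_zero_iff, Real.norm_eq_abs, abs_div, abs_of_pos hn0, div_lt_iff₀ hn0]
          simpa [b] using hz
        have h3 : deriv b (z / n) = 0 := by
          rw [(b.eventuallyEq_one_of_mem_ball h2).deriv_eq]
          exact deriv_const _ _
        rw [h3]; simpa using hκ0
      · have h2 : E z ≤ Real.exp (-n) :=
          Real.exp_le_exp.2 (neg_le_neg ((not_lt.1 hz).trans (hs1 z)))
        rw [abs_mul, abs_mul, abs_of_pos (hE0 z), abs_of_pos (by positivity : 0 < 1 / n)]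
        have h3 : |deriv b (z / n)| * (1 / n) ≤ C * 1 :=
          mul_le_mul (hC _) ((div_le_one hn0).2 hn1) (by positivity) hC0
        rw [mul_one] at h3
        exact mul_le_mul h3 h2 (hE0 z).le hC0
    have h2 : |b (z / n) * (E z * (-(z / s z)))| ≤ b (z / n) * E z := by
      rw [abs_mul, abs_of_nonneg (hθ0 z)]
      exact mul_le_mul_of_nonneg_left (hEd' z) (hθ0 z)
    exact (abs_add_le _ _).trans (by linarith)
  · have h1 : (1 : ℝ) ≤ (2 * n + 1) ^ 2 := by nlinarith
    calc _ ≤ C * Real.exp (-n) * (2 * n + 1) ^ 2 := le_mul_of_one_le_right hκ0 h1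
      _ ≤ 1 := hκ1.trans (min_le_right _ _)
  · have h1 : b (z / n) = 1 := by
      refine b.one_of_mem_closedBall ?_
      rw [mem_closedBall_zero_iff, Real.norm_eq_abs, abs_div, abs_of_pos hn0, div_le_iff₀ hn0]
      simpa [b] using (abs_le.2 hz).trans hnR
    simp only [h1, one_mul]
    refine Real.exp_le_exp.2 (neg_le_neg (Real.sqrt_le_sqrt ?_))
    have := sq_le_sq' hz.1 hz.2
    linarith

/-! ### Comparison and stability of approximate entropy solutions -/

section Comparison

variable {G : ℝ → ℝ} {L : ℝ≥0} {m M T V r R κ e₁ e₂ B : ℝ} {ρ ψ : ℝ → ℝ} {v w : ℝ → ℝ → ℝ}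

/-- This is the flux that survives the doubling. The bound -ψ' ≤ ψ + κ, with |G(f) - G(g)| ≤ L|f -
g|, returns it to L times the doubled distance, ready for Gronwall, plus κ times the area of the
box. -/
lemma neg_integral_flux_le (hG : LipschitzWith L G) (hmM : m ≤ M) (hρ : IsMollifier ρ r)
    (hr : 0 < r) (hψ : IsWeight ψ R κ) (hR : 0 < R) (hκ : 0 ≤ κ) (hB : ∀ x, ρ x ≤ B)
    {f g : ℝ → ℝ} (hf : Measurable f) (hg : Measurable g) (hfm : ∀ z, f z ∈ Icc m M)
    (hgm : ∀ z, g z ∈ Icc m M) :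
    -∫ p : ℝ × ℝ, |G (f p.1) - G (g p.2)| * (ρ (p.1 - p.2) * deriv ψ p.1)
      ≤ L * doubled ρ ψ f g + L * (M - m) * κ * B * (2 * (R + r)) ^ 2 := by
  set S := R + r with hS
  have hB0 : 0 ≤ B := (hρ.nonneg 0).trans (hB 0)
  have hρc := hρ.smooth.continuous
  have hψc := hψ.smooth.continuous
  have hψc' : Continuous (deriv ψ) := hψ.smooth.continuous_deriv (by simp)
  have z0 := mul_eq_zero_of_notMem_box hr.le hρ.eq_zero hψ.eq_zero
  have z1 := mul_eq_zero_of_notMem_box hr.le hρ.eq_zero (deriv_eq_zero_of_notMem_Icc hψ.eq_zero)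
  have hid : LipschitzWith 1 (id : ℝ → ℝ) := LipschitzWith.id
  have i0 : Integrable fun p : ℝ × ℝ => |f p.1 - g p.2| * (ρ (p.1 - p.2) * ψ p.1) :=
    integrable_doubled hid hf hg hfm hgm (by fun_prop) (hasCompactSupport_of_box z0)
  have i1 : Integrable fun p : ℝ × ℝ =>
      |G (f p.1) - G (g p.2)| * (ρ (p.1 - p.2) * deriv ψ p.1) :=
    integrable_doubled hG hf hg hfm hgm (by fun_prop) (hasCompactSupport_of_box z1)
  rw [doubled, ← integral_neg, ← setIntegral_eq_integral_of_forall_compl_eq_zero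
    (s := Icc (-S) S ×ˢ Icc (-S) S) (fun p hp => by simp [z1 p hp]),
    ← setIntegral_eq_integral_of_forall_compl_eq_zero
    (s := Icc (-S) S ×ˢ Icc (-S) S) (f := fun p : ℝ × ℝ => |f p.1 - g p.2| * _)
    (fun p hp => by simp [z0 p hp]), ← integral_const_mul]
  have hfin : (volume : Measure (ℝ × ℝ)) (Icc (-S) S ×ˢ Icc (-S) S) ≠ ⊤ :=
    (isCompact_Icc.prod isCompact_Icc).measure_lt_top.ne
  have e1 : ∫ _p in Icc (-S) S ×ˢ Icc (-S) S, L * (M - m) * κ * B ∂(volume : Measure (ℝ × ℝ))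
      = L * (M - m) * κ * B * (2 * S) ^ 2 := by
    rw [setIntegral_const, volume_real_box S (by positivity), smul_eq_mul, mul_comm]
  have i2 : IntegrableOn (fun _ : ℝ × ℝ => L * (M - m) * κ * B) (Icc (-S) S ×ˢ Icc (-S) S) :=
    integrableOn_const hfin
  rw [← e1, ← integral_add (i0.integrableOn.const_mul _) i2]
  refine setIntegral_mono i1.neg.integrableOn ((i0.integrableOn.const_mul _).add i2) fun p => ?_
  simp only
  have h1 : |G (f p.1) - G (g p.2)| ≤ L * |f p.1 - g p.2| := by
    have := hG.dist_le_mul (f p.1) (g p.2)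
    rwa [Real.dist_eq, Real.dist_eq] at this
  have h2 : |f p.1 - g p.2| ≤ M - m := abs_sub_le_of_mem_Icc (hfm _) (hgm _)
  have h3 : -deriv ψ p.1 ≤ ψ p.1 + κ := (neg_le_abs _).trans (hψ.deriv_le _)
  have h4 := hρ.nonneg (p.1 - p.2)
  have h5 := hψ.nonneg p.1
  calc -(|G (f p.1) - G (g p.2)| * (ρ (p.1 - p.2) * deriv ψ p.1))
      = |G (f p.1) - G (g p.2)| * (ρ (p.1 - p.2) * -deriv ψ p.1) := by ring
    _ ≤ |G (f p.1) - G (g p.2)| * (ρ (p.1 - p.2) * (ψ p.1 + κ)) := by gcongr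
    _ ≤ L * |f p.1 - g p.2| * (ρ (p.1 - p.2) * (ψ p.1 + κ)) := by gcongr
    _ = L * (|f p.1 - g p.2| * (ρ (p.1 - p.2) * ψ p.1))
        + L * |f p.1 - g p.2| * κ * ρ (p.1 - p.2) := by ring
    _ ≤ L * (|f p.1 - g p.2| * (ρ (p.1 - p.2) * ψ p.1)) + L * (M - m) * κ * B := by
        have := hB (p.1 - p.2)
        gcongr

/-- Kruzhkov's doubling. Each curve serves as the constant k in the inequality of the other. The two
fluxes have kernels ∂_z and ∂_y of ρ(z-y)ψ(z), whose sum contains no ρ', so the singular terms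
cancel and only ρψ' is left. -/
lemma doubled_le (hG : LipschitzWith L G) (hmM : m ≤ M) (hρ : IsMollifier ρ r)
    (hr : 0 < r) (hψ : IsWeight ψ R κ) (hR : 0 < R) (hκ : 0 ≤ κ) (hκ1 : κ ≤ 1)
    (hB : ∀ x, ρ x ≤ B) (hB' : ∀ x, |deriv ρ x| ≤ B) (he₁ : 0 ≤ e₁) (he₂ : 0 ≤ e₂)
    (hv : IsBoundedCurve m M T v) (hw : IsBoundedCurve m M T w)
    (hdv : DiniEntropy G m M e₁ T v) (hdw : DiniEntropy G m M e₂ T w) :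
    ∀ t ∈ Icc 0 T, doubled ρ ψ (fun z => v z t) (fun z => w z t)
      ≤ (doubled ρ ψ (fun z => v z 0) (fun z => w z 0)
        + (L * (M - m) * κ * B * (2 * (R + r)) ^ 2 + (e₁ + e₂) * (3 * B) * (2 * (R + r))) * t)
        * Real.exp ((L + 1) * t) := by
  have hB0 : 0 ≤ B := (hρ.nonneg 0).trans (hB 0)
  have hMm : 0 ≤ M - m := sub_nonneg.2 hmM
  refine le_of_right_dini (by positivity) (by positivity)
    (continuousOn_doubled hρ hr hψ hR hv hw hB) ?_
  intro t ht ε hε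
  set S := R + r with hS
  have hS0 : 0 < S := by positivity
  have htI := Ico_subset_Icc_self ht
  have hρc := hρ.smooth.continuous
  have hψc := hψ.smooth.continuous
  have hρc' : Continuous (deriv ρ) := hρ.smooth.continuous_deriv (by simp)
  have hψc' : Continuous (deriv ψ) := hψ.smooth.continuous_deriv (by simp)
  have hρd : ∀ x, HasDerivAt ρ (deriv ρ x) x := fun x =>
    (hρ.smooth.differentiable (by simp) x).hasDerivAt
  have hψd : ∀ x, HasDerivAt ψ (deriv ψ x) x := fun x =>
    (hψ.smooth.differentiable (by simp) x).hasDerivAt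
  have z0 := mul_eq_zero_of_notMem_box hr.le hρ.eq_zero hψ.eq_zero
  have z1 := mul_eq_zero_of_notMem_box hr.le hρ.eq_zero (deriv_eq_zero_of_notMem_Icc hψ.eq_zero)
  have z2 := mul_eq_zero_of_notMem_box hr.le (deriv_eq_zero_of_notMem_Icc hρ.eq_zero) hψ.eq_zero
  -- As ψ ≤ 1 and κ ≤ 1. Hence the kernel derivatives are bounded by B + 2B, the source of the
  -- constant 3B.
  have hψ2 : ∀ x, |deriv ψ x| ≤ 2 := fun x => by linarith [hψ.deriv_le x, hψ.le_one x]
  have hK0B : ∀ p : ℝ × ℝ, ρ (p.1 - p.2) * ψ p.1 ≤ 3 * B := fun p => by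
    calc _ ≤ B * 1 := mul_le_mul (hB _) (hψ.le_one _) (hψ.nonneg _) hB0
      _ ≤ 3 * B := by linarith
  have hK2B' : ∀ p : ℝ × ℝ, |deriv ρ (p.1 - p.2) * ψ p.1| ≤ B := fun p => by
    rw [abs_mul, abs_of_nonneg (hψ.nonneg _)]
    calc _ ≤ B * 1 := mul_le_mul (hB' _) (hψ.le_one _) (hψ.nonneg _) hB0
      _ = B := mul_one B
  set K1 : ℝ × ℝ → ℝ := fun p => deriv ρ (p.1 - p.2) * ψ p.1 + ρ (p.1 - p.2) * deriv ψ p.1 with hK1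
  set K2 : ℝ × ℝ → ℝ := fun p => -(deriv ρ (p.1 - p.2) * ψ p.1) with hK2
  have hK1c : Continuous K1 := by fun_prop
  have hK2c : Continuous K2 := by fun_prop
  have hK1z : ∀ p, p ∉ Icc (-S) S ×ˢ Icc (-S) S → K1 p = 0 := fun p hp => by
    simp only [hK1, z1 p hp, z2 p hp, add_zero]
  have hK2z : ∀ p, p ∉ Icc (-S) S ×ˢ Icc (-S) S → K2 p = 0 := fun p hp => by
    simp only [hK2, z2 p hp, neg_zero]
  have hK1B : ∀ p, |K1 p| ≤ 3 * B := fun p => by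
    have : |ρ (p.1 - p.2) * deriv ψ p.1| ≤ B * 2 := by
      rw [abs_mul, abs_of_nonneg (hρ.nonneg _)]
      exact mul_le_mul (hB _) (hψ2 _) (abs_nonneg _) hB0
    exact (abs_add_le _ _).trans (by linarith [hK2B' p])
  have hK2B : ∀ p, |K2 p| ≤ 3 * B := fun p => by
    rw [hK2, abs_neg]; linarith [hK2B' p]
  -- Three small errors share ε: one from each Dini inequality, giving the 2, and one from replacing
  -- v(t+h) by v(t) inside the flux, giving the L.
  set ε₁ := ε / ((2 + L) * (3 * B) * (2 * S) + 1) with hε₁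
  have hε₁0 : 0 < ε₁ := by positivity
  have hε₁' : ε₁ * ((2 + L) * (3 * B) * (2 * S)) ≤ ε := by
    have : ε₁ * ((2 + L) * (3 * B) * (2 * S) + 1) = ε := by rw [hε₁]; field_simp
    nlinarith
  have hsmooth : ContDiff ℝ ∞ fun p : ℝ × ℝ => ρ (p.1 - p.2) * ψ p.1 :=
    (hρ.smooth.comp (contDiff_fst.sub contDiff_snd)).mul (hψ.smooth.comp contDiff_fst)
  have A1 := hdv.doubled hG hv ht hS0 hsmooth
    (fun p => mul_nonneg (hρ.nonneg _) (hψ.nonneg _)) z0 (K' := K1)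
    (fun z y => ((hρd (z - y)).comp_sub_const z y).mul (hψd z)) hK1c hK1z hK0B hK1B hε₁0
  have A2 := hdw.doubled hG hw ht hS0 (K := fun p => ρ (p.2 - p.1) * ψ p.2)
    (hsmooth.comp (contDiff_snd.prodMk contDiff_fst))
    (fun p => mul_nonneg (hρ.nonneg _) (hψ.nonneg _))
    (fun p hp => z0 p.swap fun h => hp ⟨h.2, h.1⟩)
    (K' := fun p => K2 p.swap)
    (fun y z => by
      have h1 : HasDerivAt (fun x => ρ (z - x)) (-deriv ρ (z - y)) y :=
        (hρd (z - y)).comp_const_sub z y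
      simpa [hK2] using h1.mul_const (ψ z))
    (hK2c.comp continuous_swap) (fun p hp => hK2z p.swap fun h => hp ⟨h.2, h.1⟩)
    (fun p => hK0B p.swap) (fun p => hK2B p.swap) hε₁0
  filter_upwards [A1, A2, (tendsto_add_nhdsGT ht).eventually (hv.cont t htI S hS0 ε₁ hε₁0),
    (tendsto_add_nhdsGT ht).eventually self_mem_nhdsWithin, self_mem_nhdsWithin]
    with h a1 a2 a3 htI' h0
  have h0' : 0 < h := h0
  have b1 := a1 (fun z => w z t) (hw.meas t htI) (hw.mem t htI)
  -- Here v has already advanced to t+h, so that the two inequalities chain through the distance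
  -- between v(t+h) and w(t). The price is a flux term with v(t+h), which `b3` compares with the one
  -- at time t.
  have b2 := a2 (fun z => v z (t + h)) (hv.meas _ htI') (hv.mem _ htI')
  have sw1 : ∀ s, ∫ p : ℝ × ℝ, |w p.1 s - v p.2 (t + h)| * (ρ (p.2 - p.1) * ψ p.2)
      = doubled ρ ψ (fun z => v z (t + h)) (fun z => w z s) := fun s => by
    rw [doubled, Measure.volume_eq_prod, ← integral_prod_swap]
    simp [abs_sub_comm]
  have sw2 : ∫ p : ℝ × ℝ, |G (w p.1 t) - G (v p.2 (t + h))| * K2 p.swap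
      = ∫ p : ℝ × ℝ, |G (v p.1 (t + h)) - G (w p.2 t)| * K2 p := by
    rw [Measure.volume_eq_prod, ← integral_prod_swap]
    simp [abs_sub_comm]
  rw [sw1, sw1, sw2] at b2
  have b3 := integral_doubled_sub_le hG (hv.meas t htI) (hv.meas _ htI') (hw.meas t htI)
    (hv.mem t htI) (hv.mem _ htI') (hw.mem t htI) hS0 hK2c hK2z hK2B
  have b4 := neg_integral_flux_le hG hmM hρ hr hψ hR hκ hB (hv.meas t htI) (hw.meas t htI)
    (hv.mem t htI) (hw.mem t htI)
  have e1 : (∫ p : ℝ × ℝ, |G (v p.1 t) - G (w p.2 t)| * K1 p)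
      + (∫ p : ℝ × ℝ, |G (v p.1 t) - G (w p.2 t)| * K2 p)
      = ∫ p : ℝ × ℝ, |G (v p.1 t) - G (w p.2 t)| * (ρ (p.1 - p.2) * deriv ψ p.1) := by
    rw [← integral_add (integrable_doubled hG (hv.meas t htI) (hw.meas t htI) (hv.mem t htI)
      (hw.mem t htI) hK1c (hasCompactSupport_of_box hK1z)) (integrable_doubled hG (hv.meas t htI)
      (hw.meas t htI) (hv.mem t htI) (hw.mem t htI) hK2c (hasCompactSupport_of_box hK2z))]
    refine integral_congr_ae (ae_of_all _ fun p => ?_)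
    simp only [hK1, hK2]; ring
  rw [← hS] at b4
  have b5 : L * (3 * B) * (2 * S) * ∫ z in Icc (-S) S, |v z (t + h) - v z t|
      ≤ L * (3 * B) * (2 * S) * ε₁ := mul_le_mul_of_nonneg_left a3 (by positivity)
  have b1' : doubled ρ ψ (fun z => v z (t + h)) (fun z => w z t)
      ≤ doubled ρ ψ (fun z => v z t) (fun z => w z t)
        - h * (∫ p : ℝ × ℝ, |G (v p.1 t) - G (w p.2 t)| * K1 p)
        + h * ((e₁ + ε₁) * (3 * B)) * (2 * S) := b1
  set J1 := ∫ p : ℝ × ℝ, |G (v p.1 t) - G (w p.2 t)| * K1 p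
  set J2 := ∫ p : ℝ × ℝ, |G (v p.1 t) - G (w p.2 t)| * K2 p
  set J2' := ∫ p : ℝ × ℝ, |G (v p.1 (t + h)) - G (w p.2 t)| * K2 p
  set H := doubled ρ ψ (fun z => v z t) (fun z => w z t)
  have hH0 : 0 ≤ H := integral_nonneg fun p =>
    mul_nonneg (abs_nonneg _) (mul_nonneg (hρ.nonneg _) (hψ.nonneg _))
  rw [← e1] at b4
  have fin : -J1 - J2' + (e₁ + ε₁) * (3 * B) * (2 * S) + (e₂ + ε₁) * (3 * B) * (2 * S)
      ≤ (L + 1) * H + (L * (M - m) * κ * B * (2 * S) ^ 2 + (e₁ + e₂) * (3 * B) * (2 * S)) + ε := by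
    nlinarith
  have := mul_le_mul_of_nonneg_left fin h0'.le
  linarith

/-- Doubling changes a weighted `L¹` distance by at most the modulus of one of the functions. -/
lemma abs_doubled_sub_le (hρ : IsMollifier ρ r) (hr : 0 < r) (hψ : IsWeight ψ R κ) (hV : 0 ≤ V)
    {f g : ℝ → ℝ} (hf : Measurable f) (hg : Measurable g)
    (hfm : ∀ z, f z ∈ Icc m M) (hgm : ∀ z, g z ∈ Icc m M) (hgV : HasModulus V g) :
    |doubled ρ ψ f g - ∫ z, |f z - g z| * ψ z| ≤ V * r := by
  have hρc := hρ.smooth.continuous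
  have hψc := hψ.smooth.continuous
  have z0 := mul_eq_zero_of_notMem_box hr.le hρ.eq_zero hψ.eq_zero
  have hK : Continuous fun p : ℝ × ℝ => ρ (p.1 - p.2) * ψ p.1 := by fun_prop
  have hKc := hasCompactSupport_of_box z0
  have i1 : Integrable fun p : ℝ × ℝ => |f p.1 - g p.2| * (ρ (p.1 - p.2) * ψ p.1) :=
    integrable_doubled LipschitzWith.id hf hg hfm hgm hK hKc
  have i2 : Integrable fun p : ℝ × ℝ => |f p.1 - g p.1| * (ρ (p.1 - p.2) * ψ p.1) :=
    integrable_bdd_mul (C := M - m) (Measurable.aestronglyMeasurable (by fun_prop))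
      (fun p => by rw [abs_abs]; exact abs_sub_le_of_mem_Icc (hfm _) (hgm _)) hK hKc
  -- Unit mass of ρ writes the plain distance over the same two variables. The two integrands then
  -- differ by at most |g(z) - g(y)| ρ(z-y), with shifts no larger than r.
  have e2 : ∫ z, |f z - g z| * ψ z
      = ∫ p : ℝ × ℝ, |f p.1 - g p.1| * (ρ (p.1 - p.2) * ψ p.1) := by
    rw [Measure.volume_eq_prod] at i2 ⊢
    rw [integral_prod _ i2]
    refine integral_congr_ae (ae_of_all _ fun z => ?_)
    simp only
    rw [integral_const_mul, integral_mul_const, integral_sub_left_eq_self ρ volume z,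
      hρ.integral_eq, one_mul]
  rw [e2, doubled, ← integral_sub i1 i2, ← ENNReal.ofReal_le_ofReal_iff (by positivity),
    ← Real.norm_eq_abs, ofReal_norm]
  refine (enorm_integral_le_lintegral_enorm _).trans ?_
  calc ∫⁻ p : ℝ × ℝ, ‖|f p.1 - g p.2| * (ρ (p.1 - p.2) * ψ p.1)
        - |f p.1 - g p.1| * (ρ (p.1 - p.2) * ψ p.1)‖ₑ
      ≤ ∫⁻ p : ℝ × ℝ, ‖g p.1 - g p.2‖ₑ * ENNReal.ofReal (ρ (p.1 - p.2)) := by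
        refine lintegral_mono fun p => ?_
        rw [← ofReal_norm, ← ofReal_norm, ← ENNReal.ofReal_mul (norm_nonneg _)]
        refine ENNReal.ofReal_le_ofReal ?_
        rw [← sub_mul, norm_mul, Real.norm_eq_abs, Real.norm_eq_abs, Real.norm_eq_abs,
          abs_of_nonneg (mul_nonneg (hρ.nonneg _) (hψ.nonneg _))]
        have h1 := abs_abs_sub_abs_le (f p.1 - g p.2) (f p.1 - g p.1)
        rw [sub_sub_sub_cancel_left] at h1
        have h2 : ρ (p.1 - p.2) * ψ p.1 ≤ ρ (p.1 - p.2) :=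
          mul_le_of_le_one_right (hρ.nonneg _) (hψ.le_one _)
        exact mul_le_mul h1 h2 (mul_nonneg (hρ.nonneg _) (hψ.nonneg _)) (abs_nonneg _)
    _ = ∫⁻ z, ∫⁻ y, ‖g z - g y‖ₑ * ENNReal.ofReal (ρ (z - y)) := by
        rw [Measure.volume_eq_prod, lintegral_prod _ (by fun_prop)]
    _ = ∫⁻ z, ∫⁻ x, ‖g z - g (z - x)‖ₑ * ENNReal.ofReal (ρ x) := by
        refine lintegral_congr fun z => ?_
        rw [← lintegral_sub_left_eq_self _ z]
        simp
    _ = ∫⁻ x, ∫⁻ z, ‖g z - g (z - x)‖ₑ * ENNReal.ofReal (ρ x) :=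
        lintegral_lintegral_swap (by fun_prop)
    _ ≤ ∫⁻ x, ENNReal.ofReal (V * r) * ENNReal.ofReal (ρ x) := by
        refine lintegral_mono fun x => ?_
        rw [lintegral_mul_const' _ _ ENNReal.ofReal_ne_top]
        by_cases hx : x ∈ Icc (-r) r
        · gcongr
          have h1 := hgV (-x)
          rw [abs_neg] at h1
          calc ∫⁻ z, ‖g z - g (z - x)‖ₑ = ∫⁻ z, ‖g (z + -x) - g z‖ₑ :=
                lintegral_congr fun z => by rw [← enorm_neg, neg_sub, sub_eq_add_neg z x]
            _ ≤ ENNReal.ofReal (V * |x|) := h1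
            _ ≤ _ := ENNReal.ofReal_le_ofReal
                (mul_le_mul_of_nonneg_left (abs_le.2 hx) hV)
        · simp [hρ.eq_zero x hx]
    _ = ENNReal.ofReal (V * r) := by
        rw [lintegral_const_mul' _ _ ENNReal.ofReal_ne_top,
          ← ofReal_integral_eq_lintegral_ofReal _ (ae_of_all _ hρ.nonneg), hρ.integral_eq]
        · simp
        · exact integrable_of_integral_eq_one hρ.integral_eq

lemma exists_pos_mul_le {A η : ℝ} (hA : 0 ≤ A) (hη : 0 < η) : ∃ δ > 0, δ * A ≤ η :=
  ⟨η / (A + 1), by positivity, by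
    rw [div_mul_eq_mul_div, div_le_iff₀ (by positivity)]; nlinarith⟩

/-- Stability of approximate entropy solutions, one of which has a translation modulus. -/
theorem stability (hG : LipschitzWith L G) (hmM : m ≤ M) (hV : 0 ≤ V) (hT : 0 ≤ T) (hR : 0 < R)
    {η : ℝ} (hη : 0 < η) : ∃ δ > 0, ∃ S > 0, ∀ (e₁ e₂ : ℝ) (v w : ℝ → ℝ → ℝ),
      0 ≤ e₁ → e₁ ≤ δ → 0 ≤ e₂ → e₂ ≤ δ → IsBoundedCurve m M T v → IsBoundedCurve m M T w →
      DiniEntropy G m M e₁ T v → DiniEntropy G m M e₂ T w →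
      (∀ t ∈ Icc 0 T, HasModulus V fun z => w z t) →
      ∫ z in Icc (-S) S, |v z 0 - w z 0| ≤ δ →
      ∀ t ∈ Icc 0 T, ∫ z in Icc (-R) R, |v z t - w z t| ≤ η := by
  have hMm : 0 ≤ M - m := sub_nonneg.2 hmM
  set X := Real.exp ((L + 1) * T) with hX
  have hX0 : 0 < X := Real.exp_pos _
  have hX1 : 1 ≤ X := Real.one_le_exp (by positivity)
  -- Order of choices: a depends only on R; r only on a, V, T and L; the mollifier bound B on r;
  -- then κ' and with it the weight and S; finally δ, once S and B are known.
  obtain ⟨a, ha, hw⟩ := exists_isWeight hR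
  -- Three sources of error get a quarter of aη each: the mollification (r), the truncation of the
  -- weight (κ'), and the data together with the entropy errors (δ).
  have hη4 : 0 < a * η / 4 := by positivity
  obtain ⟨r', hr'0, hr'⟩ := exists_pos_mul_le (A := 2 * V * X) (by positivity) hη4
  set r := min r' 1 with hr
  have hr0 : 0 < r := lt_min hr'0 one_pos
  have hrV : r * (2 * V * X) ≤ a * η / 4 :=
    (mul_le_mul_of_nonneg_right (min_le_left _ _) (by positivity)).trans hr'
  obtain ⟨ρ, hρ⟩ := exists_isMollifier hr0
  have hρc : HasCompactSupport ρ := HasCompactSupport.intro isCompact_Icc fun x hx => hρ.eq_zero x hx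
  obtain ⟨B₁, hB₁⟩ := hρc.exists_bound_of_continuous hρ.smooth.continuous
  obtain ⟨B₂, hB₂⟩ := hρc.deriv.exists_bound_of_continuous (hρ.smooth.continuous_deriv (by simp))
  set B := max B₁ B₂ with hB
  have hρB : ∀ x, ρ x ≤ B := fun x =>
    (le_abs_self _).trans ((hB₁ x).trans (le_max_left _ _))
  have hρB' : ∀ x, |deriv ρ x| ≤ B := fun x => (hB₂ x).trans (le_max_right _ _)
  have hB0 : 0 ≤ B := (hρ.nonneg 0).trans (hρB 0)
  obtain ⟨κ', hκ'0, hκ'⟩ := exists_pos_mul_le (A := L * (M - m) * B * 4 * T * X) (by positivity) hη4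
  obtain ⟨ψ, S, κ, hψ, hS, hκ0, hκ1, hκS, hψa⟩ := hw κ' hκ'0
  obtain ⟨δ, hδ0, hδ⟩ := exists_pos_mul_le
    (A := 2 * (3 * B) * (2 * (S + 1)) * T * X + X) (by positivity) hη4
  refine ⟨δ, hδ0, S, hS, fun e₁ e₂ v w he₁ he₁' he₂ he₂' hv hw hdv hdw hmod h0 t ht => ?_⟩
  have h0T : (0 : ℝ) ∈ Icc 0 T := left_mem_Icc.2 hT
  have k1 := doubled_le hG hmM hρ hr0 hψ hS hκ0 hκ1 hρB hρB' he₁ he₂ hv hw hdv hdw t ht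
  have k2 := (abs_le.1 (abs_doubled_sub_le hρ hr0 hψ hV (hv.meas t ht) (hw.meas t ht) (hv.mem t ht)
    (hw.mem t ht) (hmod t ht))).1
  have k3 := (abs_le.1 (abs_doubled_sub_le hρ hr0 hψ hV (hv.meas 0 h0T) (hw.meas 0 h0T)
    (hv.mem 0 h0T) (hw.mem 0 h0T) (hmod 0 h0T))).2
  have hψc : HasCompactSupport ψ := HasCompactSupport.intro isCompact_Icc fun x hx => hψ.eq_zero x hx
  have hint : ∀ s ∈ Icc 0 T, Integrable fun z => |v z s - w z s| * ψ z := fun s hs =>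
    integrable_bdd_mul (C := M - m)
      (Measurable.aestronglyMeasurable (by have := hv.meas s hs; have := hw.meas s hs; fun_prop))
      (fun p => by rw [abs_abs]; exact abs_sub_le_of_mem_Icc (hv.mem s hs _) (hw.mem s hs _))
      hψ.smooth.continuous hψc
  have hint' : ∀ s ∈ Icc 0 T, ∀ S, IntegrableOn (fun z => |v z s - w z s|) (Icc (-S) S) :=
    fun s hs S => Measure.integrableOn_of_bounded (M := M - m) (by simp)
      (by have := hv.meas s hs; have := hw.meas s hs; fun_prop)
      (ae_of_all _ fun z => by
        rw [Real.norm_eq_abs, abs_abs]; exact abs_sub_le_of_mem_Icc (hv.mem s hs _) (hw.mem s hs _))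
  have k4 : a * ∫ z in Icc (-R) R, |v z t - w z t| ≤ ∫ z, |v z t - w z t| * ψ z := by
    rw [← integral_const_mul]
    calc _ ≤ ∫ z in Icc (-R) R, |v z t - w z t| * ψ z := by
          refine setIntegral_mono_on ((hint' t ht R).const_mul a) (hint t ht).integrableOn
            measurableSet_Icc fun z hz => ?_
          rw [mul_comm]
          exact mul_le_mul_of_nonneg_left (hψa z hz) (abs_nonneg _)
      _ ≤ _ := setIntegral_le_integral (hint t ht)
          (ae_of_all _ fun z => mul_nonneg (abs_nonneg _) (hψ.nonneg _))
  have k5 : ∫ z, |v z 0 - w z 0| * ψ z ≤ δ := by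
    refine le_trans ?_ h0
    rw [← setIntegral_eq_integral_of_forall_compl_eq_zero (s := Icc (-S) S)
      (fun z hz => by simp [hψ.eq_zero z hz])]
    exact setIntegral_mono (hint 0 h0T).integrableOn (hint' 0 h0T S) fun z =>
      mul_le_of_le_one_right (abs_nonneg _) (hψ.le_one z)
  have hr1 : r ≤ 1 := min_le_right _ _
  have hE1 : L * (M - m) * κ * B * (2 * (S + r)) ^ 2 ≤ L * (M - m) * B * 4 * κ' := by
    calc _ = L * (M - m) * B * 4 * (κ * (S + r) ^ 2) := by ring
      _ ≤ L * (M - m) * B * 4 * (κ * (S + 1) ^ 2) := by gcongr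
      _ ≤ _ := by gcongr
  have hE2 : (e₁ + e₂) * (3 * B) * (2 * (S + r)) ≤ δ * (2 * (3 * B) * (2 * (S + 1))) := by
    calc _ ≤ (δ + δ) * (3 * B) * (2 * (S + 1)) := by gcongr
      _ = _ := by ring
  have hexp : Real.exp ((L + 1) * t) ≤ X := Real.exp_le_exp.2 (by gcongr; exact ht.2)
  have k6 : doubled ρ ψ (fun z => v z t) (fun z => w z t)
      ≤ (δ + V * r + (L * (M - m) * B * 4 * κ' + δ * (2 * (3 * B) * (2 * (S + 1)))) * T) * X := by
    refine k1.trans ?_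
    have ht0 := ht.1
    have : doubled ρ ψ (fun z => v z 0) (fun z => w z 0) ≤ δ + V * r := by linarith
    have ht1 := ht.2
    gcongr
  have k7 : V * r ≤ V * r * X := le_mul_of_one_le_right (by positivity) hX1
  have : a * ∫ z in Icc (-R) R, |v z t - w z t| ≤ a * η := by
    nlinarith
  exact le_of_mul_le_mul_left this ha

end Comparison

/-! ### Truncation and the flux -/

/-- Truncation to the interval `[m, M]`. -/
def clamp (m M x : ℝ) : ℝ := max m (min x M)

lemma clamp_mem {m M : ℝ} (h : m ≤ M) (x : ℝ) : clamp m M x ∈ Icc m M :=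
  ⟨le_max_left _ _, max_le h (min_le_right _ _)⟩

lemma clamp_of_mem {m M x : ℝ} (h : x ∈ Icc m M) : clamp m M x = x := by
  rw [clamp, min_eq_left h.2, max_eq_right h.1]

lemma lipschitzWith_clamp (m M : ℝ) : LipschitzWith 1 (clamp m M) :=
  (LipschitzWith.id.min_const M).const_max m

lemma monotone_clamp (m M : ℝ) : Monotone (clamp m M) := fun _ _ h =>
  max_le_max_left m (min_le_min_right M h)

/-- The flux and the entropy fluxes are controlled only on (0,∞) and may blow up near 0. Composition
with truncation makes them globally Lipschitz without altering them on the range of the solution. -/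
lemma lipschitzWith_comp_clamp {f f' : ℝ → ℝ} {m M : ℝ} (hm : 0 < m) (hmM : m ≤ M)
    (hd : ∀ w, 0 < w → HasDerivAt f (f' w) w) (hc : ContinuousOn f' (Ioi 0)) :
    ∃ L, LipschitzWith L fun x => f (clamp m M x) := by
  have hsub : Icc m M ⊆ Ioi 0 := fun x hx => hm.trans_le hx.1
  obtain ⟨C, hC⟩ := isCompact_Icc.exists_bound_of_continuousOn (hc.mono hsub)
  have hC0 : 0 ≤ C := (norm_nonneg _).trans (hC m (left_mem_Icc.2 hmM))
  have h1 : LipschitzOnWith C.toNNReal f (Icc m M) :=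
    (convex_Icc m M).lipschitzOnWith_of_nnnorm_hasDerivWithin_le
      (fun x hx => (hd x (hsub hx)).hasDerivWithinAt) fun x hx => by
        rw [← NNReal.coe_le_coe, coe_nnnorm, Real.coe_toNNReal _ hC0]; exact hC x hx
  refine ⟨C.toNNReal, fun x y => ?_⟩
  refine (h1 (clamp_mem hmM x) (clamp_mem hmM y)).trans ?_
  gcongr
  simpa using lipschitzWith_clamp m M x y

section Flux

variable {V : ℝ → ℝ}

lemma contDiffOn_flux (hV : ContDiffOn ℝ 1 V (Ici 0)) : ContDiffOn ℝ 1 (flux V) (Ioi 0) := by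
  refine hV.comp (t := Ici 0) ?_ fun x (hx : 0 < x) => (by positivity : (0 : ℝ) ≤ 1 / x)
  exact contDiffOn_const.div contDiffOn_id fun x hx => ne_of_gt hx

lemma hasDerivAt_flux (hV : ContDiffOn ℝ 1 V (Ici 0)) (w : ℝ) (hw : 0 < w) :
    HasDerivAt (flux V) (deriv (flux V) w) w :=
  (((contDiffOn_flux hV).differentiableOn one_ne_zero).differentiableAt
    (Ioi_mem_nhds hw)).hasDerivAt

lemma continuousOn_deriv_flux (hV : ContDiffOn ℝ 1 V (Ici 0)) :
    ContinuousOn (deriv (flux V)) (Ioi 0) :=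
  (contDiffOn_flux hV).continuousOn_deriv_of_isOpen isOpen_Ioi le_rfl

lemma monotoneOn_flux (hV : AntitoneOn V (Ici 0)) : MonotoneOn (flux V) (Ioi 0) := by
  intro x hx y hy hxy
  have hx' : 0 < x := hx
  have hy' : 0 < y := hy
  exact hV (mem_Ici.2 (by positivity)) (mem_Ici.2 (by positivity))
    (one_div_le_one_div_of_le hx' hxy)

lemma deriv_flux_nonneg (hV : AntitoneOn V (Ici 0)) {w : ℝ} (hw : 0 < w) :
    0 ≤ deriv (flux V) w := by
  rw [← derivWithin_of_mem_nhds (Ioi_mem_nhds hw)]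
  exact (monotoneOn_flux hV).derivWithin_nonneg

lemma monotone_flux_clamp (hV : AntitoneOn V (Ici 0)) {m M : ℝ} (hm : 0 < m) (hmM : m ≤ M) :
    Monotone fun x => flux V (clamp m M x) := fun _ _ h =>
  monotoneOn_flux hV (hm.trans_le (clamp_mem hmM _).1) (hm.trans_le (clamp_mem hmM _).1)
    (monotone_clamp m M h)

lemma exists_abs_flux_clamp_le (hV : ContDiffOn ℝ 1 V (Ici 0)) {m M : ℝ} (hm : 0 < m)
    (hmM : m ≤ M) : ∃ C, ∀ x, |flux V (clamp m M x)| ≤ C := by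
  obtain ⟨C, hC⟩ := isCompact_Icc.exists_bound_of_continuousOn
    ((contDiffOn_flux hV).continuousOn.mono fun x (hx : x ∈ Icc m M) => hm.trans_le hx.1)
  exact ⟨C, fun x => hC _ (clamp_mem hmM x)⟩

/-- The convexity inequality behind all entropy inequalities. -/
lemma entropy_flux_le (hV : ContDiffOn ℝ 1 V (Ici 0)) (hVa : AntitoneOn V (Ici 0))
    {η Q : ℝ → ℝ} (h : IsEntropyPair V η Q) {a b : ℝ} (ha : 0 < a) (hb : 0 < b) :
    deriv η a * (flux V b - flux V a) ≤ Q b - Q a := by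
  have hmono : Monotone (deriv η) :=
    h.convex.monotoneOn_deriv (fun x _ => (h.smooth.differentiable two_ne_zero x)) |>.mono
      (subset_univ _) |> monotoneOn_univ.1
  -- D' = (η' - η'(a)) W' has the sign of x - a, since η' is non-decreasing and W' ≥ 0; hence D is
  -- minimal at a.
  set D : ℝ → ℝ := fun x => Q x - deriv η a * flux V x with hD
  have hDd : ∀ x, 0 < x → HasDerivAt D ((deriv η x - deriv η a) * deriv (flux V) x) x :=
    fun x hx => ((h.flux_deriv x hx).sub ((hasDerivAt_flux hV x hx).const_mul _)).congr_deriv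
      (by ring)
  suffices D a ≤ D b by simp only [hD] at this; linarith
  have hpos : ∀ x ∈ uIcc a b, 0 < x := fun x hx => (lt_min ha hb).trans_le hx.1
  rcases le_total a b with hab | hab
  · rw [uIcc_of_le hab] at hpos
    refine monotoneOn_of_deriv_nonneg (convex_Icc a b)
      (fun x hx => (hDd x (hpos x hx)).continuousAt.continuousWithinAt)
      (fun x hx => (hDd x (hpos x (interior_subset hx))).differentiableAt.differentiableWithinAt)
      (fun x hx => ?_) (left_mem_Icc.2 hab) (right_mem_Icc.2 hab) hab
    have hx' := interior_subset hx
    rw [(hDd x (hpos x hx')).deriv]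
    exact mul_nonneg (sub_nonneg.2 (hmono hx'.1)) (deriv_flux_nonneg hVa (hpos x hx'))
  · rw [uIcc_of_ge hab] at hpos
    refine antitoneOn_of_deriv_nonpos (convex_Icc b a)
      (fun x hx => (hDd x (hpos x hx)).continuousAt.continuousWithinAt)
      (fun x hx => (hDd x (hpos x (interior_subset hx))).differentiableAt.differentiableWithinAt)
      (fun x hx => ?_) (left_mem_Icc.2 hab) (right_mem_Icc.2 hab) hab
    have hx' := interior_subset hx
    rw [(hDd x (hpos x hx')).deriv]
    exact mul_nonpos_of_nonpos_of_nonneg (sub_nonpos.2 (hmono hx'.2))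
      (deriv_flux_nonneg hVa (hpos x hx'))

lemma IsEntropyPair.continuousOn_deriv (hV : ContDiffOn ℝ 1 V (Ici 0)) {η Q : ℝ → ℝ}
    (h : IsEntropyPair V η Q) : ContinuousOn (fun w => deriv η w * deriv (flux V) w) (Ioi 0) :=
  (h.smooth.continuous_deriv (by norm_num)).continuousOn.mul (continuousOn_deriv_flux hV)

end Flux

/-! ### Weak forms of classical solutions -/

lemma IsTest.hasDerivAt_fst {φ : ℝ × ℝ → ℝ} (hφ : IsTest φ) (z t : ℝ) :
    HasDerivAt (fun x => φ (x, t)) (fderiv ℝ φ (z, t) (1, 0)) z := by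
  have h1 : HasFDerivAt φ (fderiv ℝ φ (z, t)) (z, t) :=
    (hφ.1.differentiable (by simp) _).hasFDerivAt
  exact h1.comp_hasDerivAt z ((hasDerivAt_id z).prodMk (hasDerivAt_const z t))

lemma IsTest.hasDerivAt_snd {φ : ℝ × ℝ → ℝ} (hφ : IsTest φ) (z t : ℝ) :
    HasDerivAt (fun s => φ (z, s)) (fderiv ℝ φ (z, t) (0, 1)) t := by
  have h1 : HasFDerivAt φ (fderiv ℝ φ (z, t)) (z, t) :=
    (hφ.1.differentiable (by simp) _).hasFDerivAt
  exact h1.comp_hasDerivAt t ((hasDerivAt_const t z).prodMk (hasDerivAt_id t))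

lemma IsTest.continuous_fderiv {φ : ℝ × ℝ → ℝ} (hφ : IsTest φ) (v : ℝ × ℝ) :
    Continuous fun p => fderiv ℝ φ p v :=
  (hφ.1.continuous_fderiv (by simp)).clm_apply continuous_const

lemma IsTest.hasCompactSupport_fderiv {φ : ℝ × ℝ → ℝ} (hφ : IsTest φ) (v : ℝ × ℝ) :
    HasCompactSupport fun p => fderiv ℝ φ p v := hφ.2.fderiv_apply ℝ v

lemma hasCompactSupport_slice {φ : ℝ × ℝ → ℝ} (hφ : HasCompactSupport φ) (t : ℝ) :
    HasCompactSupport fun z => φ (z, t) := by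
  refine HasCompactSupport.intro (hφ.image continuous_fst) fun z hz => ?_
  by_contra h
  exact hz ⟨(z, t), subset_tsupport _ h, rfl⟩

lemma continuous_integral_slice {K : ℝ × ℝ → ℝ} (hK : Continuous K) (hKc : HasCompactSupport K) :
    Continuous fun t => ∫ z, K (z, t) := by
  have h1 : Continuous (Function.uncurry fun t z => K (z, t)) := hK.comp continuous_swap
  have h2 := continuous_parametric_integral_of_continuous (μ := (volume : Measure ℝ)) h1
    (hKc.image continuous_fst)
  refine h2.congr fun t => setIntegral_eq_integral_of_forall_compl_eq_zero fun z hz => ?_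
  by_contra h
  exact hz ⟨(z, t), subset_tsupport _ h, rfl⟩

lemma integral_mul_deriv_slice {F F' : ℝ → ℝ} (hF : ∀ z, HasDerivAt F (F' z) z)
    (hF' : Continuous F') {φ : ℝ × ℝ → ℝ} (hφ : IsTest φ) (t : ℝ) :
    ∫ z, F z * deriv (fun x => φ (x, t)) z = -∫ z, F' z * φ (z, t) := by
  have hFc : Continuous F := continuous_iff_continuousAt.2 fun z => (hF z).continuousAt
  have hφc : Continuous fun z => φ (z, t) := hφ.1.continuous.comp (by fun_prop)
  have hφ' : Continuous (deriv fun x => φ (x, t)) := by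
    have : deriv (fun x => φ (x, t)) = fun z => fderiv ℝ φ (z, t) (1, 0) :=
      funext fun z => (hφ.hasDerivAt_fst z t).deriv
    rw [this]
    exact (hφ.continuous_fderiv (1, 0)).comp (by fun_prop : Continuous fun z : ℝ => (z, t))
  have hs := hasCompactSupport_slice hφ.2 t
  exact integral_mul_deriv_eq_deriv_mul_of_integrable (fun z _ => hF z)
    (fun z _ => (hφ.hasDerivAt_fst z t).differentiableAt.hasDerivAt)
    ((hFc.mul hφ').integrable_of_hasCompactSupport hs.deriv.mul_left)
    ((hF'.mul hφc).integrable_of_hasCompactSupport hs.mul_left)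
    ((hFc.mul hφc).integrable_of_hasCompactSupport hs.mul_left)

lemma integral_deriv_time {A A' : ℝ → ℝ → ℝ} {T : ℝ} (hT : 0 ≤ T)
    (hA : Continuous fun p : ℝ × ℝ => A p.1 p.2) (hA' : Continuous fun p : ℝ × ℝ => A' p.1 p.2)
    (hAd : ∀ z, ∀ t ∈ Ioo 0 T, HasDerivAt (fun s => A z s) (A' z t) t)
    {φ : ℝ × ℝ → ℝ} (hφ : IsTest φ) :
    ∫ t in (0 : ℝ)..T, ∫ z, (A z t * deriv (fun s => φ (z, s)) t + A' z t * φ (z, t))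
      = ∫ z, (A z T * φ (z, T) - A z 0 * φ (z, 0)) := by
  set g : ℝ → ℝ → ℝ := fun t z => A z t * fderiv ℝ φ (z, t) (0, 1) + A' z t * φ (z, t) with hg
  have hφc := hφ.1.continuous
  have hφt := hφ.continuous_fderiv (0, 1)
  have hgc : Continuous (Function.uncurry fun z t => g t z) := by
    have h1 : Continuous fun p : ℝ × ℝ =>
      A p.1 p.2 * fderiv ℝ φ p (0, 1) + A' p.1 p.2 * φ p := by fun_prop
    exact h1
  have hgs : HasCompactSupport (Function.uncurry fun z t => g t z) :=
    HasCompactSupport.add (f := fun p : ℝ × ℝ => A p.1 p.2 * fderiv ℝ φ p (0, 1))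
      (f' := fun p : ℝ × ℝ => A' p.1 p.2 * φ p)
      (hφ.hasCompactSupport_fderiv (0, 1)).mul_left hφ.2.mul_left
  have hgi : Integrable (Function.uncurry fun z t => g t z) (volume.prod volume) :=
    hgc.integrable_of_hasCompactSupport hgs
  have hgi' : Integrable (Function.uncurry fun z t => g t z)
      (volume.prod (volume.restrict (Ioc 0 T))) := by
    have h1 : (volume : Measure ℝ).prod (volume.restrict (Ioc 0 T))
        = ((volume : Measure ℝ).prod volume).restrict (univ ×ˢ Ioc 0 T) := by
      rw [← Measure.prod_restrict, Measure.restrict_univ]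
    rw [h1]
    exact hgi.restrict
  have e1 : ∀ t z, A z t * deriv (fun s => φ (z, s)) t + A' z t * φ (z, t) = g t z := fun t z => by
    rw [(hφ.hasDerivAt_snd z t).deriv]
  simp only [e1]
  rw [intervalIntegral.integral_of_le hT, ← integral_integral_swap hgi']
  refine integral_congr_ae (ae_of_all _ fun z => ?_)
  simp only
  rw [← intervalIntegral.integral_of_le hT]
  refine intervalIntegral.integral_eq_sub_of_hasDerivAt_of_le
    (f := fun t => A z t * φ (z, t)) hT ?_ (fun t ht => ?_) ?_
  · exact Continuous.continuousOn ((hA.comp (by fun_prop : Continuous fun t : ℝ => (z, t))).mul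
      (hφc.comp (by fun_prop)))
  · have := (hAd z t ht).mul (hφ.hasDerivAt_snd z t)
    exact this.congr_deriv (by simp only [hg]; ring)
  · exact (hgc.comp (by fun_prop : Continuous fun t : ℝ => (z, t))).intervalIntegrable _ _

/-- Fubini with the fundamental theorem in t absorbs the boundary terms, and integration by parts in
z does the rest: for classical functions the weak form is the tested residual ∂_z F - ∂_t A. -/
lemma weakForm_eq {A A' F F' : ℝ → ℝ → ℝ} {T : ℝ} (hT : 0 ≤ T)
    (hA : Continuous fun p : ℝ × ℝ => A p.1 p.2) (hA' : Continuous fun p : ℝ × ℝ => A' p.1 p.2)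
    (hAd : ∀ z, ∀ t ∈ Ioo 0 T, HasDerivAt (fun s => A z s) (A' z t) t)
    (hF : Continuous fun p : ℝ × ℝ => F p.1 p.2) (hF' : Continuous fun p : ℝ × ℝ => F' p.1 p.2)
    (hFd : ∀ z t, HasDerivAt (fun x => F x t) (F' z t) z)
    {φ : ℝ × ℝ → ℝ} (hφ : IsTest φ) :
    weakForm T A F (fun z => A z 0) φ = ∫ t in (0 : ℝ)..T, ∫ z, (F' z t - A' z t) * φ (z, t) := by
  have hφc := hφ.1.continuous
  have hφt := hφ.continuous_fderiv (0, 1)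
  have hφz := hφ.continuous_fderiv (1, 0)
  have slice : ∀ {K : ℝ × ℝ → ℝ}, Continuous K → HasCompactSupport K → ∀ t,
      Integrable fun z => K (z, t) := fun hK hKc t =>
    Continuous.integrable_of_hasCompactSupport (hK.comp (by fun_prop)) (hasCompactSupport_slice hKc t)
  have j1 := slice (K := fun p => A p.1 p.2 * fderiv ℝ φ p (0, 1)) (by fun_prop)
    (hφ.hasCompactSupport_fderiv (0, 1)).mul_left
  have j2 := slice (K := fun p => F p.1 p.2 * fderiv ℝ φ p (1, 0)) (by fun_prop)
    (hφ.hasCompactSupport_fderiv (1, 0)).mul_left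
  have j3 := slice (K := fun p => F' p.1 p.2 * φ p) (by fun_prop) hφ.2.mul_left
  have j4 := slice (K := fun p => A' p.1 p.2 * φ p) (by fun_prop) hφ.2.mul_left
  have d1 : ∀ z t, deriv (fun s => φ (z, s)) t = fderiv ℝ φ (z, t) (0, 1) := fun z t =>
    (hφ.hasDerivAt_snd z t).deriv
  have d2 : ∀ z t, deriv (fun x => φ (x, t)) z = fderiv ℝ φ (z, t) (1, 0) := fun z t =>
    (hφ.hasDerivAt_fst z t).deriv
  rw [weakForm, ← integral_deriv_time hT hA hA' hAd hφ]
  have e1 : ∀ t, ∫ z, (A z t * deriv (fun s => φ (z, s)) t - F z t * deriv (fun x => φ (x, t)) z)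
      = (∫ z, (F' z t - A' z t) * φ (z, t))
        + ∫ z, (A z t * deriv (fun s => φ (z, s)) t + A' z t * φ (z, t)) := by
    intro t
    have ibp := integral_mul_deriv_slice (fun z => hFd z t)
      (hF'.comp (by fun_prop : Continuous fun z : ℝ => (z, t))) hφ t
    simp only [d1, d2] at ibp ⊢
    rw [integral_sub (j1 t) (j2 t), ibp, integral_add (j1 t) (j4 t)]
    simp only [sub_mul]
    rw [integral_sub (j3 t) (j4 t)]
    ring
  have c1 := continuous_integral_slice (K := fun p => (F' p.1 p.2 - A' p.1 p.2) * φ p)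
    (by fun_prop) hφ.2.mul_left
  have c2 := continuous_integral_slice
    (K := fun p => A p.1 p.2 * fderiv ℝ φ p (0, 1) + A' p.1 p.2 * φ p) (by fun_prop)
    (HasCompactSupport.add (f := fun p : ℝ × ℝ => A p.1 p.2 * fderiv ℝ φ p (0, 1))
      (f' := fun p : ℝ × ℝ => A' p.1 p.2 * φ p)
      (hφ.hasCompactSupport_fderiv (0, 1)).mul_left hφ.2.mul_left)
  simp only [e1]
  simp only [d1]
  rw [intervalIntegral.integral_add (c1.intervalIntegrable _ _) (c2.intervalIntegrable _ _)]
  ring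

/-! ### Filtered solutions as flows -/

/-- `ν` is the measure `-dΨ`. -/
structure IsTailMeasure (Ψ : ℝ → ℝ) (ν : Measure ℝ) : Prop where
  pos : ∀ᵐ ζ ∂ν, 0 < ζ
  tail : ∀ᵐ x ∂(volume.restrict (Ioi (0 : ℝ))), ν.real (Ioi x) = Ψ x

/-- Solutions of the filtered equation as curves of bounded continuous functions, extended
continuously to all times. -/
structure IsFlow (ν : Measure ℝ) [IsFiniteMeasure ν] {G : ℝ → ℝ} {L : ℝ≥0}
    (hG : LipschitzWith L G) (a b C T : ℝ) (u : ℝ → ℝ →ᵇ ℝ) : Prop where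
  cont : Continuous u
  ode : ∀ t ∈ Icc 0 T, HasDerivWithinAt u (jumpField ν hG (u t)) (Icc 0 T) t
  mem : ∀ t, u t ∈ regularSet a b C

section Flow

variable {Ψ : ℝ → ℝ} {ν : Measure ℝ} [IsFiniteMeasure ν] {G : ℝ → ℝ} {L : ℝ≥0}
  {a b C T : ℝ} {u : ℝ → ℝ →ᵇ ℝ}

lemma exists_isFlow (hG : LipschitzWith L G) (hmono : Monotone G) {D : ℝ} (hD : ∀ x, |G x| ≤ D)
    (hT : 0 ≤ T) {u₀ : ℝ →ᵇ ℝ} (h0 : u₀ ∈ regularSet a b C) :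
    ∃ u, IsFlow ν hG a b C T u ∧ u 0 = u₀ := by
  obtain ⟨u, hu0, hu⟩ := exists_jump_trajectory ν hG hD hT u₀
  have hmem := jump_trajectory_mem_regularSet ν hG hmono hu (by rwa [hu0])
  have hc : ContinuousOn u (Icc 0 T) := fun t ht => (hu t ht).continuousWithinAt
  have hcl : ∀ t ∈ Icc 0 T, u (clamp 0 T t) = u t := fun t ht => by rw [clamp_of_mem ht]
  -- The curve is frozen outside [0, T], so that joint continuity holds on the whole plane.
  refine ⟨fun t => u (clamp 0 T t), ⟨?_, fun t ht => ?_, fun t => hmem _ (clamp_mem hT t)⟩, ?_⟩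
  · exact hc.comp_continuous (lipschitzWith_clamp 0 T).continuous (clamp_mem hT)
  · simp only [hcl t ht]
    exact (hu t ht).congr hcl (hcl t ht)
  · simp only [hcl 0 (left_mem_Icc.2 hT), hu0]

/-- Composition with `avg Ψ` preserves bounded continuous functions. -/
noncomputable def avgBCF (hΨ : IsKernel Ψ) (h : ℝ →ᵇ ℝ) : ℝ →ᵇ ℝ :=
  BoundedContinuousFunction.ofNormedAddCommGroup (avg Ψ h)
    (by
      obtain ⟨K, hK⟩ := hΨ.avg_lipschitz h.continuous.measurable h.norm_coe_le_norm
      exact hK.continuous) ‖h‖ fun z => abs_le.2 (hΨ.avg_mem_Icc h.continuous.measurable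
        (fun x => abs_le.1 (h.norm_coe_le_norm x)) z)

lemma avgBCF_apply (hΨ : IsKernel Ψ) (h : ℝ →ᵇ ℝ) (z : ℝ) : avgBCF hΨ h z = avg Ψ h z := rfl

lemma continuous_avgBCF (hΨ : IsKernel Ψ) : Continuous (avgBCF hΨ) := by
  refine LipschitzWith.continuous (K := 1) (LipschitzWith.of_dist_le_mul fun g h => ?_)
  rw [NNReal.coe_one, one_mul]
  refine (BoundedContinuousFunction.dist_le dist_nonneg).2 fun z => ?_
  have h1 : avg Ψ g z - avg Ψ h z = avg Ψ (g - h : ℝ →ᵇ ℝ) z := by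
    rw [avg, avg, ← integral_sub (hΨ.integrable_mul (g := fun x => g (z + x)) (by fun_prop)
      fun x => g.norm_coe_le_norm _) (hΨ.integrable_mul (g := fun x => h (z + x)) (by fun_prop)
      fun x => h.norm_coe_le_norm _)]
    simp only [← mul_sub]; rfl
  rw [avgBCF_apply, avgBCF_apply, Real.dist_eq, h1, dist_eq_norm]
  exact (avgBCF hΨ (g - h)).norm_coe_le_norm z |>.trans
    (BoundedContinuousFunction.norm_ofNormedAddCommGroup_le _ (norm_nonneg _) _)

lemma continuous_uncurry_bcf {f : ℝ → ℝ →ᵇ ℝ} (hf : Continuous f) :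
    Continuous fun p : ℝ × ℝ => f p.2 p.1 :=
  continuous_eval.comp ((hf.comp continuous_snd).prodMk continuous_fst)

/-- The chain rule in time gives ∂_t η(u) = η'(u) J(G(u)), and the spatial derivative of the
averaged Q(u) is J(Q(u)). Thus the entropy production is the difference of two jump integrals
against the same ν. -/
lemma IsFlow.weakForm_eq (hΨ : IsKernel Ψ) (hν : IsTailMeasure Ψ ν) {hG : LipschitzWith L G}
    (hu : IsFlow ν hG a b C T u) (hT : 0 ≤ T) {η Q : ℝ → ℝ} {K : ℝ≥0} (hη : ContDiff ℝ 1 η)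
    (hQ : LipschitzWith K Q) {φ : ℝ × ℝ → ℝ} (hφ : IsTest φ) :
    weakForm T (fun z t => η (u t z)) (fun z t => avg Ψ (fun x => Q (u t x)) z)
        (fun z => η (u 0 z)) φ
      = ∫ t in (0 : ℝ)..T, ∫ z, (jump ν ((u t).comp Q hQ) z
          - deriv η (u t z) * jump ν ((u t).comp G hG) z) * φ (z, t) := by
  have hGu : Continuous fun t => (u t).comp G hG :=
    (BoundedContinuousFunction.continuous_comp hG).comp hu.cont
  have hQu : Continuous fun t => (u t).comp Q hQ :=
    (BoundedContinuousFunction.continuous_comp hQ).comp hu.cont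
  have hj := (lipschitz_jump ν).continuous
  have hcu := continuous_uncurry_bcf hu.cont
  have hη' := hη.continuous_deriv le_rfl
  refine LagrangianLWR.weakForm_eq (A := fun z t => η (u t z))
    (A' := fun z t => deriv η (u t z) * jump ν ((u t).comp G hG) z)
    (F := fun z t => avg Ψ (fun x => Q (u t x)) z)
    (F' := fun z t => jump ν ((u t).comp Q hQ) z) hT (hη.continuous.comp hcu)
    ((hη'.comp hcu).mul (continuous_uncurry_bcf (hj.comp hGu))) (fun z t ht => ?_)
    (continuous_uncurry_bcf ((continuous_avgBCF hΨ).comp hQu))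
    (continuous_uncurry_bcf (hj.comp hQu)) (fun z t => ?_) hφ
  · have h1 := (hu.ode t (Ioo_subset_Icc_self ht)).hasDerivAt (Icc_mem_nhds ht.1 ht.2)
    have h2 : HasDerivAt (fun s => u s z) (jumpField ν hG (u t) z) t :=
      (BoundedContinuousFunction.evalCLM ℝ (β := ℝ) z).hasFDerivAt.comp_hasDerivAt t h1
    exact ((hη.differentiable one_ne_zero (u t z)).hasDerivAt).comp t h2
  · rw [jump_apply']
    exact hΨ.hasDerivAt_avg hν.pos hν.tail ((u t).comp Q hQ).continuous
      ((u t).comp Q hQ).norm_coe_le_norm z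

/-- For each jump ζ the production is Q(u(z+ζ)) - Q(u(z)) - η'(u(z)) (G(u(z+ζ)) - G(u(z))),
non-negative by `hηQ`. The entropy inequality with averaged flux therefore holds without error at
every scale. -/
lemma IsFlow.weakForm_nonneg (hΨ : IsKernel Ψ) (hν : IsTailMeasure Ψ ν) {hG : LipschitzWith L G}
    (hu : IsFlow ν hG a b C T u) (hT : 0 ≤ T) {η Q : ℝ → ℝ} {K : ℝ≥0} (hη : ContDiff ℝ 1 η)
    (hQ : LipschitzWith K Q)
    (hηQ : ∀ x ∈ Icc a b, ∀ y ∈ Icc a b, deriv η x * (G y - G x) ≤ Q y - Q x)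
    {φ : ℝ × ℝ → ℝ} (hφ : IsTest φ) (hφ0 : ∀ p, 0 ≤ φ p) :
    0 ≤ weakForm T (fun z t => η (u t z)) (fun z t => avg Ψ (fun x => Q (u t x)) z)
        (fun z => η (u 0 z)) φ := by
  rw [hu.weakForm_eq hΨ hν hT hη hQ hφ]
  refine intervalIntegral.integral_nonneg hT fun t _ => integral_nonneg fun z =>
    mul_nonneg (sub_nonneg.2 ?_) (hφ0 _)
  rw [jump_apply', jump_apply', ← integral_const_mul]
  refine integral_mono (((integrable_shift ν ((u t).comp G hG) z).sub
    (integrable_const _)).const_mul _) ((integrable_shift ν ((u t).comp Q hQ) z).sub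
    (integrable_const _)) fun ζ => ?_
  exact hηQ _ ((hu.mem t).1 z) _ ((hu.mem t).1 (z + ζ))

lemma IsFlow.weakForm_eq_zero (hΨ : IsKernel Ψ) (hν : IsTailMeasure Ψ ν) {hG : LipschitzWith L G}
    (hu : IsFlow ν hG a b C T u) (hT : 0 ≤ T) {φ : ℝ × ℝ → ℝ} (hφ : IsTest φ) :
    weakForm T (fun z t => u t z) (fun z t => avg Ψ (fun x => G (u t x)) z)
        (fun z => u 0 z) φ = 0 := by
  have := hu.weakForm_eq hΨ hν hT (η := id) contDiff_id hG hφ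
  simp only [id] at this
  rw [this]
  simp [deriv_id']

/-- In space the constant comes from translated trajectories, in time from the bounded speed of the
field. -/
lemma IsFlow.exists_lipschitz {hG : LipschitzWith L G} (hu : IsFlow ν hG a b C T u) {D : ℝ}
    (hD : ∀ x, |G x| ≤ D) {K₀ : ℝ≥0} (h0 : LipschitzWith K₀ (u 0)) :
    ∃ K, LipschitzOnWith K (fun p : ℝ × ℝ => u p.2 p.1) (univ ×ˢ Icc 0 T) := by
  obtain ⟨K₁, hK₁⟩ := jump_trajectory_lipschitz ν hG hu.ode h0
  have hD0 : 0 ≤ D := (abs_nonneg _).trans (hD 0)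
  have htime : ∀ s ∈ Icc 0 T, ∀ t ∈ Icc 0 T, ‖u s - u t‖ ≤ 2 * ν.real univ * D * ‖s - t‖ :=
    fun s hs t ht => (convex_Icc 0 T).norm_image_sub_le_of_norm_hasDerivWithin_le hu.ode
      (fun x _ => norm_jumpField_le ν hG hD (u x)) ht hs
  refine ⟨(2 * ν.real univ * D).toNNReal + K₁, LipschitzOnWith.of_dist_le_mul ?_⟩
  rintro ⟨z, s⟩ ⟨-, hs⟩ ⟨y, t⟩ ⟨-, ht⟩
  have h1 : dist (u s z) (u t z) ≤ 2 * ν.real univ * D * dist s t := by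
    refine ((BoundedContinuousFunction.dist_coe_le_dist z).trans_eq (dist_eq_norm _ _)).trans ?_
    exact htime s hs t ht
  have h2 := (hK₁ t ht).dist_le_mul z y
  have h3 : dist s t ≤ dist (z, s) (y, t) := le_max_right _ _
  have h4 : dist z y ≤ dist (z, s) (y, t) := le_max_left _ _
  rw [NNReal.coe_add, Real.coe_toNNReal _ (by positivity)]
  calc dist (u s z) (u t y) ≤ dist (u s z) (u t z) + dist (u t z) (u t y) := dist_triangle _ _ _
    _ ≤ 2 * ν.real univ * D * dist (z, s) (y, t) + K₁ * dist (z, s) (y, t) := by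
        refine add_le_add (h1.trans ?_) (h2.trans ?_) <;> gcongr
    _ = _ := by ring

/-- A flow for one flux is a flow for every flux that agrees with it on the range. -/
lemma IsFlow.congr {hG : LipschitzWith L G} (hu : IsFlow ν hG a b C T u) {G' : ℝ → ℝ} {L' : ℝ≥0}
    (hG' : LipschitzWith L' G') (h : ∀ x ∈ Icc a b, G x = G' x) {a' b' : ℝ} (ha : a' ≤ a)
    (hb : b ≤ b') : IsFlow ν hG' a' b' C T u where
  cont := hu.cont
  ode t ht := by
    have h1 : jumpField ν hG' (u t) = jumpField ν hG (u t) := by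
      have : (u t).comp G' hG' = (u t).comp G hG := by
        ext z
        exact (h _ ((hu.mem t).1 z)).symm
      rw [jumpField, this, jumpField]
    rw [h1]
    exact hu.ode t ht
  mem t := ⟨fun z => Icc_subset_Icc ha hb ((hu.mem t).1 z), (hu.mem t).2⟩

lemma IsFlow.diniEntropy (hΨ : IsKernel Ψ) (hν : IsTailMeasure Ψ ν) {hG : LipschitzWith L G}
    (hu : IsFlow ν hG a b C T u) (hmono : Monotone G) (hC : 0 ≤ C) :
    DiniEntropy G a b (L * C * firstMoment Ψ) T fun z t => u t z :=
  jump_trajectory_diniEntropy hΨ hν.pos hν.tail hG hmono hC hu.ode fun t _ => hu.mem t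

lemma IsFlow.isBoundedCurve {hG : LipschitzWith L G} (hu : IsFlow ν hG a b C T u) :
    IsBoundedCurve a b T fun z t => u t z where
  meas t _ := (u t).continuous.measurable
  mem t _ := (hu.mem t).1
  cont t _ R hR ε hε := by
    have h1 : ∀ᶠ s in 𝓝[Icc 0 T] t, dist (u s) (u t) < ε / (2 * R) :=
      (hu.cont.tendsto t).mono_left nhdsWithin_le_nhds |>.eventually
        (Metric.ball_mem_nhds _ (by positivity))
    filter_upwards [h1] with s hs
    calc ∫ z in Icc (-R) R, |u s z - u t z| ≤ ∫ _z in Icc (-R) R, ε / (2 * R) := by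
          refine setIntegral_mono ?_ (by simp) fun z => ?_
          · exact ((u s).continuous.sub (u t).continuous).abs.continuousOn.integrableOn_Icc
          · exact (BoundedContinuousFunction.dist_coe_le_dist (f := u s) (g := u t) z).trans hs.le
      _ = ε := by
          simp only [integral_const, smul_eq_mul, measureReal_restrict_apply_univ,
            Real.volume_real_Icc]
          rw [max_eq_left (by linarith)]
          field_simp; ring

end Flow

/-! ### Test functions in time -/

lemma IsMollifier.integrable {ρ : ℝ → ℝ} {r : ℝ} (hρ : IsMollifier ρ r) : Integrable ρ :=
  integrable_of_integral_eq_one hρ.integral_eq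

/-- The primitive of a mollifier, a smoothed Heaviside function. -/
lemma IsMollifier.exists_primitive {ρ : ℝ → ℝ} {r : ℝ} (hρ : IsMollifier ρ r) :
    ∃ P : ℝ → ℝ, ContDiff ℝ ∞ P ∧ (∀ x, HasDerivAt P (ρ x) x) ∧ Monotone P ∧
      (∀ x ≤ -r, P x = 0) ∧ ∀ x, r ≤ x → P x = 1 := by
  have hc := hρ.smooth.continuous
  set P : ℝ → ℝ := fun x => ∫ y in Iic x, ρ y with hP
  have hPd : ∀ x, HasDerivAt P (ρ x) x := by
    intro x
    have h1 : P = fun x => (∫ y in Iic 0, ρ y) + ∫ y in (0 : ℝ)..x, ρ y := by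
      ext x
      rw [← intervalIntegral.integral_Iic_sub_Iic hρ.integrable.integrableOn
        hρ.integrable.integrableOn]
      simp [hP]
    rw [h1]
    exact (intervalIntegral.integral_hasDerivAt_right (hc.intervalIntegrable _ _)
      (hc.stronglyMeasurableAtFilter _ _) hc.continuousAt).const_add _
  refine ⟨P, ?_, hPd, ?_, fun x hx => ?_, fun x hx => ?_⟩
  · rw [contDiff_infty_iff_deriv]
    refine ⟨fun x => (hPd x).differentiableAt, ?_⟩
    rw [funext fun x => (hPd x).deriv]
    exact hρ.smooth
  · exact monotone_of_deriv_nonneg (fun x => (hPd x).differentiableAt) fun x => by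
      rw [(hPd x).deriv]; exact hρ.nonneg x
  · have hz : ∀ y ∈ Iio x, ρ y = 0 := fun y hy => hρ.eq_zero y fun h => by
      have h2 : y < x := hy
      linarith [h.1]
    simp only [hP]
    rw [integral_Iic_eq_integral_Iio]
    exact setIntegral_eq_zero_of_forall_eq_zero hz
  · have hz : ∀ y, y ∉ Iic x → ρ y = 0 := fun y hy => hρ.eq_zero y fun h => by
      have h2 : x < y := not_le.1 hy
      linarith [h.2]
    simp only [hP]
    rw [setIntegral_eq_integral_of_forall_compl_eq_zero hz, hρ.integral_eq]

lemma IsMollifier.abs_integral_sub_le {ρ : ℝ → ℝ} {r : ℝ} (hρ : IsMollifier ρ r) {T : ℝ}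
    {c : ℝ → ℝ} (hc : ContinuousOn c (Icc 0 T)) {q A ε : ℝ} (h0 : 0 ≤ q - r) (hT : q + r ≤ T)
    (hr : 0 < r) (hA : ∀ x ∈ Icc (q - r) (q + r), |c x - A| ≤ ε) :
    |(∫ x in (0 : ℝ)..T, ρ (x - q) * c x) - A| ≤ ε := by
  have hT0 : 0 ≤ T := by linarith
  have hρc := hρ.smooth.continuous
  have hcc : ContinuousOn (fun x => ρ (x - q) * c x) (Icc 0 T) :=
    (by fun_prop : Continuous fun x => ρ (x - q)).continuousOn.mul hc
  have i1 : IntervalIntegrable (fun x => ρ (x - q) * c x) volume 0 T :=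
    ContinuousOn.intervalIntegrable (by rwa [uIcc_of_le hT0])
  have i2 : IntervalIntegrable (fun x => ρ (x - q)) volume 0 T :=
    Continuous.intervalIntegrable (by fun_prop) _ _
  have hz : ∀ x, x ∉ Icc (q - r) (q + r) → ρ (x - q) = 0 := fun x hx =>
    hρ.eq_zero _ fun h => hx ⟨by linarith [h.1], by linarith [h.2]⟩
  have hz' : ∀ x, x ∉ Icc 0 T → ρ (x - q) = 0 := fun x hx => hz x fun h => hx
    ⟨by linarith [h.1], by linarith [h.2]⟩
  have e1 : ∫ x in (0 : ℝ)..T, ρ (x - q) = 1 := by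
    rw [intervalIntegral.integral_of_le hT0, ← integral_Icc_eq_integral_Ioc,
      setIntegral_eq_integral_of_forall_compl_eq_zero hz', integral_sub_right_eq_self, hρ.integral_eq]
  have e2 : (∫ x in (0 : ℝ)..T, ρ (x - q) * c x) - A = ∫ x in (0 : ℝ)..T, ρ (x - q) * (c x - A) := by
    simp only [mul_sub]
    rw [intervalIntegral.integral_sub i1 (i2.mul_const A), intervalIntegral.integral_mul_const, e1,
      one_mul]
  rw [e2, ← Real.norm_eq_abs]
  have := intervalIntegral.norm_integral_le_of_norm_le hT0 (μ := volume)
    (f := fun x => ρ (x - q) * (c x - A)) (g := fun x => ρ (x - q) * ε)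
    (ae_of_all _ fun x _ => ?_) (i2.mul_const ε)
  · refine this.trans_eq ?_
    rw [intervalIntegral.integral_mul_const, e1, one_mul]
  · rw [norm_mul, Real.norm_of_nonneg (hρ.nonneg _)]
    by_cases hx : x ∈ Icc (q - r) (q + r)
    · exact mul_le_mul_of_nonneg_left (hA x hx) (hρ.nonneg _)
    · simp [hz x hx]

/-- A differential inequality in the sense of distributions on `[0, T]`, with initial value `a₀`,
holds in the integrated sense. -/
lemma le_of_forall_test {a b : ℝ → ℝ} {a₀ T : ℝ} (hT : 0 < T) (ha : ContinuousOn a (Icc 0 T))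
    (hb : ContinuousOn b (Icc 0 T))
    (h : ∀ τ : ℝ → ℝ, ContDiff ℝ ∞ τ → HasCompactSupport τ → (∀ x, 0 ≤ τ x) →
      0 ≤ (∫ t in (0 : ℝ)..T, (a t * deriv τ t - b t * τ t)) - (a T * τ T - a₀ * τ 0)) :
    a 0 ≤ a₀ ∧ ∀ s t, 0 ≤ s → s < t → t ≤ T → a t - a s ≤ -∫ x in s..t, b x := by
  have hbi : ∀ x ∈ Icc 0 T, ∀ y ∈ Icc 0 T, IntervalIntegrable b volume x y := fun x hx y hy =>
    (hb.mono (uIcc_subset_Icc hx hy)).intervalIntegrable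
  have h0T : (0 : ℝ) ∈ Icc 0 T := left_mem_Icc.2 hT.le
  have hTT : T ∈ Icc 0 T := right_mem_Icc.2 hT.le
  -- Adding the primitive of b removes the source: the claim becomes that c is non-increasing and
  -- starts at most at a₀.
  set c : ℝ → ℝ := fun t => a t + ∫ x in (0 : ℝ)..t, b x with hc
  have hbc : ContinuousOn (fun t => ∫ x in (0 : ℝ)..t, b x) (Icc 0 T) := by
    have := intervalIntegral.continuousOn_primitive_interval (μ := volume) (f := b) (a := 0) (b := T)
      (by rw [uIcc_of_le hT.le]; exact hb.integrableOn_Icc)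
    rwa [uIcc_of_le hT.le] at this
  have hcc : ContinuousOn c (Icc 0 T) := ha.add hbc
  have key : ∀ τ : ℝ → ℝ, ContDiff ℝ ∞ τ → HasCompactSupport τ → (∀ x, 0 ≤ τ x) →
      0 ≤ (∫ t in (0 : ℝ)..T, deriv τ t * c t) - (c T * τ T - a₀ * τ 0) := by
    intro τ hτ hτc hτ0
    have hτ' : Continuous (deriv τ) := hτ.continuous_deriv (by simp)
    have hτd : ∀ x, HasDerivAt τ (deriv τ x) x := fun x =>
      (hτ.differentiable (by simp) x).hasDerivAt
    have ii : ∀ {f : ℝ → ℝ}, ContinuousOn f (Icc 0 T) → IntervalIntegrable f volume 0 T :=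
      fun hf => ContinuousOn.intervalIntegrable (by rwa [uIcc_of_le hT.le])
    have ibp := intervalIntegral.integral_eq_sub_of_hasDerivAt_of_le
      (f := fun t => (∫ x in (0 : ℝ)..t, b x) * τ t)
      (f' := fun t => b t * τ t + (∫ x in (0 : ℝ)..t, b x) * deriv τ t) hT.le
      (hbc.mul hτ.continuous.continuousOn) (fun t ht => ?_)
      (ii ((hb.mul hτ.continuous.continuousOn).add (hbc.mul hτ'.continuousOn)))
    · have e1 : (∫ t in (0 : ℝ)..T, deriv τ t * c t)
          = (∫ t in (0 : ℝ)..T, (a t * deriv τ t - b t * τ t))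
            + ∫ t in (0 : ℝ)..T, (b t * τ t + (∫ x in (0 : ℝ)..t, b x) * deriv τ t) := by
        have i1 : IntervalIntegrable (fun t => a t * deriv τ t - b t * τ t) volume 0 T :=
          ii ((ha.mul hτ'.continuousOn).sub (hb.mul hτ.continuous.continuousOn))
        have i2 : IntervalIntegrable (fun t => b t * τ t + (∫ x in (0 : ℝ)..t, b x) * deriv τ t)
            volume 0 T := ii ((hb.mul hτ.continuous.continuousOn).add (hbc.mul hτ'.continuousOn))
        rw [← intervalIntegral.integral_add i1 i2]
        refine intervalIntegral.integral_congr fun t _ => ?_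
        simp only [hc]; ring
      have := h τ hτ hτc hτ0
      rw [e1, ibp]
      simp only [hc, intervalIntegral.integral_same]
      linarith
    · have hbt : ContinuousAt b t := hb.continuousAt (Icc_mem_nhds ht.1 ht.2)
      refine (intervalIntegral.integral_hasDerivAt_right (hbi 0 h0T t (Ioo_subset_Icc_self ht)) ?_
        hbt).mul (hτd t)
      exact (hb.mono Ioo_subset_Icc_self).stronglyMeasurableAtFilter isOpen_Ioo t ht
  have test : ∀ {ρ : ℝ → ℝ} {r : ℝ}, IsMollifier ρ r → 0 < r → ∀ p q, p ≤ q →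
      ∃ τ : ℝ → ℝ, ContDiff ℝ ∞ τ ∧ HasCompactSupport τ ∧ (∀ x, 0 ≤ τ x) ∧
        (∀ x, deriv τ x = ρ (x - p) - ρ (x - q)) ∧ (∀ x, x ≤ p - r → τ x = 0) ∧
        (∀ x, q + r ≤ x → τ x = 0) ∧ ∀ x, p + r ≤ x → x ≤ q - r → τ x = 1 := by
    intro ρ r hρ hr p q hpq
    obtain ⟨P, hPs, hPd, hPm, hP0, hP1⟩ := hρ.exists_primitive
    have z1 : ∀ x, x ≤ p - r → P (x - p) - P (x - q) = 0 := fun x hx => by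
      rw [hP0 _ (by linarith), hP0 _ (by linarith), sub_zero]
    have z2 : ∀ x, q + r ≤ x → P (x - p) - P (x - q) = 0 := fun x hx => by
      rw [hP1 _ (by linarith), hP1 _ (by linarith), sub_self]
    refine ⟨fun x => P (x - p) - P (x - q), (hPs.comp (contDiff_id.sub contDiff_const)).sub
      (hPs.comp (contDiff_id.sub contDiff_const)),
      HasCompactSupport.intro (isCompact_Icc (a := p - r) (b := q + r)) fun x hx => ?_,
      fun x => sub_nonneg.2 (hPm (by linarith)), fun x => ?_, z1, z2, fun x h1 h2 => ?_⟩
    · by_cases h1 : x ≤ p - r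
      · exact z1 x h1
      · refine z2 x ?_
        by_contra h2
        exact hx ⟨(not_le.1 h1).le, (not_le.1 h2).le⟩
    · exact (((hPd (x - p)).comp_sub_const x p).sub ((hPd (x - q)).comp_sub_const x q)).deriv
    · simp only [hP1 (x - p) (by linarith), hP0 (x - q) (by linarith), sub_zero]
  have near : ∀ s ∈ Icc 0 T, ∀ ε > 0, ∃ δ > 0, ∀ x ∈ Icc 0 T, |x - s| < δ → |c x - c s| ≤ ε := by
    intro s hs ε hε
    obtain ⟨δ, hδ, h1⟩ := Metric.continuousOn_iff.1 hcc s hs ε hε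
    exact ⟨δ, hδ, fun x hx hxs => (h1 x hx hxs).le⟩
  constructor
  · refine le_of_forall_pos_le_add fun ε hε => ?_
    obtain ⟨δ, hδ, hn⟩ := near 0 h0T ε hε
    set r := min (δ / 4) (T / 4) with hr
    have hr0 : 0 < r := by positivity
    have hrδ : r ≤ δ / 4 := min_le_left _ _
    have hrT : r ≤ T / 4 := min_le_right _ _
    obtain ⟨ρ, hρ⟩ := exists_isMollifier hr0
    -- The ascent around -2r happens before time 0. On [0, T] the test function only descends, from
    -- 1 at time 0 to 0 at time 2r, and so isolates the initial value.
    obtain ⟨τ, hτ, hτc, hτ0, hτd, -, hz2, hone⟩ := test hρ hr0 (-2 * r) r (by linarith)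
    have k := key τ hτ hτc hτ0
    rw [hone 0 (by linarith) (by linarith), hz2 T (by linarith)] at k
    have e1 : ∫ t in (0 : ℝ)..T, deriv τ t * c t = -∫ t in (0 : ℝ)..T, ρ (t - r) * c t := by
      rw [← intervalIntegral.integral_neg]
      refine intervalIntegral.integral_congr fun t ht => ?_
      rw [uIcc_of_le hT.le] at ht
      simp only [hτd]
      rw [hρ.eq_zero (t - -2 * r) fun h => by linarith [h.2, ht.1]]
      ring
    have k2 := (abs_le.1 (hρ.abs_integral_sub_le hcc (q := r) (A := c 0) (ε := ε) (by linarith)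
      (by linarith) hr0 fun x hx => hn x ⟨by linarith [hx.1], by linarith [hx.2]⟩
      (by rw [sub_zero, abs_of_nonneg (by linarith [hx.1])]; linarith [hx.2]))).1
    have hc0 : c 0 = a 0 := by simp [hc]
    rw [e1] at k
    rw [hc0] at k2
    linarith
  · intro s t hs hst ht
    suffices c t ≤ c s by
      have hsI : s ∈ Icc 0 T := ⟨hs, by linarith⟩
      have htI : t ∈ Icc 0 T := ⟨by linarith, ht⟩
      have := intervalIntegral.integral_add_adjacent_intervals (hbi 0 h0T s hsI) (hbi s hsI t htI)
      simp only [hc] at *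
      linarith
    refine le_of_forall_pos_le_add fun ε hε => ?_
    obtain ⟨δ₁, hδ₁, hn₁⟩ := near s ⟨hs, by linarith⟩ (ε / 2) (by positivity)
    obtain ⟨δ₂, hδ₂, hn₂⟩ := near t ⟨by linarith, ht⟩ (ε / 2) (by positivity)
    set r := min (min (δ₁ / 4) (δ₂ / 4)) ((t - s) / 4) with hr
    have hts : 0 < t - s := by linarith
    have hr0 : 0 < r := by positivity
    have hr1 : r ≤ δ₁ / 4 := (min_le_left _ _).trans (min_le_left _ _)
    have hr2 : r ≤ δ₂ / 4 := (min_le_left _ _).trans (min_le_right _ _)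
    have hr3 : r ≤ (t - s) / 4 := min_le_right _ _
    obtain ⟨ρ, hρ⟩ := exists_isMollifier hr0
    -- Centring the ramps at s + r and t - r keeps them inside [s, t], which allows s = 0 and t = T.
    obtain ⟨τ, hτ, hτc, hτ0, hτd, hz1, hz2, -⟩ := test hρ hr0 (s + r) (t - r) (by linarith)
    have k := key τ hτ hτc hτ0
    rw [hz1 0 (by linarith), hz2 T (by linarith)] at k
    have ii : ∀ q, IntervalIntegrable (fun x => ρ (x - q) * c x) volume 0 T := fun q =>
      ContinuousOn.intervalIntegrable (by
        rw [uIcc_of_le hT.le]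
        have := hρ.smooth.continuous
        exact (by fun_prop : Continuous fun x => ρ (x - q)).continuousOn.mul hcc)
    have e1 : ∫ x in (0 : ℝ)..T, deriv τ x * c x
        = (∫ x in (0 : ℝ)..T, ρ (x - (s + r)) * c x) - ∫ x in (0 : ℝ)..T, ρ (x - (t - r)) * c x := by
      rw [← intervalIntegral.integral_sub (ii _) (ii _)]
      refine intervalIntegral.integral_congr fun x _ => ?_
      simp only [hτd]; ring
    have k1 := (abs_le.1 (hρ.abs_integral_sub_le hcc (q := s + r) (A := c s) (ε := ε / 2)
      (by linarith) (by linarith) hr0 fun x hx => hn₁ x ⟨by linarith [hx.1], by linarith [hx.2]⟩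
      (by rw [abs_of_nonneg (by linarith [hx.1])]; linarith [hx.2]))).2
    have k2 := (abs_le.1 (hρ.abs_integral_sub_le hcc (q := t - r) (A := c t) (ε := ε / 2)
      (by linarith) (by linarith) hr0 fun x hx => hn₂ x ⟨by linarith [hx.1], by linarith [hx.2]⟩
      (by rw [abs_of_nonpos (by linarith [hx.2])]; linarith [hx.1]))).1
    rw [e1] at k
    linarith

/-! ### Smooth approximations of the Kruzhkov entropies -/

/-- Smoothing |x - k| to √((x-k)² + ε²) leaves η' far from ±1 near k. The flux error is nevertheless
O(ε): it is the integral of (1 ∓ η')W', hence at most D times the integral of 1 ∓ η', which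
telescopes to at most η(k) = ε. -/
lemma exists_kruzhkov_pair {V : ℝ → ℝ} (hV : ContDiffOn ℝ 1 V (Ici 0))
    (hVa : AntitoneOn V (Ici 0)) {m M : ℝ} (hm : 0 < m) (hmM : m ≤ M) :
    ∃ D ≥ 0, ∀ k ∈ Icc m M, ∀ ε > 0, ∃ η Q, IsEntropyPair V η Q ∧
      (∀ x ∈ Icc m M, |η x - abs (x - k)| ≤ ε) ∧
      ∀ x ∈ Icc m M, |Q x - abs (flux V x - flux V k)| ≤ D * ε := by
  have hsub : Icc m M ⊆ Ioi 0 := fun x hx => hm.trans_le hx.1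
  obtain ⟨D, hD⟩ := isCompact_Icc.exists_bound_of_continuousOn
    ((continuousOn_deriv_flux hV).mono hsub)
  have hD0 : 0 ≤ D := (norm_nonneg _).trans (hD m (left_mem_Icc.2 hmM))
  refine ⟨D, hD0, fun k hk ε hε => ?_⟩
  have hk0 : 0 < k := hsub hk
  set η : ℝ → ℝ := fun x => √((x - k) ^ 2 + ε ^ 2) with hη
  have hpos : ∀ x, 0 < (x - k) ^ 2 + ε ^ 2 := fun x => by positivity
  have hηpos : ∀ x, 0 < η x := fun x => Real.sqrt_pos.2 (hpos x)
  have hηs : ContDiff ℝ 2 η := ContDiff.sqrt (by fun_prop) fun x => (hpos x).ne'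
  have hηd : ∀ x, HasDerivAt η ((x - k) / η x) x := fun x => by
    have h1 : HasDerivAt (fun x : ℝ => (x - k) ^ 2 + ε ^ 2) (2 * (x - k)) x := by
      simpa using (((hasDerivAt_id x).sub_const k).pow 2).add_const (ε ^ 2)
    refine (h1.sqrt (hpos x).ne').congr_deriv ?_
    rw [mul_div_mul_left _ _ two_ne_zero]
  have hηge : ∀ x, |x - k| ≤ η x := fun x => by
    rw [hη, ← Real.sqrt_sq_eq_abs]
    exact Real.sqrt_le_sqrt (by linarith [sq_nonneg ε])
  have hηle : ∀ x, η x ≤ |x - k| + ε := fun x => by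
    refine Real.sqrt_le_iff.2 ⟨by positivity, ?_⟩
    have := sq_abs (x - k)
    nlinarith [abs_nonneg (x - k)]
  have hηk : η k = ε := by simp [hη, hε.le]
  have hη1 : ∀ x, |(x - k) / η x| ≤ 1 := fun x => by
    rw [abs_div, abs_of_pos (hηpos x)]
    exact (div_le_one (hηpos x)).2 (hηge x)
  have hconv : ConvexOn ℝ univ η := by
    refine Monotone.convexOn_univ_of_deriv (fun x => (hηd x).differentiableAt) ?_
    intro x y hxy
    rw [(hηd x).deriv, (hηd y).deriv, div_le_div_iff₀ (hηpos x) (hηpos y)]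
    have sx : η x ^ 2 = (x - k) ^ 2 + ε ^ 2 := Real.sq_sqrt (hpos x).le
    have sy : η y ^ 2 = (y - k) ^ 2 + ε ^ 2 := Real.sq_sqrt (hpos y).le
    have hx := hηpos x
    have hy := hηpos y
    rcases le_total 0 (x - k) with h1 | h1
    · have h2 : 0 ≤ y - k := by linarith
      refine (sq_le_sq₀ (by positivity) (by positivity)).1 ?_
      rw [mul_pow, mul_pow, sx, sy]
      have : (x - k) ^ 2 ≤ (y - k) ^ 2 := pow_le_pow_left₀ h1 (by linarith) 2
      nlinarith [sq_nonneg ε]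
    · rcases le_total 0 (y - k) with h2 | h2
      · nlinarith
      · have h3 : (-(y - k)) * η x ≤ (-(x - k)) * η y := by
          refine (sq_le_sq₀ (by nlinarith) (by nlinarith)).1 ?_
          rw [mul_pow, mul_pow, sx, sy, neg_sq, neg_sq]
          have : (y - k) ^ 2 ≤ (x - k) ^ 2 := by nlinarith
          nlinarith [sq_nonneg ε]
        linarith
  set f : ℝ → ℝ := fun w => (w - k) / η w * deriv (flux V) w with hf
  have hfc : ContinuousOn f (Ioi 0) :=
    (Continuous.div (by fun_prop) hηs.continuous fun x => (hηpos x).ne').continuousOn.mul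
      (continuousOn_deriv_flux hV)
  set Q : ℝ → ℝ := fun x => ∫ w in k..x, f w with hQ
  have hsubI : ∀ x, 0 < x → uIcc k x ⊆ Ioi 0 := fun x hx w hw => (lt_min hk0 hx).trans_le hw.1
  have hfi : ∀ x, 0 < x → IntervalIntegrable f volume k x := fun x hx =>
    (hfc.mono (hsubI x hx)).intervalIntegrable
  have hQd : ∀ x, 0 < x → HasDerivAt Q (f x) x := fun x hx =>
    intervalIntegral.integral_hasDerivAt_right (hfi x hx)
      (hfc.stronglyMeasurableAtFilter isOpen_Ioi x hx) (hfc.continuousAt (Ioi_mem_nhds hx))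
  refine ⟨η, Q, ⟨hconv, hηs, fun w hw => by rw [(hηd w).deriv]; exact hQd w hw⟩,
    fun x _ => abs_le.2 ⟨by linarith [hηge x], by linarith [hηle x]⟩, fun x hx => ?_⟩
  have hx0 := hsub hx
  have hWi : IntervalIntegrable (deriv (flux V)) volume k x :=
    ((continuousOn_deriv_flux hV).mono (hsubI x hx0)).intervalIntegrable
  have ftc : ∀ {g g' : ℝ → ℝ}, (∀ w, 0 < w → HasDerivAt g (g' w) w) →
      IntervalIntegrable g' volume k x → ∫ w in k..x, g' w = g x - g k := fun hg hi =>
    intervalIntegral.integral_eq_sub_of_hasDerivAt (fun w hw => hg w (hsubI x hx0 hw)) hi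
  have hW := ftc (hasDerivAt_flux hV) hWi
  have hηi : IntervalIntegrable (fun w => (w - k) / η w) volume k x :=
    (Continuous.div (by fun_prop) hηs.continuous fun x => (hηpos x).ne').intervalIntegrable _ _
  have hηI := ftc (fun w _ => hηd w) hηi
  have hIcc : uIcc k x ⊆ Icc m M := uIcc_subset_Icc hk hx
  have hWD : ∀ w ∈ uIcc k x, 0 ≤ deriv (flux V) w ∧ deriv (flux V) w ≤ D := fun w hw =>
    ⟨deriv_flux_nonneg hVa (hsubI x hx0 hw), (le_abs_self _).trans (hD w (hIcc hw))⟩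
  rcases le_total k x with hkx | hkx
  · rw [abs_of_nonneg (sub_nonneg.2 (monotoneOn_flux hVa hk0 hx0 hkx))]
    rw [uIcc_of_le hkx] at hWD
    have e1 : (flux V x - flux V k) - Q x
        = ∫ w in k..x, (1 - (w - k) / η w) * deriv (flux V) w := by
      simp only [sub_mul, one_mul]
      rw [intervalIntegral.integral_sub hWi (hfi x hx0), hW]
    have e2 : ∫ w in k..x, (1 - (w - k) / η w) * D = ((x - k) - (η x - η k)) * D := by
      rw [intervalIntegral.integral_mul_const, intervalIntegral.integral_sub (by simp) hηi, hηI]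
      simp
    have i1 : IntervalIntegrable (fun w => (1 - (w - k) / η w) * deriv (flux V) w) volume k x := by
      simp only [sub_mul, one_mul]
      exact hWi.sub (hfi x hx0)
    have h1 : 0 ≤ (flux V x - flux V k) - Q x := by
      rw [e1]
      exact intervalIntegral.integral_nonneg hkx fun w hw =>
        mul_nonneg (by linarith [(abs_le.1 (hη1 w)).2]) (hWD w hw).1
    have h2 : (flux V x - flux V k) - Q x ≤ ((x - k) - (η x - η k)) * D := by
      rw [e1, ← e2]
      exact intervalIntegral.integral_mono_on hkx i1
        (((by simp : IntervalIntegrable (fun _ => (1 : ℝ)) volume k x).sub hηi).mul_const D)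
        fun w hw => mul_le_mul_of_nonneg_left (hWD w hw).2 (by linarith [(abs_le.1 (hη1 w)).2])
    have h3 : (x - k) - (η x - η k) ≤ ε := by linarith [hηge x, le_abs_self (x - k)]
    have h4 := mul_le_mul_of_nonneg_right h3 hD0
    rw [abs_le]
    constructor <;> linarith
  · rw [abs_of_nonpos (sub_nonpos.2 (monotoneOn_flux hVa hx0 hk0 hkx))]
    rw [uIcc_of_ge hkx] at hWD
    have e1 : -(flux V x - flux V k) - Q x
        = ∫ w in x..k, (1 + (w - k) / η w) * deriv (flux V) w := by
      simp only [add_mul, one_mul]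
      rw [intervalIntegral.integral_add hWi.symm (hfi x hx0).symm, intervalIntegral.integral_symm k x,
        hW, intervalIntegral.integral_symm k x]
      ring
    have e2 : ∫ w in x..k, (1 + (w - k) / η w) * D = ((k - x) + (η k - η x)) * D := by
      have hηI' : ∫ w in x..k, (w - k) / η w = η k - η x := by
        rw [intervalIntegral.integral_symm, hηI]; ring
      rw [intervalIntegral.integral_mul_const, intervalIntegral.integral_add (by simp) hηi.symm,
        hηI']
      simp
    have i1 : IntervalIntegrable (fun w => (1 + (w - k) / η w) * deriv (flux V) w) volume x k := by
      simp only [add_mul, one_mul]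
      exact hWi.symm.add (hfi x hx0).symm
    have h1 : 0 ≤ -(flux V x - flux V k) - Q x := by
      rw [e1]
      exact intervalIntegral.integral_nonneg hkx fun w hw =>
        mul_nonneg (by linarith [(abs_le.1 (hη1 w)).1]) (hWD w hw).1
    have h2 : -(flux V x - flux V k) - Q x ≤ ((k - x) + (η k - η x)) * D := by
      rw [e1, ← e2]
      exact intervalIntegral.integral_mono_on hkx i1
        (((by simp : IntervalIntegrable (fun _ => (1 : ℝ)) volume x k).add hηi.symm).mul_const D)
        fun w hw => mul_le_mul_of_nonneg_left (hWD w hw).2 (by linarith [(abs_le.1 (hη1 w)).1])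
    have h3 : (k - x) + (η k - η x) ≤ ε := by linarith [hηge x, neg_le_abs (x - k)]
    have h4 := mul_le_mul_of_nonneg_right h3 hD0
    rw [abs_le]
    constructor <;> linarith

/-! ### Product test functions -/

lemma isTest_mul {χ τ : ℝ → ℝ} (hχ : ContDiff ℝ ∞ χ) (hχc : HasCompactSupport χ)
    (hτ : ContDiff ℝ ∞ τ) (hτc : HasCompactSupport τ) : IsTest fun p : ℝ × ℝ => χ p.1 * τ p.2 := by
  refine ⟨(hχ.comp contDiff_fst).mul (hτ.comp contDiff_snd),
    HasCompactSupport.intro (hχc.prod hτc) fun p hp => ?_⟩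
  by_contra h
  exact hp ⟨subset_tsupport _ (left_ne_zero_of_mul h), subset_tsupport _ (right_ne_zero_of_mul h)⟩

lemma weakForm_mul {A F : ℝ → ℝ → ℝ} {a χ τ : ℝ → ℝ} {T : ℝ} (hT : 0 ≤ T)
    (hA : ∀ t ∈ Icc 0 T, Integrable fun z => A z t * χ z)
    (hF : ∀ t ∈ Icc 0 T, Integrable fun z => F z t * deriv χ z)
    (ha : Integrable fun z => a z * χ z) :
    weakForm T A F a (fun p => χ p.1 * τ p.2)
      = (∫ t in (0 : ℝ)..T, ((∫ z, A z t * χ z) * deriv τ t - (∫ z, F z t * deriv χ z) * τ t))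
        - ((∫ z, A z T * χ z) * τ T - (∫ z, a z * χ z) * τ 0) := by
  rw [weakForm]
  congr 1
  · refine intervalIntegral.integral_congr fun t ht => ?_
    rw [uIcc_of_le hT] at ht
    simp only [deriv_const_mul_field', deriv_mul_const_field']
    rw [← integral_mul_const, ← integral_mul_const,
      ← integral_sub ((hA t ht).mul_const _) ((hF t ht).mul_const _)]
    refine integral_congr_ae (ae_of_all _ fun z => ?_)
    simp only
    ring
  · rw [← integral_mul_const, ← integral_mul_const,
      ← integral_sub ((hA T (right_mem_Icc.2 hT)).mul_const _) (ha.mul_const _)]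
    refine integral_congr_ae (ae_of_all _ fun z => ?_)
    simp only
    ring

/-- `le_of_forall_test` for (a, b) and for (-a, -b). -/
lemma eq_of_forall_test {a b : ℝ → ℝ} {a₀ T : ℝ} (hT : 0 < T) (ha : ContinuousOn a (Icc 0 T))
    (hb : ContinuousOn b (Icc 0 T))
    (h : ∀ τ : ℝ → ℝ, ContDiff ℝ ∞ τ → HasCompactSupport τ →
      (∫ t in (0 : ℝ)..T, (a t * deriv τ t - b t * τ t)) - (a T * τ T - a₀ * τ 0) = 0) :
    a 0 = a₀ ∧ ∀ t ∈ Icc 0 T, a t = a₀ - ∫ x in (0 : ℝ)..t, b x := by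
  have h1 := le_of_forall_test hT ha hb fun τ h1 h2 _ => (h τ h1 h2).ge
  have h2 := le_of_forall_test (a := fun t => -a t) (b := fun t => -b t) (a₀ := -a₀) hT ha.neg
    hb.neg fun τ h1 h2 _ => by
    have e := h τ h1 h2
    have : (∫ t in (0 : ℝ)..T, (-a t * deriv τ t - -b t * τ t))
        = -∫ t in (0 : ℝ)..T, (a t * deriv τ t - b t * τ t) := by
      rw [← intervalIntegral.integral_neg]
      refine intervalIntegral.integral_congr fun t _ => ?_
      ring
    rw [this]
    linarith
  have h0 : a 0 = a₀ := le_antisymm h1.1 (neg_le_neg_iff.1 h2.1)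
  refine ⟨h0, fun t ht => ?_⟩
  rcases ht.1.eq_or_lt with rfl | ht0
  · simp [h0]
  · have e1 := h1.2 0 t le_rfl ht0 ht.2
    have e2 := h2.2 0 t le_rfl ht0 ht.2
    simp only [intervalIntegral.integral_neg] at e2
    rw [h0] at e1 e2
    linarith

lemma weakForm_congr {A A' F F' : ℝ → ℝ → ℝ} {a a' : ℝ → ℝ} {T : ℝ} (hT : 0 ≤ T)
    (hA : ∀ t ∈ Icc 0 T, (fun z => A z t) =ᵐ[volume] fun z => A' z t)
    (hF : ∀ t ∈ Icc 0 T, (fun z => F z t) =ᵐ[volume] fun z => F' z t) (ha : a =ᵐ[volume] a')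
    (φ : ℝ × ℝ → ℝ) : weakForm T A F a φ = weakForm T A' F' a' φ := by
  rw [weakForm, weakForm]
  congr 1
  · refine intervalIntegral.integral_congr fun t ht => integral_congr_ae ?_
    rw [uIcc_of_le hT] at ht
    filter_upwards [hA t ht, hF t ht] with z h1 h2
    rw [h1, h2]
  · refine integral_congr_ae ?_
    filter_upwards [hA T (right_mem_Icc.2 hT), ha] with z h1 h2
    rw [h1, h2]

/-! ### Functionals of bounded curves -/

section Curve

variable {m M T : ℝ} {v : ℝ → ℝ → ℝ}

lemma IsBoundedCurve.integrable_comp_mul (hv : IsBoundedCurve m M T v) {f : ℝ → ℝ}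
    (hf : Continuous f) {t : ℝ} (ht : t ∈ Icc 0 T) {χ : ℝ → ℝ} (hχ : Continuous χ)
    (hχc : HasCompactSupport χ) : Integrable fun z => f (v z t) * χ z := by
  obtain ⟨C, hC⟩ := isCompact_Icc.exists_bound_of_continuousOn (hf.continuousOn (s := Icc m M))
  exact integrable_bdd_mul (f := fun z => f (v z t))
    (hf.measurable.comp (hv.meas t ht)).aestronglyMeasurable (fun z => hC _ (hv.mem t ht z)) hχ hχc

lemma IsBoundedCurve.integrableOn_abs_sub (hv : IsBoundedCurve m M T v) {s t : ℝ}
    (hs : s ∈ Icc 0 T) (ht : t ∈ Icc 0 T) (R : ℝ) :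
    IntegrableOn (fun z => |v z s - v z t|) (Icc (-R) R) :=
  Measure.integrableOn_of_bounded (M := M - m) (by simp)
    ((hv.meas s hs).sub (hv.meas t ht)).abs.aestronglyMeasurable (ae_of_all _ fun z => by
      rw [Real.norm_eq_abs, abs_abs]
      exact abs_sub_le_of_mem_Icc (hv.mem s hs z) (hv.mem t ht z))

lemma IsBoundedCurve.abs_integral_comp_mul_sub_le (hv : IsBoundedCurve m M T v) {f : ℝ → ℝ}
    {L : ℝ≥0} (hf : LipschitzWith L f) {s t : ℝ} (hs : s ∈ Icc 0 T) (ht : t ∈ Icc 0 T) {χ : ℝ → ℝ}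
    (hχ : Continuous χ) {R B : ℝ} (hR : tsupport χ ⊆ Icc (-R) R) (hB : ∀ z, |χ z| ≤ B) :
    |(∫ z, f (v z s) * χ z) - ∫ z, f (v z t) * χ z|
      ≤ L * B * ∫ z in Icc (-R) R, |v z s - v z t| := by
  have hχc := hasCompactSupport_of_tsupport_subset hR
  rw [← integral_sub (hv.integrable_comp_mul hf.continuous hs hχ hχc)
    (hv.integrable_comp_mul hf.continuous ht hχ hχc),
    ← setIntegral_eq_integral_of_forall_compl_eq_zero (s := Icc (-R) R)
      (fun z hz => by rw [image_eq_zero_of_notMem_tsupport fun h => hz (hR h)]; ring),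
    ← integral_const_mul]
  refine (norm_integral_le_of_norm_le (f := fun z => f (v z s) * χ z - f (v z t) * χ z)
    ((hv.integrableOn_abs_sub hs ht R).const_mul _)
    (ae_of_all _ fun z => ?_))
  rw [← sub_mul, norm_mul]
  have h1 := hf.dist_le_mul (v z s) (v z t)
  rw [Real.dist_eq, Real.dist_eq] at h1
  calc _ ≤ (L * |v z s - v z t|) * B := mul_le_mul h1 (hB z) (abs_nonneg _) (by positivity)
    _ = _ := by ring

lemma exists_bound_tsupport {χ : ℝ → ℝ} (hχ : Continuous χ) (hχc : HasCompactSupport χ) :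
    ∃ R > 0, ∃ B > 0, tsupport χ ⊆ Icc (-R) R ∧ ∀ z, |χ z| ≤ B := by
  obtain ⟨R, hR0, hR⟩ := hχc.isBounded.subset_closedBall_lt 0 0
  obtain ⟨B, hB⟩ := hχc.exists_bound_of_continuous hχ
  refine ⟨R, hR0, max B 1, by positivity, ?_, fun z => (hB z).trans (le_max_left _ _)⟩
  rwa [Real.closedBall_eq_Icc, zero_sub, zero_add] at hR

lemma IsBoundedCurve.continuousOn_integral_comp_mul (hv : IsBoundedCurve m M T v) {f : ℝ → ℝ}
    {L : ℝ≥0} (hf : LipschitzWith L f) {χ : ℝ → ℝ} (hχ : Continuous χ)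
    (hχc : HasCompactSupport χ) : ContinuousOn (fun t => ∫ z, f (v z t) * χ z) (Icc 0 T) := by
  obtain ⟨R, hR0, B, hB0, hR, hB⟩ := exists_bound_tsupport hχ hχc
  intro t ht
  rw [ContinuousWithinAt, Metric.tendsto_nhds]
  intro ε hε
  filter_upwards [hv.cont t ht R hR0 (ε / ((L + 1) * B)) (by positivity), self_mem_nhdsWithin]
    with s hs hsT
  rw [Real.dist_eq]
  have h2 : 0 ≤ ∫ z in Icc (-R) R, |v z s - v z t| := integral_nonneg fun z => abs_nonneg _
  calc _ ≤ L * B * ∫ z in Icc (-R) R, |v z s - v z t| :=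
        hv.abs_integral_comp_mul_sub_le hf hsT ht hχ hR hB
    _ ≤ L * B * (ε / ((L + 1) * B)) := by gcongr
    _ = ε * (L / (L + 1)) := by field_simp
    _ < ε * 1 := by
        gcongr
        rw [div_lt_one (by positivity)]
        linarith
    _ = ε := mul_one ε

end Curve

/-! ### Entropy solutions as bounded curves -/

section Bounds

variable {T : ℝ} {w : ℝ → ℝ → ℝ}

/-- Fubini gives the bounds at almost every time. For every other time, the distance of w(z,t) to
[m, M] is at most |w(z,s) - w(z,t)| for a good s, and continuity in L¹_loc makes this small. -/
lemma ContinuousInL1loc.ae_mem_Icc (hw : ContinuousInL1loc T w) (hT : 0 < T) {m M : ℝ}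
    (hmM : m ≤ M)
    (h : ∀ᵐ p : ℝ × ℝ ∂(volume.restrict (univ ×ˢ Icc 0 T)), w p.1 p.2 ∈ Icc m M) :
    ∀ t ∈ Icc 0 T, ∀ᵐ z, w z t ∈ Icc m M := by
  have h1 : ∀ᵐ t ∂(volume.restrict (Icc 0 T)), ∀ᵐ z, w z t ∈ Icc m M := by
    have e : (volume : Measure (ℝ × ℝ)).restrict (univ ×ˢ Icc 0 T)
        = (volume : Measure ℝ).prod (volume.restrict (Icc 0 T)) := by
      rw [Measure.volume_eq_prod, ← Measure.prod_restrict, Measure.restrict_univ]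
    rw [e] at h
    exact Measure.ae_ae_of_ae_prod
      ((Measure.measurePreserving_swap (μ := (volume : Measure ℝ).restrict (Icc 0 T))
        (ν := (volume : Measure ℝ))).quasiMeasurePreserving.ae h)
  rw [ae_restrict_iff' measurableSet_Icc] at h1
  have hd := Measure.dense_of_ae h1
  intro t ht
  have hloc : ∀ n : ℕ, ∀ᵐ z ∂(volume.restrict (Icc (-(n : ℝ)) n)), w z t ∈ Icc m M := by
    intro n
    have hz : ∫⁻ z in Icc (-(n : ℝ)) n, ‖w z t - clamp m M (w z t)‖ₑ = 0 := by
      refine le_antisymm (le_of_forall_pos_le_add fun ε hε => ?_) zero_le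
      have h2 := (ENNReal.tendsto_nhds_zero.1 (hw.2 _ (isCompact_Icc (a := -(n : ℝ)) (b := n)) t ht)) ε hε
      obtain ⟨δ, hδ, hball⟩ := Metric.mem_nhdsWithin_iff.1 h2
      -- Good times are dense in the line but informative only within [0, T], so one is sought in
      -- the open interval, also when t is an endpoint.
      have hne : (Metric.ball t δ ∩ Ioo 0 T).Nonempty := by
        have : t ∈ closure (Ioo 0 T) := by rwa [closure_Ioo hT.ne]
        exact mem_closure_iff.1 this _ Metric.isOpen_ball (Metric.mem_ball_self hδ)
      obtain ⟨s, hsU, hs⟩ := hd.inter_open_nonempty _ (Metric.isOpen_ball.inter isOpen_Ioo) hne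
      have hsI := Ioo_subset_Icc_self hsU.2
      rw [zero_add]
      refine le_trans (lintegral_mono_ae (ae_restrict_of_ae ?_)) (hball ⟨hsU.1, hsI⟩)
      filter_upwards [hs hsI] with z hz
      rw [Real.enorm_eq_ofReal_abs, Real.enorm_eq_ofReal_abs]
      refine ENNReal.ofReal_le_ofReal ?_
      rw [abs_le]
      simp only [clamp]
      rcases le_total (w z t) M with h3 | h3
      · rw [min_eq_left h3]
        rcases le_total m (w z t) with h4 | h4
        · rw [max_eq_right h4]; simp
        · rw [max_eq_left h4]
          constructor <;>
            rcases abs_cases (w z s - w z t) with h5 | h5 <;> linarith [hz.1, hz.2]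
      · rw [min_eq_right h3, max_eq_right hmM]
        constructor <;>
          rcases abs_cases (w z s - w z t) with h5 | h5 <;> linarith [hz.1, hz.2]
    have hm := (hw.1 t ht).aestronglyMeasurable
    have hm' : AEStronglyMeasurable (fun z => w z t - clamp m M (w z t)) volume :=
      hm.sub ((lipschitzWith_clamp m M).continuous.comp_aestronglyMeasurable hm)
    rw [lintegral_eq_zero_iff' hm'.enorm.restrict] at hz
    filter_upwards [hz] with z hz
    have : w z t = clamp m M (w z t) := by simpa [sub_eq_zero] using hz
    rw [this]
    exact clamp_mem hmM _
  have := ae_all_iff.2 fun n => (ae_restrict_iff' measurableSet_Icc).1 (hloc n)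
  filter_upwards [this] with z hz
  obtain ⟨n, hn⟩ := exists_nat_ge |z|
  exact hz n (abs_le.1 hn)

/-- Entropy solutions are only given up to null sets in z. Truncating a measurable version of each
slice yields bounds at every point without changing any class. -/
lemma ContinuousInL1loc.exists_isBoundedCurve (hw : ContinuousInL1loc T w) {m M : ℝ}
    (hmM : m ≤ M) (h : ∀ t ∈ Icc 0 T, ∀ᵐ z, w z t ∈ Icc m M) :
    ∃ v, IsBoundedCurve m M T v ∧ ∀ t ∈ Icc 0 T, (fun z => v z t) =ᵐ[volume] fun z => w z t := by
  have hm : ∀ t ∈ Icc 0 T, AEStronglyMeasurable (fun z => w z t) volume := fun t ht =>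
    (hw.1 t ht).aestronglyMeasurable
  choose! g hg using fun t ht => (hm t ht)
  have hgw : ∀ t ∈ Icc 0 T, (fun z => clamp m M (g t z)) =ᵐ[volume] fun z => w z t := by
    intro t ht
    filter_upwards [(hg t ht).2, h t ht] with z h1 h2
    rw [← h1, clamp_of_mem h2]
  have hmeas : ∀ t ∈ Icc 0 T, Measurable fun z => clamp m M (g t z) := fun t ht =>
    (lipschitzWith_clamp m M).continuous.measurable.comp (hg t ht).1.measurable
  refine ⟨fun z t => clamp m M (g t z), ⟨hmeas, fun t _ z => clamp_mem hmM _,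
    fun t ht R _ ε hε => ?_⟩, hgw⟩
  filter_upwards [ENNReal.tendsto_nhds_zero.1 (hw.2 _ (isCompact_Icc (a := -R) (b := R)) t ht)
    (ENNReal.ofReal ε) (by simpa using hε), self_mem_nhdsWithin] with s hs hsT
  have e : ∫⁻ z in Icc (-R) R, ‖w z s - w z t‖ₑ
      = ∫⁻ z in Icc (-R) R, ‖clamp m M (g s z) - clamp m M (g t z)‖ₑ := by
    refine lintegral_congr_ae (ae_restrict_of_ae ?_)
    filter_upwards [hgw s hsT, hgw t ht] with z h1 h2
    rw [h1, h2]
  rw [e] at hs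
  have h1 := integral_norm_eq_lintegral_enorm (μ := volume.restrict (Icc (-R) R))
    ((hmeas s hsT).sub (hmeas t ht)).aestronglyMeasurable
  simp only [Real.norm_eq_abs] at h1
  refine h1.trans_le (ENNReal.toReal_le_of_le_ofReal hε.le hs)

end Bounds

/-! ### Entropy solutions satisfy the Dini form of the Kruzhkov inequalities -/

lemma IsWeakSolution.exists_bounds {V y₀ : ℝ → ℝ} {T : ℝ} {w : ℝ → ℝ → ℝ} (hT : 0 < T)
    (hw : IsWeakSolution V y₀ T w) :
    ∃ m > 0, ∃ M, m ≤ M ∧ ∀ t ∈ Icc 0 T, ∀ᵐ z, w z t ∈ Icc m M := by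
  obtain ⟨m, hm, hlow⟩ := hw.pos
  set C := eLpNormEssSup (fun p : ℝ × ℝ => w p.1 p.2) (volume.restrict (univ ×ˢ Icc 0 T)) with hC
  have hCt : C ≠ ⊤ := by
    have := hw.bdd.2.ne
    rwa [eLpNorm_exponent_top] at this
  refine ⟨m, hm, max m C.toReal, le_max_left _ _,
    hw.cont.ae_mem_Icc hT (le_max_left _ _) ?_⟩
  filter_upwards [hlow, ae_le_eLpNormEssSup (f := fun p : ℝ × ℝ => w p.1 p.2)
    (μ := volume.restrict (univ ×ˢ Icc 0 T))] with p h1 h2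
  refine ⟨h1, (le_abs_self _).trans (le_trans ?_ (le_max_right _ _))⟩
  have := ENNReal.toReal_mono hCt h2
  rwa [toReal_enorm] at this

lemma locallyIntegrable_comp {f y : ℝ → ℝ} {a b : ℝ} (hf : ContinuousOn f (Icc a b))
    (hfm : Measurable fun z => f (y z)) (hy : ∀ z, y z ∈ Icc a b) :
    LocallyIntegrable fun z => f (y z) := by
  obtain ⟨C, hC⟩ := isCompact_Icc.exists_bound_of_continuousOn hf
  exact (locallyIntegrable_const C).mono hfm.aestronglyMeasurable
    (ae_of_all _ fun z => (hC _ (hy z)).trans (le_abs_self _))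

section Curve

variable {m M T : ℝ} {v : ℝ → ℝ → ℝ}

lemma IsBoundedCurve.integral_sub_le (hv : IsBoundedCurve m M T v) (hT : 0 < T) {η Q : ℝ → ℝ}
    {K₁ K₂ : ℝ≥0} (hη : LipschitzWith K₁ η) (hQ : LipschitzWith K₂ Q) {a : ℝ → ℝ}
    (ha : LocallyIntegrable a)
    (h : ∀ φ, IsTest φ → (∀ p, 0 ≤ φ p) →
      0 ≤ weakForm T (fun z t => η (v z t)) (fun z t => Q (v z t)) a φ)
    {χ : ℝ → ℝ} (hχ : ContDiff ℝ ∞ χ) (hχc : HasCompactSupport χ) (hχ0 : ∀ z, 0 ≤ χ z) {s t : ℝ}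
    (hs : 0 ≤ s) (hst : s < t) (ht : t ≤ T) :
    (∫ z, η (v z t) * χ z) - ∫ z, η (v z s) * χ z
      ≤ -∫ x in s..t, ∫ z, Q (v z x) * deriv χ z := by
  have hχ' : Continuous (deriv χ) := hχ.continuous_deriv (by simp)
  refine (le_of_forall_test (a := fun t => ∫ z, η (v z t) * χ z)
    (b := fun t => ∫ z, Q (v z t) * deriv χ z) (a₀ := ∫ z, a z * χ z) hT
    (hv.continuousOn_integral_comp_mul hη hχ.continuous hχc)
    (hv.continuousOn_integral_comp_mul hQ hχ' hχc.deriv) fun τ hτ hτc hτ0 => ?_).2 s t hs hst ht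
  have := h _ (isTest_mul hχ hχc hτ hτc) fun p => mul_nonneg (hχ0 _) (hτ0 _)
  rwa [weakForm_mul hT.le (fun t ht => hv.integrable_comp_mul hη.continuous ht hχ.continuous hχc)
    (fun t ht => hv.integrable_comp_mul hQ.continuous ht hχ' hχc.deriv)
    (ha.integrable_smul_right_of_hasCompactSupport hχ.continuous hχc)] at this

/-- The initial datum enters the definition only through the weak form; continuity in time
identifies it with the slice at 0. -/
lemma IsBoundedCurve.ae_eq_initial (hv : IsBoundedCurve m M T v) (hT : 0 < T) {Q : ℝ → ℝ}
    {K : ℝ≥0} (hQ : LipschitzWith K Q) {a : ℝ → ℝ} (ha : LocallyIntegrable a)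
    (h : ∀ φ, IsTest φ → weakForm T v (fun z t => Q (v z t)) a φ = 0) :
    (fun z => v z 0) =ᵐ[volume] a := by
  have h0 : (0 : ℝ) ∈ Icc 0 T := left_mem_Icc.2 hT.le
  have hv0 : LocallyIntegrable fun z => v z 0 :=
    locallyIntegrable_comp (f := id) continuousOn_id (hv.meas 0 h0) (hv.mem 0 h0)
  refine ae_eq_of_integral_contDiff_smul_eq hv0 ha fun χ hχ hχc => ?_
  have hχ' : Continuous (deriv χ) := hχ.continuous_deriv (by simp)
  have := (eq_of_forall_test (a := fun t => ∫ z, v z t * χ z)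
    (b := fun t => ∫ z, Q (v z t) * deriv χ z) (a₀ := ∫ z, a z * χ z) hT
    (hv.continuousOn_integral_comp_mul LipschitzWith.id hχ.continuous hχc)
    (hv.continuousOn_integral_comp_mul hQ hχ' hχc.deriv) fun τ hτ hτc => ?_).1
  · simpa only [smul_eq_mul, mul_comm] using this
  · have := h _ (isTest_mul hχ hχc hτ hτc)
    rwa [weakForm_mul (A := v) hT.le
      (fun t ht => hv.integrable_comp_mul continuous_id ht hχ.continuous hχc)
      (fun t ht => hv.integrable_comp_mul hQ.continuous ht hχ' hχc.deriv)
      (ha.integrable_smul_right_of_hasCompactSupport hχ.continuous hχc)] at this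

/-- The Kruzhkov inequalities integrated in time imply their Dini form. -/
lemma IsBoundedCurve.diniEntropy (hv : IsBoundedCurve m M T v) {G : ℝ → ℝ} {L : ℝ≥0}
    (hG : LipschitzWith L G)
    (h : ∀ k ∈ Icc m M, ∀ χ : ℝ → ℝ, ContDiff ℝ ∞ χ → HasCompactSupport χ → (∀ z, 0 ≤ χ z) →
      ∀ s t, 0 ≤ s → s < t → t ≤ T → (∫ z, |v z t - k| * χ z) - ∫ z, |v z s - k| * χ z
        ≤ -∫ x in s..t, ∫ z, |G (v z x) - G k| * deriv χ z) :
    DiniEntropy G m M 0 T v := by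
  intro t ht R hR ε hε
  have htI := Ico_subset_Icc_self ht
  -- Continuity at t freezes the flux at its value at time t. The neighbourhood depends on R and ε
  -- but not on k or χ, which supplies the uniformity asked for by `DiniEntropy`.
  obtain ⟨δ, hδ, hball⟩ := Metric.mem_nhdsWithin_iff.1
    (hv.cont t htI R hR (ε / (L + 1)) (by positivity))
  filter_upwards [Ioo_mem_nhdsGT (show (0 : ℝ) < min δ (T - t) from lt_min hδ (by linarith [ht.2]))]
    with r hr k hk χ hχ hχ0 hχR B hχB hχB'
  have hr0 := hr.1
  have hr1 : r < δ := hr.2.trans_le (min_le_left _ _)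
  have hr2 : r < T - t := hr.2.trans_le (min_le_right _ _)
  have hB : 0 ≤ B := (hχ0 0).trans (hχB 0)
  have hχc := hasCompactSupport_of_tsupport_subset hχR
  have hχ' : Continuous (deriv χ) := hχ.continuous_deriv (by simp)
  have hGk := lipschitzWith_abs_sub hG (G k)
  have hχR' : tsupport (deriv χ) ⊆ Icc (-R) R :=
    (closure_minimal (support_deriv_subset) (isClosed_tsupport χ)).trans hχR
  have hsub : Icc t (t + r) ⊆ Icc 0 T := Icc_subset_Icc ht.1 (by linarith)
  have key := h k hk χ hχ hχc hχ0 t (t + r) ht.1 (by linarith) (by linarith)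
  have hint : IntervalIntegrable (fun x => ∫ z, |G (v z x) - G k| * deriv χ z) volume t (t + r) := by
    refine ContinuousOn.intervalIntegrable ?_
    rw [uIcc_of_le (by linarith)]
    exact (hv.continuousOn_integral_comp_mul hGk hχ' hχc.deriv).mono hsub
  have hlow : ∫ x in t..(t + r), ((∫ z, |G (v z t) - G k| * deriv χ z) - ε * B)
      ≤ ∫ x in t..(t + r), ∫ z, |G (v z x) - G k| * deriv χ z := by
    refine intervalIntegral.integral_mono_on (by linarith) (by simp) hint fun x hx => ?_
    have h1 := hv.abs_integral_comp_mul_sub_le hGk (hsub hx) htI hχ' hχR' hχB'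
    have h2 : ∫ z in Icc (-R) R, |v z x - v z t| ≤ ε / (L + 1) :=
      hball ⟨by rw [Metric.mem_ball, Real.dist_eq, abs_lt]; constructor <;> linarith [hx.1, hx.2],
        hsub hx⟩
    have h3 : L * B * ∫ z in Icc (-R) R, |v z x - v z t| ≤ ε * B := by
      calc L * B * ∫ z in Icc (-R) R, |v z x - v z t| ≤ L * B * (ε / (L + 1)) := by gcongr
        _ = (ε * B) * (L / (L + 1)) := by field_simp
        _ ≤ (ε * B) * 1 := by
            gcongr
            rw [div_le_one (by positivity)]
            linarith
        _ = _ := mul_one _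
    linarith [(abs_le.1 (h1.trans h3)).1]
  rw [intervalIntegral.integral_const, smul_eq_mul] at hlow
  have : (t + r - t) * ((∫ z, |G (v z t) - G k| * deriv χ z) - ε * B)
    = r * (∫ z, |G (v z t) - G k| * deriv χ z) - r * ((0 + ε) * B) := by ring
  linarith

end Curve

/-- The interval [m, M] may be widened at will, because the comparison with flows requires one
interval containing both ranges. The error is 0: the smooth entropies approximate |x - k|
arbitrarily well. -/
theorem IsEntropySolution.exists_diniEntropy {V y₀ y : ℝ → ℝ} (hV : ContDiffOn ℝ 1 V (Ici 0))
    (hVa : AntitoneOn V (Ici 0)) {T : ℝ} (hT : 0 < T) {a b : ℝ} (hym : Measurable y)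
    (hyab : ∀ z, y z ∈ Icc a b) (hy : y₀ =ᵐ[volume] y) {w : ℝ → ℝ → ℝ}
    (hw : IsEntropySolution V y₀ T w) :
    ∃ m₀ > 0, ∃ M₀, m₀ ≤ M₀ ∧ ∀ m M, 0 < m → m ≤ m₀ → M₀ ≤ M → ∃ v, IsBoundedCurve m M T v ∧
      (∀ t ∈ Icc 0 T, (fun z => v z t) =ᵐ[volume] fun z => w z t) ∧
      (fun z => v z 0) =ᵐ[volume] y ∧
      DiniEntropy (fun x => flux V (clamp m M x)) m M 0 T v := by
  obtain ⟨m₀, hm₀, M₀, hmM₀, hbd⟩ := hw.toIsWeakSolution.exists_bounds hT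
  refine ⟨m₀, hm₀, M₀, hmM₀, fun m M hm hmm hMM => ?_⟩
  have hmM : m ≤ M := hmm.trans (hmM₀.trans hMM)
  obtain ⟨v, hv, hvw⟩ := hw.cont.exists_isBoundedCurve hmM fun t ht =>
    (hbd t ht).mono fun z hz => Icc_subset_Icc hmm hMM hz
  have hcl : ∀ (f : ℝ → ℝ) {z t}, t ∈ Icc 0 T → f (clamp m M (v z t)) = f (v z t) :=
    fun f z t ht => by rw [clamp_of_mem (hv.mem t ht z)]
  obtain ⟨L, hL⟩ := lipschitzWith_comp_clamp hm hmM (hasDerivAt_flux hV) (continuousOn_deriv_flux hV)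
  have htr : ∀ (η Q : ℝ → ℝ) φ, weakForm T (fun z t => η (w z t)) (fun z t => Q (w z t))
      (fun z => η (y₀ z)) φ = weakForm T (fun z t => η (clamp m M (v z t)))
        (fun z t => Q (clamp m M (v z t))) (fun z => η (y z)) φ := fun η Q φ => by
    refine weakForm_congr hT.le (fun t ht => ?_) (fun t ht => ?_) ?_ φ
    · filter_upwards [hvw t ht] with z hz
      rw [hcl η ht, hz]
    · filter_upwards [hvw t ht] with z hz
      rw [hcl Q ht, hz]
    · filter_upwards [hy] with z hz
      rw [hz]
  refine ⟨v, hv, hvw, ?_, ?_⟩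
  · refine hv.ae_eq_initial hT hL (locallyIntegrable_comp (f := id) continuousOn_id hym hyab)
      fun φ hφ => ?_
    refine Eq.trans ?_ ((htr id (flux V) φ).symm.trans (hw.weak φ hφ))
    exact weakForm_congr hT.le (fun t ht => by simp only [hcl id ht]; rfl) (fun t ht => ae_eq_rfl)
      ae_eq_rfl φ
  · refine hv.diniEntropy hL fun k hk χ hχ hχc hχ0 s t hs hst ht => ?_
    obtain ⟨D, hD, hpair⟩ := exists_kruzhkov_pair hV hVa hm hmM
    have hχ' : Continuous (deriv χ) := hχ.continuous_deriv (by simp)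
    have hsI : s ∈ Icc 0 T := ⟨hs, hst.le.trans ht⟩
    have htI : t ∈ Icc 0 T := ⟨hs.trans hst.le, ht⟩
    have hst' : Icc s t ⊆ Icc 0 T := Icc_subset_Icc hs ht
    have hGk := lipschitzWith_abs_sub hL (flux V (clamp m M k))
    have hk1 : LipschitzWith 1 fun x : ℝ => |x - k| := lipschitzWith_abs_sub LipschitzWith.id k
    -- The total effect of replacing the Kruzhkov pair by a smooth one: an error at each of the
    -- times s and t, and one in the flux over the time interval.
    set C := 2 * (∫ z, χ z) + (t - s) * (D * ∫ z, |deriv χ z|) with hC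
    have hC0 : 0 ≤ C := by
      have h1 : 0 ≤ ∫ z, χ z := integral_nonneg hχ0
      have h2 : 0 ≤ ∫ z, |deriv χ z| := integral_nonneg fun z => abs_nonneg _
      have h3 : 0 ≤ t - s := by linarith
      positivity
    refine le_of_forall_pos_le_add fun δ hδ => ?_
    obtain ⟨η, Q, hηQ, hη, hQ⟩ := hpair k hk (δ / (C + 1)) (by positivity)
    obtain ⟨K₁, hK₁⟩ := lipschitzWith_comp_clamp (f := η) hm hmM
      (fun x _ => (hηQ.smooth.differentiable (by norm_num) x).hasDerivAt)
      (hηQ.smooth.continuous_deriv (by norm_num)).continuousOn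
    obtain ⟨K₂, hK₂⟩ := lipschitzWith_comp_clamp hm hmM hηQ.flux_deriv (hηQ.continuousOn_deriv hV)
    set ε := δ / (C + 1) with hε
    have hε0 : 0 < ε := by positivity
    have main := hv.integral_sub_le hT hK₁ hK₂ (a := fun z => η (y z))
      (locallyIntegrable_comp hηQ.smooth.continuous.continuousOn
        (hηQ.smooth.continuous.measurable.comp hym) hyab)
      (fun φ hφ hφ0 => by rw [← htr]; exact hw.entropy η Q hηQ φ hφ hφ0) hχ hχc hχ0 hs hst ht
    have h1 : ∀ r ∈ Icc 0 T, |(∫ z, η (clamp m M (v z r)) * χ z) - ∫ z, |v z r - k| * χ z|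
        ≤ ε * ∫ z, χ z := fun r hr => by
      rw [← integral_sub (hv.integrable_comp_mul hK₁.continuous hr hχ.continuous hχc)
        (hv.integrable_comp_mul hk1.continuous hr hχ.continuous hχc), ← integral_const_mul]
      refine norm_integral_le_of_norm_le
        (f := fun z => η (clamp m M (v z r)) * χ z - |v z r - k| * χ z)
        ((hχ.continuous.integrable_of_hasCompactSupport hχc).const_mul ε) (ae_of_all _ fun z => ?_)
      rw [← sub_mul, norm_mul, Real.norm_of_nonneg (hχ0 z), hcl η hr]
      exact mul_le_mul_of_nonneg_right (hη _ (hv.mem r hr z)) (hχ0 z)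
    have h2 : ∀ r ∈ Icc 0 T, |(∫ z, Q (clamp m M (v z r)) * deriv χ z)
        - ∫ z, |flux V (clamp m M (v z r)) - flux V (clamp m M k)| * deriv χ z|
        ≤ D * ε * ∫ z, |deriv χ z| := fun r hr => by
      rw [← integral_sub (hv.integrable_comp_mul hK₂.continuous hr hχ' hχc.deriv)
        (hv.integrable_comp_mul hGk.continuous hr hχ' hχc.deriv), ← integral_const_mul]
      refine norm_integral_le_of_norm_le (f := fun z => Q (clamp m M (v z r)) * deriv χ z
        - |flux V (clamp m M (v z r)) - flux V (clamp m M k)| * deriv χ z)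
        ((hχ'.integrable_of_hasCompactSupport hχc.deriv).abs.const_mul _) (ae_of_all _ fun z => ?_)
      rw [← sub_mul, norm_mul, clamp_of_mem (hv.mem r hr z), clamp_of_mem hk]
      exact mul_le_mul_of_nonneg_right (hQ _ (hv.mem r hr z)) (norm_nonneg _)
    have ii : ∀ {f : ℝ → ℝ} {K : ℝ≥0}, LipschitzWith K f →
        IntervalIntegrable (fun x => ∫ z, f (v z x) * deriv χ z) volume s t := fun hf => by
      refine ContinuousOn.intervalIntegrable ?_
      rw [uIcc_of_le hst.le]
      exact (hv.continuousOn_integral_comp_mul hf hχ' hχc.deriv).mono hst'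
    have h3 : (∫ x in s..t, ∫ z, |flux V (clamp m M (v z x)) - flux V (clamp m M k)| * deriv χ z)
        ≤ (∫ x in s..t, ∫ z, Q (clamp m M (v z x)) * deriv χ z)
          + (t - s) * (D * ε * ∫ z, |deriv χ z|) := by
      have : (t - s) * (D * ε * ∫ z, |deriv χ z|) = ∫ _x in s..t, (D * ε * ∫ z, |deriv χ z|) := by
        rw [intervalIntegral.integral_const, smul_eq_mul]
      rw [this, ← intervalIntegral.integral_add (ii hK₂) (by simp)]
      refine intervalIntegral.integral_mono_on hst.le (ii hGk) ((ii hK₂).add (by simp))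
        fun x hx => ?_
      linarith [(abs_le.1 (h2 x (hst' hx))).1]
    have h4 : C * ε ≤ δ := by
      rw [hε, mul_div_assoc', div_le_iff₀ (by positivity)]
      nlinarith
    have h5 : C * ε = 2 * (ε * ∫ z, χ z) + (t - s) * (D * ε * ∫ z, |deriv χ z|) := by
      rw [hC]; ring
    have h6 := (abs_le.1 (h1 t htI)).1
    have h7 := (abs_le.1 (h1 s hsI)).2
    linarith

/-! ### Filtered solutions: existence and uniqueness -/

/-- Truncation of a function of bounded variation to [1, M] changes it only on a null set and does
not increase its modulus. -/
lemma IsBV.exists_representative {y₀ : ℝ → ℝ} (hBV : IsBV y₀) (hy₀ : ∀ᵐ z : ℝ, 1 ≤ y₀ z) :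
    ∃ y M C, 1 ≤ M ∧ 0 ≤ C ∧ Measurable y ∧ (∀ z, y z ∈ Icc 1 M) ∧ HasModulus C y ∧
      y₀ =ᵐ[volume] y := by
  obtain ⟨g, hg, hgy⟩ := hBV
  obtain ⟨C, hC, hmod⟩ := hasModulus_of_boundedVariation hg
  obtain ⟨p, q, hp, hq, hpq⟩ := hg.locallyBoundedVariationOn.exists_monotoneOn_sub_monotoneOn
  have hgm : Measurable g := by
    rw [hpq]
    exact (monotoneOn_univ.1 hp).measurable.sub (monotoneOn_univ.1 hq).measurable
  have hb : ∀ z, |g z| ≤ |g 0| + (eVariationOn g univ).toReal := fun z => by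
    have h1 := hg.dist_le (mem_univ z) (mem_univ 0)
    rw [Real.dist_eq] at h1
    linarith [abs_sub_abs_le_abs_sub (g z) (g 0)]
  set M := max 1 (|g 0| + (eVariationOn g univ).toReal) with hM
  refine ⟨fun z => clamp 1 M (g z), M, C, le_max_left _ _, hC,
    (lipschitzWith_clamp 1 M).continuous.measurable.comp hgm, fun z => clamp_mem (le_max_left _ _) _,
    ?_, ?_⟩
  · have := hmod.comp (lipschitzWith_clamp 1 M)
    rwa [NNReal.coe_one, one_mul] at this
  · filter_upwards [hgy, hy₀] with z h1 h2
    rw [h1] at h2 ⊢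
    exact (clamp_of_mem ⟨h2, (le_abs_self _).trans ((hb z).trans (le_max_right _ _))⟩).symm

lemma abs_le_of_mem_Icc_one {x M : ℝ} (h : x ∈ Icc 1 M) : |x| ≤ M :=
  abs_le.2 ⟨by linarith [h.1, h.2], h.2⟩

section Filtered

variable {V Φ y₀ y : ℝ → ℝ} {T α M C : ℝ}

lemma exists_isFlow_isFilteredSolution (hV : ContDiffOn ℝ 1 V (Ici 0))
    (hVa : AntitoneOn V (Ici 0)) (hΦ : IsKernel Φ) (hα : 0 < α) (hT : 0 ≤ T) (hM : 1 ≤ M)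
    (hym : Measurable y) (hy : ∀ z, y z ∈ Icc 1 M) (hmod : HasModulus C y)
    (hyy : y₀ =ᵐ[volume] y) {ν : Measure ℝ} [IsFiniteMeasure ν]
    (hν : IsTailMeasure (scaled Φ α) ν) {L : ℝ≥0}
    (hG : LipschitzWith L fun x => flux V (clamp 1 M x)) :
    ∃ u, IsFlow ν hG 1 M C T u ∧ (∀ z, u 0 z = avg (scaled Φ α) y z) ∧
      IsFilteredSolution V Φ y₀ α T fun z t => u t z := by
  have hΨ := hΦ.isKernel_scaled hα
  have hyb : ∀ z, |y z| ≤ M := fun z => abs_le_of_mem_Icc_one (hy z)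
  obtain ⟨K, hK⟩ := hΨ.avg_lipschitz hym hyb
  obtain ⟨D, hD⟩ := exists_abs_flux_clamp_le hV one_pos hM
  have hmem := hΨ.avg_mem_Icc hym hy
  let u₀ : ℝ →ᵇ ℝ := BoundedContinuousFunction.ofNormedAddCommGroup (avg (scaled Φ α) y)
    hK.continuous M fun z => abs_le_of_mem_Icc_one (hmem z)
  obtain ⟨u, hu, hu0⟩ := exists_isFlow (ν := ν) hG (monotone_flux_clamp hVa one_pos hM) hD hT
    (u₀ := u₀) (a := 1) (b := M) (C := C) ⟨hmem, hΨ.avg_hasModulus hym hyb hmod⟩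
  have h0 : ∀ z, u 0 z = avg (scaled Φ α) y z := fun z => by rw [hu0]; rfl
  refine ⟨u, hu, h0, ⟨hu.exists_lipschitz hD (K₀ := K) (by rw [hu0]; exact hK),
    ⟨1, one_pos, fun z t _ => ((hu.mem t).1 z).1⟩, fun z => ?_, fun φ hφ => ?_⟩⟩
  · rw [h0, average_eq_avg, IsKernel.avg_congr hyy]
  · refine Eq.trans ?_ (hu.weakForm_eq_zero hΨ hν hT hφ)
    have e : ∀ t x, clamp 1 M (u t x) = u t x := fun t x => clamp_of_mem ((hu.mem t).1 x)
    simp only [average_eq_avg, e]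

/-- The pairing of bounded continuous functions with an integrable function. -/
noncomputable def pairing (χ : ℝ → ℝ) (hχ : Integrable χ) : (ℝ →ᵇ ℝ) →L[ℝ] ℝ :=
  LinearMap.mkContinuous
    { toFun := fun f => ∫ z, f z * χ z
      map_add' := fun f g => by
        simp only [BoundedContinuousFunction.coe_add, Pi.add_apply, add_mul]
        exact integral_add
          (hχ.bdd_mul f.continuous.aestronglyMeasurable (ae_of_all _ f.norm_coe_le_norm))
          (hχ.bdd_mul g.continuous.aestronglyMeasurable (ae_of_all _ g.norm_coe_le_norm))
      map_smul' := fun c f => by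
        simp only [BoundedContinuousFunction.coe_smul, smul_eq_mul, mul_assoc, RingHom.id_apply]
        exact integral_const_mul _ _ }
    (∫ z, |χ z|) fun f => by
      rw [mul_comm, ← integral_const_mul]
      refine norm_integral_le_of_norm_le (f := fun z => f z * χ z) (hχ.abs.const_mul _)
        (ae_of_all _ fun z => ?_)
      rw [norm_mul]
      exact mul_le_mul_of_nonneg_right (f.norm_coe_le_norm z) (norm_nonneg _)

lemma pairing_apply {χ : ℝ → ℝ} (hχ : Integrable χ) (f : ℝ →ᵇ ℝ) :
    pairing χ hχ f = ∫ z, f z * χ z := rfl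

/-- A bounded continuous function is determined by its pairings with test functions. -/
lemma eq_of_forall_pairing {f g : ℝ →ᵇ ℝ}
    (h : ∀ χ : ℝ → ℝ, ContDiff ℝ ∞ χ → HasCompactSupport χ → ∫ z, f z * χ z = ∫ z, g z * χ z) :
    f = g := by
  have := ae_eq_of_integral_contDiff_smul_eq (μ := volume) (f := f) (f' := g)
    f.continuous.locallyIntegrable g.continuous.locallyIntegrable fun χ hχ hχc => by
      simpa only [smul_eq_mul, mul_comm] using h χ hχ hχc
  exact DFunLike.coe_injective ((f.continuous.ae_eq_iff_eq volume g.continuous).1 this)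

/-- Product test functions show that v satisfies the integral equation of the flow when paired with
every χ, hence as a curve of bounded continuous functions. Uniqueness for Lipschitz fields then
applies. -/
lemma IsFilteredSolution.eq_flow (hV : ContDiffOn ℝ 1 V (Ici 0)) (hΦ : IsKernel Φ) (hα : 0 < α)
    (hT : 0 < T) (hM : 1 ≤ M) (hyy : y₀ =ᵐ[volume] y) {ν : Measure ℝ} [IsFiniteMeasure ν]
    (hν : IsTailMeasure (scaled Φ α) ν) {L : ℝ≥0}
    {hG : LipschitzWith L fun x => flux V (clamp 1 M x)} {u : ℝ → ℝ →ᵇ ℝ}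
    (hu : IsFlow ν hG 1 M C T u) (hu0 : ∀ z, u 0 z = avg (scaled Φ α) y z) {v : ℝ → ℝ → ℝ}
    (hv : IsFilteredSolution V Φ y₀ α T v) : ∀ z, ∀ t ∈ Icc 0 T, v z t = u t z := by
  have hΨ := hΦ.isKernel_scaled hα
  obtain ⟨K, hK⟩ := hv.lipschitz
  obtain ⟨m, hm, hlow⟩ := hv.pos
  have h0T : (0 : ℝ) ∈ Icc 0 T := left_mem_Icc.2 hT.le
  have hv0 : ∀ z, v z 0 = u 0 z := fun z => by rw [hv.initial, hu0, average_eq_avg, IsKernel.avg_congr hyy]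
  have hKd : ∀ x, ∀ s ∈ Icc 0 T, ∀ z, ∀ t ∈ Icc 0 T,
      |v x s - v z t| ≤ K * max |x - z| |s - t| := fun x s hs z t ht => by
    have := hK.dist_le_mul (x, s) ⟨mem_univ _, hs⟩ (z, t) ⟨mem_univ _, ht⟩
    rwa [Real.dist_eq, Prod.dist_eq, Real.dist_eq, Real.dist_eq] at this
  set m' := min m 1 with hm'
  -- No upper bound is assumed for v; it follows from the initial bound M and the Lipschitz constant
  -- in time. The interval [m', M'] contains [1, M], so u is a flow for the wider truncation too.
  set M' := M + K * T with hM'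
  have hm'0 : 0 < m' := lt_min hm one_pos
  have hMM' : M ≤ M' := by
    have : 0 ≤ K * T := by positivity
    linarith
  have hmM' : m' ≤ M' := (min_le_right _ _).trans (hM.trans hMM')
  have hmem : ∀ z, ∀ t ∈ Icc 0 T, v z t ∈ Icc m' M' := fun z t ht => by
    refine ⟨(min_le_left _ _).trans (hlow z t ht), ?_⟩
    have h1 := hKd z t ht z 0 h0T
    rw [sub_self, abs_zero, sub_zero, max_eq_right (abs_nonneg _), abs_of_nonneg ht.1] at h1
    have h2 : K * t ≤ K * T := by gcongr; exact ht.2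
    have h3 := ((hu.mem 0).1 z).2
    rw [← hv0] at h3
    linarith [(abs_le.1 h1).2]
  obtain ⟨L', hG'⟩ := lipschitzWith_comp_clamp hm'0 hmM' (hasDerivAt_flux hV)
    (continuousOn_deriv_flux hV)
  have hcT : ∀ t, clamp 0 T t ∈ Icc 0 T := clamp_mem hT.le
  let γ : ℝ → ℝ →ᵇ ℝ := fun t => BoundedContinuousFunction.ofNormedAddCommGroup
    (fun z => v z (clamp 0 T t)) (by
      refine LipschitzWith.continuous (K := K) (LipschitzWith.of_dist_le_mul fun x z => ?_)
      have := hKd x _ (hcT t) z _ (hcT t)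
      rwa [sub_self, abs_zero, max_eq_left (abs_nonneg _)] at this) M' fun z => by
        have := hmem z _ (hcT t)
        exact abs_le.2 ⟨by linarith [this.1, this.2], this.2⟩
  have hγ : ∀ t ∈ Icc 0 T, ∀ z, γ t z = v z t := fun t ht z => by
    change v z (clamp 0 T t) = v z t
    rw [clamp_of_mem ht]
  have hγmem : ∀ t z, γ t z ∈ Icc m' M' := fun t z => hmem z _ (hcT t)
  have hγc : Continuous γ := by
    refine LipschitzWith.continuous (K := K) (LipschitzWith.of_dist_le_mul fun s t => ?_)
    refine (BoundedContinuousFunction.dist_le (by positivity)).2 fun z => ?_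
    have h1 := hKd z _ (hcT s) z _ (hcT t)
    rw [sub_self, abs_zero, max_eq_right (abs_nonneg _)] at h1
    have h2 := (lipschitzWith_clamp 0 T).dist_le_mul s t
    rw [NNReal.coe_one, one_mul, Real.dist_eq] at h2
    exact h1.trans (by gcongr)
  set F := jumpField ν hG' with hF
  have hFc : Continuous fun t => F (γ t) := (lipschitz_jumpField ν hG').continuous.comp hγc
  have hFi : ∀ a b, IntervalIntegrable (fun t => F (γ t)) volume a b := fun a b =>
    hFc.intervalIntegrable a b
  have hint : ∀ t ∈ Icc 0 T, γ t = γ 0 + ∫ s in (0 : ℝ)..t, F (γ s) := by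
    intro t ht
    refine eq_of_forall_pairing fun χ hχ hχc => ?_
    have hχi : Integrable χ := hχ.continuous.integrable_of_hasCompactSupport hχc
    have hχ' : Continuous (deriv χ) := hχ.continuous_deriv (by simp)
    have hjump : ∀ s ∈ Icc 0 T, pairing χ hχi (F (γ s))
        = -∫ z, average Φ α (fun x => flux V (v x s)) z * deriv χ z := fun s hs => by
      rw [pairing_apply, hF, jumpField,
        integral_jump_mul hΨ hν.pos hν.tail _ (hχ.of_le (by simp)) hχc, average_eq_avg]
      have e : ⇑((γ s).comp _ hG') = fun x => flux V (v x s) := funext fun x => by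
        rw [BoundedContinuousFunction.comp_apply, clamp_of_mem (hγmem s x), hγ s hs]
      rw [e]
    have hlin : pairing χ hχi (γ t)
        = pairing χ hχi (γ 0) - ∫ s in (0 : ℝ)..t, -pairing χ hχi (F (γ s)) := by
      have htest := (eq_of_forall_test (a := fun t => pairing χ hχi (γ t))
        (b := fun t => -pairing χ hχi (F (γ t))) (a₀ := pairing χ hχi (γ 0)) hT
        ((pairing χ hχi).continuous.comp hγc).continuousOn
        ((pairing χ hχi).continuous.comp hFc).neg.continuousOn fun τ hτ hτc => ?_).2 t ht
      · exact htest
      · have h1 := hv.weak _ (isTest_mul hχ hχc hτ hτc)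
        have e1 : ∀ s ∈ Icc 0 T, pairing χ hχi (γ s) = ∫ z, v z s * χ z := fun s hs => by
          simp only [pairing_apply, hγ s hs]
        have i1 : ∀ s ∈ Icc 0 T, Integrable fun z => v z s * χ z := fun s hs => by
          have := ((γ s).continuous.mul hχ.continuous).integrable_of_hasCompactSupport
            (μ := volume) hχc.mul_left
          refine this.congr (ae_of_all _ fun z => ?_)
          simp only [Pi.mul_apply, hγ s hs]
        rw [weakForm_mul hT.le i1 (fun s hs => ?_) (i1 0 h0T)] at h1
        · rw [e1 T (right_mem_Icc.2 hT.le), e1 0 h0T]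
          refine Eq.trans ?_ h1
          congr 1
          refine intervalIntegral.integral_congr fun s hs => ?_
          rw [uIcc_of_le hT.le] at hs
          simp only [e1 s hs, hjump s hs, neg_neg]
        · have hc : Continuous (average Φ α fun x => flux V (v x s)) := by
            obtain ⟨K', hK'⟩ := hΨ.avg_lipschitz ((γ s).comp _ hG').continuous.measurable
              ((γ s).comp _ hG').norm_coe_le_norm
            refine hK'.continuous.congr fun z => ?_
            rw [average_eq_avg]
            congr 1
            funext x
            rw [BoundedContinuousFunction.comp_apply, clamp_of_mem (hγmem s x), hγ s hs]
          exact (hc.mul hχ').integrable_of_hasCompactSupport hχc.deriv.mul_left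
    rw [← pairing_apply hχi, ← pairing_apply hχi, hlin, map_add, intervalIntegral.integral_neg,
      sub_neg_eq_add, ContinuousLinearMap.intervalIntegral_comp_comm _ (hFi 0 t)]
  have hγd : ∀ t ∈ Icc 0 T, HasDerivWithinAt γ (F (γ t)) (Icc 0 T) t := fun t ht => by
    have h1 : HasDerivAt (fun t => γ 0 + ∫ s in (0 : ℝ)..t, F (γ s)) (F (γ t)) t :=
      (intervalIntegral.integral_hasDerivAt_right (hFi 0 t)
        hFc.stronglyMeasurable.stronglyMeasurableAtFilter hFc.continuousAt).const_add _
    exact h1.hasDerivWithinAt.congr hint (hint t ht)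
  have hu' : IsFlow ν hG' m' M' C T u := hu.congr hG' (fun x hx => by
    rw [clamp_of_mem hx, clamp_of_mem (Icc_subset_Icc (min_le_right _ _) hMM' hx)])
    (min_le_right _ _) hMM'
  have hright : ∀ {f : ℝ → ℝ →ᵇ ℝ}, (∀ t ∈ Icc 0 T, HasDerivWithinAt f (F (f t)) (Icc 0 T) t) →
      ∀ t ∈ Ico 0 T, HasDerivWithinAt f (F (f t)) (Ici t) t := fun hf t ht =>
    (hf t (Ico_subset_Icc_self ht)).mono_of_mem_nhdsWithin (Icc_mem_nhdsGE_of_mem ht)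
  have heq := ODE_solution_unique (v := fun _ => F) (fun _ => lipschitz_jumpField ν hG')
    hγc.continuousOn (hright hγd) hu'.cont.continuousOn (hright hu'.ode)
    (by ext z; rw [hγ 0 h0T, hv0])
  intro z t ht
  rw [← hγ t ht z, heq ht]

end Filtered

/-! ### Families of flows indexed by the filter scale -/

/-- The flows with kernels `scaled Φ α` and averaged initial data. -/
structure IsFlowFamily (Φ y : ℝ → ℝ) {G : ℝ → ℝ} {L : ℝ≥0} (hG : LipschitzWith L G)
    (a b C T : ℝ) (ν : ℝ → Measure ℝ) [∀ α, IsFiniteMeasure (ν α)] (u : ℝ → ℝ → ℝ →ᵇ ℝ) :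
    Prop where
  tail : ∀ α > 0, IsTailMeasure (scaled Φ α) (ν α)
  flow : ∀ α > 0, IsFlow (ν α) hG a b C T (u α)
  initial : ∀ α > 0, ∀ z, u α 0 z = avg (scaled Φ α) y z

lemma integral_abs_avg_sub_le {Φ h : ℝ → ℝ} (hΦ : IsKernel Φ) {α D C : ℝ} (hα : 0 < α)
    (hh : Measurable h) (hD : ∀ x, |h x| ≤ D) (hC : 0 ≤ C) (hmod : HasModulus C h) (R : ℝ) :
    IntegrableOn (fun z => |avg (scaled Φ α) h z - h z|) (Icc (-R) R) ∧
      ∫ z in Icc (-R) R, |avg (scaled Φ α) h z - h z| ≤ C * (α * firstMoment Φ) := by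
  have hΨ := hΦ.isKernel_scaled hα
  obtain ⟨K, hK⟩ := hΨ.avg_lipschitz hh hD
  have hl := hΨ.lintegral_avg_sub_le hh hD hC hmod
  rw [IsKernel.firstMoment_scaled hα] at hl
  have hi : Integrable fun z => avg (scaled Φ α) h z - h z :=
    ⟨(hK.continuous.measurable.sub hh).aestronglyMeasurable, hl.trans_lt ENNReal.ofReal_lt_top⟩
  have hm := hΦ.firstMoment_nonneg
  refine ⟨hi.abs.integrableOn, (setIntegral_le_integral hi.abs
    (ae_of_all _ fun z => abs_nonneg _)).trans ?_⟩
  have := (ofReal_integral_norm_eq_lintegral_enorm hi).trans_le hl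
  exact (ENNReal.ofReal_le_ofReal_iff (by positivity)).1 this

lemma integrableOn_abs_sub_of_mem {f g : ℝ → ℝ} {a b : ℝ} (hf : Measurable f) (hg : Measurable g)
    (hfa : ∀ z, f z ∈ Icc a b) (hga : ∀ z, g z ∈ Icc a b) (R : ℝ) :
    IntegrableOn (fun z => |f z - g z|) (Icc (-R) R) :=
  Measure.integrableOn_of_bounded (M := b - a) (by simp) (hf.sub hg).abs.aestronglyMeasurable
    (ae_of_all _ fun z => by
      rw [Real.norm_eq_abs, abs_abs]
      exact abs_sub_le_of_mem_Icc (hfa z) (hga z))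

lemma integral_abs_sub_le_add {f g h : ℝ → ℝ} {R : ℝ}
    (h1 : IntegrableOn (fun z => |f z - g z|) (Icc (-R) R))
    (h2 : IntegrableOn (fun z => |g z - h z|) (Icc (-R) R)) :
    ∫ z in Icc (-R) R, |f z - h z|
      ≤ (∫ z in Icc (-R) R, |f z - g z|) + ∫ z in Icc (-R) R, |g z - h z| := by
  rw [← integral_add h1 h2]
  exact integral_mono_of_nonneg (ae_of_all _ fun z => abs_nonneg _) (h1.add h2)
    (ae_of_all _ fun z => abs_sub_le _ _ _)

lemma exists_pos_forall_mul_le (c : ℝ) {δ : ℝ} (hδ : 0 < δ) :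
    ∃ α₀ > 0, ∀ α ∈ Ioc 0 α₀, c * α ≤ δ := by
  refine ⟨δ / (|c| + 1), by positivity, fun α hα => ?_⟩
  calc c * α ≤ (|c| + 1) * (δ / (|c| + 1)) := by
        have := le_abs_self c
        have := hα.1
        exact mul_le_mul (by linarith) hα.2 hα.1.le (by positivity)
    _ = δ := by field_simp

section Family

variable {Φ y G : ℝ → ℝ} {L : ℝ≥0} {hG : LipschitzWith L G} {a b C T : ℝ} {ν : ℝ → Measure ℝ}
  [∀ α, IsFiniteMeasure (ν α)] {u : ℝ → ℝ → ℝ →ᵇ ℝ}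

lemma IsFlowFamily.congr (hu : IsFlowFamily Φ y hG a b C T ν u) {G' : ℝ → ℝ} {L' : ℝ≥0}
    (hG' : LipschitzWith L' G') (h : ∀ x ∈ Icc a b, G x = G' x) {a' b' : ℝ} (ha : a' ≤ a)
    (hb : b ≤ b') : IsFlowFamily Φ y hG' a' b' C T ν u where
  tail := hu.tail
  flow α hα := (hu.flow α hα).congr hG' h ha hb
  initial := hu.initial

lemma IsFlowFamily.diniEntropy (hΦ : IsKernel Φ) (hu : IsFlowFamily Φ y hG a b C T ν u)
    (hmono : Monotone G) (hC : 0 ≤ C) {α : ℝ} (hα : 0 < α) :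
    DiniEntropy G a b (L * C * firstMoment Φ * α) T fun z t => u α t z := by
  have := (hu.flow α hα).diniEntropy (hΦ.isKernel_scaled hα) (hu.tail α hα) hmono hC
  rwa [IsKernel.firstMoment_scaled hα, mul_comm α, ← mul_assoc] at this

/-- The flows supply the modulus required by `stability`, and their errors and initial deviations
are O(α). The competitor v needs no regularity of its own, so it may be another flow or an arbitrary
entropy solution. -/
lemma IsFlowFamily.stability (hΦ : IsKernel Φ) (hu : IsFlowFamily Φ y hG a b C T ν u)
    (hmono : Monotone G) (hC : 0 ≤ C) (hab : a ≤ b) (hT : 0 ≤ T) (hym : Measurable y)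
    (hy : ∀ z, y z ∈ Icc a b) (hmod : HasModulus C y) {R η : ℝ} (hR : 0 < R) (hη : 0 < η) :
    ∃ δ > 0, ∃ S > 0, ∃ α₀ > 0, ∀ e v, 0 ≤ e → e ≤ δ → IsBoundedCurve a b T v →
      DiniEntropy G a b e T v → ∫ z in Icc (-S) S, |v z 0 - y z| ≤ δ →
      ∀ α ∈ Ioc 0 α₀, ∀ t ∈ Icc 0 T, ∫ z in Icc (-R) R, |v z t - u α t z| ≤ η := by
  obtain ⟨δ, hδ, S, hS, h⟩ := LagrangianLWR.stability hG hab hC hT hR hη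
  obtain ⟨α₁, hα₁, h1⟩ := exists_pos_forall_mul_le (L * C * firstMoment Φ) hδ
  obtain ⟨α₂, hα₂, h2⟩ := exists_pos_forall_mul_le (C * firstMoment Φ) (half_pos hδ)
  -- Half of δ is allotted to the initial distance from v to y, half to the effect of averaging y.
  refine ⟨δ / 2, half_pos hδ, S, hS, min α₁ α₂, lt_min hα₁ hα₂, fun e v he0 he hv hve h0 α hα => ?_⟩
  have hm := hΦ.firstMoment_nonneg
  have h0T : (0 : ℝ) ∈ Icc 0 T := left_mem_Icc.2 hT
  have hyb : ∀ z, |y z| ≤ max |a| |b| := fun z => abs_le_max_abs_abs (hy z).1 (hy z).2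
  refine h e (L * C * firstMoment Φ * α) v (fun z t => u α t z) he0 (by linarith)
    (by have := hα.1; positivity) (h1 α ⟨hα.1, hα.2.trans (min_le_left _ _)⟩) hv
    (hu.flow α hα.1).isBoundedCurve hve (hu.diniEntropy hΦ hmono hC hα.1)
    (fun t _ => ((hu.flow α hα.1).mem t).2) ?_
  obtain ⟨i1, h3⟩ := integral_abs_avg_sub_le hΦ hα.1 hym hyb hC hmod S
  have h4 := h2 α ⟨hα.1, hα.2.trans (min_le_right _ _)⟩
  simp only [hu.initial α hα.1]
  simp only [abs_sub_comm _ (y _)] at i1 h3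
  refine (integral_abs_sub_le_add
    (integrableOn_abs_sub_of_mem (hv.meas 0 h0T) hym (hv.mem 0 h0T) hy S) i1).trans ?_
  have : C * (α * firstMoment Φ) = C * firstMoment Φ * α := by ring
  linarith

/-- The flows form a Cauchy family as the filter scale tends to zero. -/
lemma IsFlowFamily.cauchy (hΦ : IsKernel Φ) (hu : IsFlowFamily Φ y hG a b C T ν u)
    (hmono : Monotone G) (hC : 0 ≤ C) (hab : a ≤ b) (hT : 0 ≤ T) (hym : Measurable y)
    (hy : ∀ z, y z ∈ Icc a b) (hmod : HasModulus C y) {R η : ℝ} (hR : 0 < R) (hη : 0 < η) :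
    ∃ α₀ > 0, ∀ α ∈ Ioc 0 α₀, ∀ β ∈ Ioc 0 α₀, ∀ t ∈ Icc 0 T,
      ∫ z in Icc (-R) R, |u α t z - u β t z| ≤ η := by
  obtain ⟨δ, hδ, S, hS, α₀, hα₀, h⟩ := hu.stability hΦ hmono hC hab hT hym hy hmod hR hη
  obtain ⟨α₁, hα₁, h1⟩ := exists_pos_forall_mul_le (L * C * firstMoment Φ) hδ
  obtain ⟨α₂, hα₂, h2⟩ := exists_pos_forall_mul_le (C * firstMoment Φ) hδ
  have hm := hΦ.firstMoment_nonneg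
  have hyb : ∀ z, |y z| ≤ max |a| |b| := fun z => abs_le_max_abs_abs (hy z).1 (hy z).2
  refine ⟨min α₀ (min α₁ α₂), by positivity, fun α hα β hβ => ?_⟩
  refine h (L * C * firstMoment Φ * α) (fun z t => u α t z) (by have := hα.1; positivity)
    (h1 α ⟨hα.1, hα.2.trans ((min_le_right _ _).trans (min_le_left _ _))⟩)
    (hu.flow α hα.1).isBoundedCurve (hu.diniEntropy hΦ hmono hC hα.1) ?_ β
    ⟨hβ.1, hβ.2.trans (min_le_left _ _)⟩
  have h3 := (integral_abs_avg_sub_le hΦ hα.1 hym hyb hC hmod S).2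
  have h4 := h2 α ⟨hα.1, hα.2.trans ((min_le_right _ _).trans (min_le_right _ _))⟩
  simp only [hu.initial α hα.1]
  have : C * (α * firstMoment Φ) = C * firstMoment Φ * α := by ring
  linarith

end Family

/-! ### Limits in `C([0,T]; L¹_loc)` -/

/-- On each bounded interval the L¹ norms of consecutive differences are eventually dominated by a
geometric series, so the series of differences converges absolutely almost everywhere. -/
lemma ae_exists_tendsto_of_integral_le {f : ℕ → ℝ → ℝ} {a b : ℝ} (hf : ∀ n, Measurable (f n))
    (hfa : ∀ n z, f n z ∈ Icc a b)
    (h : ∀ n : ℕ, ∫ z in Icc (-((n : ℝ) + 1)) (n + 1), |f n z - f (n + 1) z| ≤ (1 / 2) ^ n) :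
    ∀ᵐ z, ∃ l, Tendsto (fun n => f n z) atTop (𝓝 l) := by
  have hloc : ∀ N : ℕ, ∀ᵐ z ∂(volume.restrict (Icc (-(N : ℝ)) N)),
      ∃ l, Tendsto (fun n => f n z) atTop (𝓝 l) := by
    intro N
    have hmeas : ∀ n, Measurable fun z => ‖f (n + N) z - f (n + N + 1) z‖ₑ := fun n =>
      ((hf _).sub (hf _)).enorm
    have hle : ∀ n : ℕ, ∫⁻ z in Icc (-(N : ℝ)) N, ‖f (n + N) z - f (n + N + 1) z‖ₑ
        ≤ ENNReal.ofReal ((1 / 2) ^ n) := by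
      intro n
      have hi := integrableOn_abs_sub_of_mem (hf (n + N)) (hf (n + N + 1)) (hfa _) (hfa _)
        ((n + N : ℕ) + 1)
      have hsub : Icc (-(N : ℝ)) N ⊆ Icc (-(((n + N : ℕ) : ℝ) + 1)) ((n + N : ℕ) + 1) := by
        push_cast
        have : (0 : ℝ) ≤ n := n.cast_nonneg
        exact Icc_subset_Icc (by linarith) (by linarith)
      refine (lintegral_mono_set hsub).trans ?_
      have e := ofReal_integral_norm_eq_lintegral_enorm hi
      simp only [Real.norm_eq_abs, abs_abs, Real.enorm_abs] at e
      rw [← e]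
      refine ENNReal.ofReal_le_ofReal ((h (n + N)).trans ?_)
      exact pow_le_pow_of_le_one (by norm_num) (by norm_num) (Nat.le_add_right n N)
    have hsum : ∫⁻ z in Icc (-(N : ℝ)) N, ∑' n, ‖f (n + N) z - f (n + N + 1) z‖ₑ ≠ ⊤ := by
      rw [lintegral_tsum fun n => (hmeas n).aemeasurable]
      refine ne_top_of_le_ne_top ?_ (ENNReal.tsum_le_tsum hle)
      rw [← ENNReal.ofReal_tsum_of_nonneg (fun n => by positivity) summable_geometric_two]
      exact ENNReal.ofReal_ne_top
    filter_upwards [ae_lt_top (Measurable.tsum hmeas) hsum] with z hz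
    have hs : Summable fun n => dist (f (n + N) z) (f (n + 1 + N) z) := by
      refine (NNReal.summable_coe.2 (ENNReal.tsum_coe_ne_top_iff_summable.1 hz.ne)).congr
        fun n => ?_
      rw [Real.dist_eq, coe_nnnorm, Real.norm_eq_abs, add_right_comm]
    obtain ⟨l, hl⟩ := cauchySeq_tendsto_of_complete
      (cauchySeq_of_summable_dist (f := fun n => f (n + N) z) hs)
    exact ⟨l, (tendsto_add_atTop_iff_nat N).1 hl⟩
  have := ae_all_iff.2 fun n => (ae_restrict_iff' measurableSet_Icc).1 (hloc n)
  filter_upwards [this] with z hz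
  obtain ⟨n, hn⟩ := exists_nat_ge |z|
  exact hz n (abs_le.1 hn)

/-- A sequence of scales with geometric rate on growing windows produces the limit for all times t;
the Cauchy property, uniform in t, then gives convergence of the whole family. -/
lemma exists_limit_of_cauchy {f : ℝ → ℝ → ℝ → ℝ} {a b T : ℝ} (hab : a ≤ b)
    (hf : ∀ α > 0, Measurable fun p : ℝ × ℝ => f α p.1 p.2)
    (hfa : ∀ α > 0, ∀ z t, f α z t ∈ Icc a b)
    (h : ∀ R > 0, ∀ η > 0, ∃ α₀ > 0, ∀ α ∈ Ioc 0 α₀, ∀ β ∈ Ioc 0 α₀, ∀ t ∈ Icc 0 T,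
      ∫ z in Icc (-R) R, |f α z t - f β z t| ≤ η) :
    ∃ w : ℝ → ℝ → ℝ, (Measurable fun p : ℝ × ℝ => w p.1 p.2) ∧ (∀ z t, w z t ∈ Icc a b) ∧
      ∀ R > 0, ∀ η > 0, ∃ α₀ > 0, ∀ α ∈ Ioc 0 α₀, ∀ t ∈ Icc 0 T,
        ∫ z in Icc (-R) R, |f α z t - w z t| ≤ η := by
  choose! A hA0 hA using h
  have hev : ∀ n : ℕ, ∀ᶠ k : ℕ in atTop, 1 / ((k : ℝ) + 1) ≤ A (n + 1) ((1 / 2) ^ n) := fun n =>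
    tendsto_one_div_add_atTop_nhds_zero_nat.eventually_le_const
      (hA0 _ (by positivity) _ (by positivity))
  obtain ⟨k, hk, hkA⟩ := extraction_forall_of_eventually hev
  set β : ℕ → ℝ := fun n => 1 / ((k n : ℝ) + 1) with hβ
  have hβ0 : ∀ n, 0 < β n := fun n => by positivity
  have hβlim : Tendsto β atTop (𝓝 0) := tendsto_one_div_add_atTop_nhds_zero_nat.comp hk.tendsto_atTop
  have hβanti : ∀ n, β (n + 1) ≤ β n := fun n => by
    have : (k n : ℝ) ≤ k (n + 1) := by exact_mod_cast (hk (Nat.lt_succ_self n)).le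
    simp only [hβ]
    gcongr
  have hslice : ∀ α > 0, ∀ t, Measurable fun z => f α z t := fun α hα t =>
    (hf α hα).comp (by fun_prop : Measurable fun z : ℝ => (z, t))
  -- The limsup exists at every point and is jointly measurable, while convergence holds only for
  -- almost every z at each t. Truncation keeps the values in [a, b] throughout.
  set w : ℝ → ℝ → ℝ := fun z t => clamp a b (limsup (fun n => f (β n) z t) atTop) with hw
  have hwm : Measurable fun p : ℝ × ℝ => w p.1 p.2 :=
    (lipschitzWith_clamp a b).continuous.measurable.comp
      (Measurable.limsup fun n => hf (β n) (hβ0 n))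
  have hwa : ∀ z t, w z t ∈ Icc a b := fun z t => clamp_mem hab _
  have hlim : ∀ t ∈ Icc 0 T, ∀ᵐ z, Tendsto (fun n => f (β n) z t) atTop (𝓝 (w z t)) := by
    intro t ht
    filter_upwards [ae_exists_tendsto_of_integral_le (fun n => hslice _ (hβ0 n) t)
      (fun n z => hfa _ (hβ0 n) z t) fun n => hA _ (by positivity) _ (by positivity) _
        ⟨hβ0 n, hkA n⟩ _ ⟨hβ0 _, (hβanti n).trans (hkA n)⟩ t ht] with z ⟨l, hl⟩
    have hlI : l ∈ Icc a b := isClosed_Icc.mem_of_tendsto hl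
      (Eventually.of_forall fun n => hfa _ (hβ0 n) z t)
    rw [hw]
    simp only
    rwa [hl.limsup_eq, clamp_of_mem hlI]
  refine ⟨w, hwm, hwa, fun R hR η hη => ⟨A R η, hA0 R hR η hη, fun α hα t ht => ?_⟩⟩
  have hconv : Tendsto (fun n => ∫ z in Icc (-R) R, |f α z t - f (β n) z t|) atTop
      (𝓝 (∫ z in Icc (-R) R, |f α z t - w z t|)) := by
    refine tendsto_integral_of_dominated_convergence (fun _ => b - a)
      (fun n => ((hslice α hα.1 t).sub (hslice _ (hβ0 n) t)).abs.aestronglyMeasurable)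
      (by simp) (fun n => ae_of_all _ fun z => ?_) ?_
    · rw [Real.norm_eq_abs, abs_abs]
      exact abs_sub_le_of_mem_Icc (hfa α hα.1 z t) (hfa _ (hβ0 n) z t)
    · filter_upwards [ae_restrict_of_ae (hlim t ht)] with z hz
      exact (tendsto_const_nhds.sub hz).abs
  refine le_of_tendsto hconv ?_
  filter_upwards [hβlim.eventually_le_const (hA0 R hR η hη)] with n hn
  exact hA R hR η hη α hα _ ⟨hβ0 n, hn⟩ t ht

/-! ### Passing to the limit in weak forms -/

/-- Convergence in `L¹` on bounded intervals. -/
def TendstoL1loc {ι : Type*} (l : Filter ι) (f : ι → ℝ → ℝ) (g : ℝ → ℝ) : Prop :=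
  ∀ R > 0, Tendsto (fun i => ∫ z in Icc (-R) R, |f i z - g z|) l (𝓝 0)

section Limit

variable {ι : Type*} {l : Filter ι} {D T : ℝ}

lemma TendstoL1loc.integral_mul {f : ι → ℝ → ℝ} {g : ℝ → ℝ} (h : TendstoL1loc l f g)
    (hf : ∀ᶠ i in l, Measurable (f i) ∧ ∀ z, |f i z| ≤ D) (hg : Measurable g)
    (hgD : ∀ z, |g z| ≤ D) {K : ℝ → ℝ} (hK : Continuous K) (hKc : HasCompactSupport K) :
    Tendsto (fun i => ∫ z, f i z * K z) l (𝓝 (∫ z, g z * K z)) := by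
  obtain ⟨R, hR, B, hB, hsupp, hKB⟩ := exists_bound_tsupport hK hKc
  rw [tendsto_iff_dist_tendsto_zero]
  have h0 := (h R hR).const_mul B
  rw [mul_zero] at h0
  refine squeeze_zero' (Eventually.of_forall fun _ => dist_nonneg) ?_ h0
  filter_upwards [hf] with i ⟨him, hiD⟩
  rw [Real.dist_eq, ← integral_sub (integrable_bdd_mul him.aestronglyMeasurable hiD hK hKc)
    (integrable_bdd_mul hg.aestronglyMeasurable hgD hK hKc),
    ← setIntegral_eq_integral_of_forall_compl_eq_zero (s := Icc (-R) R)
      (fun z hz => by rw [image_eq_zero_of_notMem_tsupport fun h => hz (hsupp h)]; ring),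
    ← integral_const_mul]
  refine norm_integral_le_of_norm_le (f := fun z => f i z * K z - g z * K z)
    ((integrableOn_abs_sub_of_mem him hg (fun z => abs_le.1 (hiD z)) (fun z => abs_le.1 (hgD z))
      R).const_mul B) (ae_of_all _ fun z => ?_)
  rw [← sub_mul, norm_mul, mul_comm]
  exact mul_le_mul_of_nonneg_right (hKB z) (norm_nonneg _)

/-- Convergence of each time slice suffices, by dominated convergence in t. Joint continuity of the
approximants serves for measurability of the inner integrals; the limits need only measurable
slices. -/
lemma tendsto_weakForm [l.IsCountablyGenerated] (hT : 0 ≤ T) {A F : ι → ℝ → ℝ → ℝ}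
    {a : ι → ℝ → ℝ} {A' F' : ℝ → ℝ → ℝ} {a' : ℝ → ℝ}
    (hA : ∀ᶠ i in l, (Continuous fun p : ℝ × ℝ => A i p.1 p.2) ∧ ∀ z t, |A i z t| ≤ D)
    (hF : ∀ᶠ i in l, (Continuous fun p : ℝ × ℝ => F i p.1 p.2) ∧ ∀ z t, |F i z t| ≤ D)
    (ha : ∀ᶠ i in l, Measurable (a i) ∧ ∀ z, |a i z| ≤ D)
    (hA' : ∀ t ∈ Icc 0 T, Measurable (fun z => A' z t) ∧ ∀ z, |A' z t| ≤ D)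
    (hF' : ∀ t ∈ Icc 0 T, Measurable (fun z => F' z t) ∧ ∀ z, |F' z t| ≤ D)
    (ha' : Measurable a' ∧ ∀ z, |a' z| ≤ D)
    (hAl : ∀ t ∈ Icc 0 T, TendstoL1loc l (fun i z => A i z t) fun z => A' z t)
    (hFl : ∀ t ∈ Icc 0 T, TendstoL1loc l (fun i z => F i z t) fun z => F' z t)
    (hal : TendstoL1loc l a a') {φ : ℝ × ℝ → ℝ} (hφ : IsTest φ) :
    Tendsto (fun i => weakForm T (A i) (F i) (a i) φ) l (𝓝 (weakForm T A' F' a' φ)) := by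
  have hφt := hφ.continuous_fderiv (0, 1)
  have hφz := hφ.continuous_fderiv (1, 0)
  have hct := hφ.hasCompactSupport_fderiv (0, 1)
  have hcz := hφ.hasCompactSupport_fderiv (1, 0)
  have hsl : ∀ t : ℝ, Continuous fun z : ℝ => (z, t) := fun t => by fun_prop
  have d1 : ∀ z t, deriv (fun s => φ (z, s)) t = fderiv ℝ φ (z, t) (0, 1) := fun z t =>
    (hφ.hasDerivAt_snd z t).deriv
  have d2 : ∀ z t, deriv (fun x => φ (x, t)) z = fderiv ℝ φ (z, t) (1, 0) := fun z t =>
    (hφ.hasDerivAt_fst z t).deriv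
  have split : ∀ {A F : ℝ → ℝ → ℝ} {t : ℝ}, (Measurable fun z => A z t) → (∀ z, |A z t| ≤ D) →
      (Measurable fun z => F z t) → (∀ z, |F z t| ≤ D) →
      ∫ z, (A z t * fderiv ℝ φ (z, t) (0, 1) - F z t * fderiv ℝ φ (z, t) (1, 0))
        = (∫ z, A z t * fderiv ℝ φ (z, t) (0, 1)) - ∫ z, F z t * fderiv ℝ φ (z, t) (1, 0) :=
    fun {A F t} h1 h2 h3 h4 => integral_sub
      (integrable_bdd_mul h1.aestronglyMeasurable h2 (hφt.comp (hsl t)) (hasCompactSupport_slice hct t))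
      (integrable_bdd_mul h3.aestronglyMeasurable h4 (hφz.comp (hsl t)) (hasCompactSupport_slice hcz t))
  have sm : ∀ {A : ℝ → ℝ → ℝ}, (Continuous fun p : ℝ × ℝ => A p.1 p.2) → ∀ t,
      Measurable fun z => A z t := fun h t => (h.comp (hsl t)).measurable
  simp only [weakForm, d1, d2]
  refine Tendsto.sub ?_ ?_
  · refine intervalIntegral.tendsto_integral_filter_of_dominated_convergence
      (fun t => ∫ z, (D * |fderiv ℝ φ (z, t) (0, 1)| + D * |fderiv ℝ φ (z, t) (1, 0)|)) ?_ ?_ ?_ ?_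
    · filter_upwards [hA, hF] with i hi hj
      have h1 := hi.1
      have h2 := hj.1
      exact (continuous_integral_slice (K := fun p => A i p.1 p.2 * fderiv ℝ φ p (0, 1)
          - F i p.1 p.2 * fderiv ℝ φ p (1, 0)) (by fun_prop)
        (hct.mul_left.sub hcz.mul_left)).aestronglyMeasurable
    · filter_upwards [hA, hF] with i hi hj
      refine ae_of_all _ fun t _ => ?_
      refine norm_integral_le_of_norm_le (f := fun z => A i z t * fderiv ℝ φ (z, t) (0, 1)
        - F i z t * fderiv ℝ φ (z, t) (1, 0)) ?_ (ae_of_all _ fun z => ?_)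
      · exact (((hφt.comp (hsl t)).integrable_of_hasCompactSupport
          (hasCompactSupport_slice hct t)).abs.const_mul D).add
          (((hφz.comp (hsl t)).integrable_of_hasCompactSupport
          (hasCompactSupport_slice hcz t)).abs.const_mul D)
      · refine (norm_sub_le _ _).trans (add_le_add ?_ ?_) <;> rw [norm_mul]
        · exact mul_le_mul_of_nonneg_right (hi.2 z t) (norm_nonneg _)
        · exact mul_le_mul_of_nonneg_right (hj.2 z t) (norm_nonneg _)
    · exact (continuous_integral_slice (K := fun p => D * |fderiv ℝ φ p (0, 1)|
        + D * |fderiv ℝ φ p (1, 0)|) (by fun_prop)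
        (hct.abs.mul_left.add hcz.abs.mul_left)).intervalIntegrable _ _
    · refine ae_of_all _ fun t ht => ?_
      rw [uIoc_of_le hT] at ht
      have htI := Ioc_subset_Icc_self ht
      rw [split (hA' t htI).1 (hA' t htI).2 (hF' t htI).1 (hF' t htI).2]
      have l1 := (hAl t htI).integral_mul (D := D)
        (by filter_upwards [hA] with i hi using ⟨sm hi.1 t, fun z => hi.2 z t⟩) (hA' t htI).1
        (hA' t htI).2 (hφt.comp (hsl t)) (hasCompactSupport_slice hct t)
      have l2 := (hFl t htI).integral_mul (D := D)
        (by filter_upwards [hF] with i hi using ⟨sm hi.1 t, fun z => hi.2 z t⟩) (hF' t htI).1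
        (hF' t htI).2 (hφz.comp (hsl t)) (hasCompactSupport_slice hcz t)
      refine (l1.sub l2).congr' ?_
      filter_upwards [hA, hF] with i hi hj
      exact (split (sm hi.1 t) (fun z => hi.2 z t) (sm hj.1 t) fun z => hj.2 z t).symm
  · have hTI : T ∈ Icc 0 T := right_mem_Icc.2 hT
    have hφc := hφ.1.continuous
    have l1 := (hAl T hTI).integral_mul (D := D)
      (by filter_upwards [hA] with i hi using ⟨sm hi.1 T, fun z => hi.2 z T⟩) (hA' T hTI).1
      (hA' T hTI).2 (hφc.comp (hsl T)) (hasCompactSupport_slice hφ.2 T)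
    have l2 := hal.integral_mul ha ha'.1 ha'.2 (hφc.comp (hsl 0)) (hasCompactSupport_slice hφ.2 0)
    have ii : ∀ {f : ℝ → ℝ} {t : ℝ}, Measurable f → (∀ z, |f z| ≤ D) →
        Integrable fun z => f z * φ (z, t) := fun {f t} h1 h2 =>
      integrable_bdd_mul h1.aestronglyMeasurable h2 (hφc.comp (hsl t))
        (hasCompactSupport_slice hφ.2 t)
    rw [integral_sub (ii (hA' T hTI).1 (hA' T hTI).2) (ii ha'.1 ha'.2)]
    refine (l1.sub l2).congr' ?_
    filter_upwards [hA, ha] with i hi hj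
    exact (integral_sub (ii (sm hi.1 T) fun z => hi.2 z T) (ii hj.1 hj.2)).symm

end Limit

lemma integral_abs_comp_sub_le {f g η : ℝ → ℝ} {K : ℝ≥0} (hη : LipschitzWith K η) {R : ℝ}
    (hi : IntegrableOn (fun z => |f z - g z|) (Icc (-R) R)) :
    ∫ z in Icc (-R) R, |η (f z) - η (g z)| ≤ K * ∫ z in Icc (-R) R, |f z - g z| := by
  rw [← integral_const_mul]
  refine integral_mono_of_nonneg (ae_of_all _ fun z => abs_nonneg _) (hi.const_mul _)
    (ae_of_all _ fun z => ?_)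
  have := hη.dist_le_mul (f z) (g z)
  rwa [Real.dist_eq, Real.dist_eq] at this

section Family

variable {Φ y G : ℝ → ℝ} {L : ℝ≥0} {hG : LipschitzWith L G} {a b C T : ℝ} {ν : ℝ → Measure ℝ}
  [∀ α, IsFiniteMeasure (ν α)] {u : ℝ → ℝ → ℝ →ᵇ ℝ} {w : ℝ → ℝ → ℝ}

/-- The averaged flux converges to the local one because all flows share the modulus C: averaging
Q(u) moves it in L¹ by at most K₂ C α times the first moment. -/
lemma IsFlowFamily.tendsto_weakForm (hΦ : IsKernel Φ) (hu : IsFlowFamily Φ y hG a b C T ν u)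
    (hC : 0 ≤ C) (hT : 0 ≤ T) (hym : Measurable y) (hy : ∀ z, y z ∈ Icc a b)
    (hmod : HasModulus C y) (hwm : ∀ t, Measurable fun z => w z t) (hwa : ∀ z t, w z t ∈ Icc a b)
    (hw : ∀ t ∈ Icc 0 T, TendstoL1loc (𝓝[>] 0) (fun α z => u α t z) fun z => w z t)
    {η Q : ℝ → ℝ} {K₁ K₂ : ℝ≥0} (hη : LipschitzWith K₁ η) (hQ : LipschitzWith K₂ Q)
    {φ : ℝ × ℝ → ℝ} (hφ : IsTest φ) :
    Tendsto (fun α => weakForm T (fun z t => η (u α t z))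
      (fun z t => avg (scaled Φ α) (fun x => Q (u α t x)) z) (fun z => η (u α 0 z)) φ)
      (𝓝[>] 0) (𝓝 (weakForm T (fun z t => η (w z t)) (fun z t => Q (w z t))
        (fun z => η (y z)) φ)) := by
  obtain ⟨D₁, hD₁⟩ := isCompact_Icc.exists_bound_of_continuousOn
    (hη.continuous.continuousOn (s := Icc a b))
  obtain ⟨D₂, hD₂⟩ := isCompact_Icc.exists_bound_of_continuousOn
    (hQ.continuous.continuousOn (s := Icc a b))
  have b1 : ∀ x ∈ Icc a b, |η x| ≤ max D₁ D₂ := fun x hx => (hD₁ x hx).trans (le_max_left _ _)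
  have b2 : ∀ x ∈ Icc a b, |Q x| ≤ max D₁ D₂ := fun x hx => (hD₂ x hx).trans (le_max_right _ _)
  have hm := hΦ.firstMoment_nonneg
  have hpos : ∀ᶠ α : ℝ in 𝓝[>] 0, 0 < α := self_mem_nhdsWithin
  have hmem : ∀ {α}, 0 < α → ∀ t z, u α t z ∈ Icc a b := fun hα t z => ((hu.flow _ hα).mem t).1 z
  have hum : ∀ α t, Measurable (u α t) := fun α t => (u α t).continuous.measurable
  have hsmall : ∀ c : ℝ, Tendsto (fun α : ℝ => c * (α * firstMoment Φ)) (𝓝[>] 0) (𝓝 0) := fun c => by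
    have : Continuous fun α : ℝ => c * (α * firstMoment Φ) := by fun_prop
    exact (this.tendsto' 0 0 (by simp)).mono_left nhdsWithin_le_nhds
  have hyb : ∀ z, |y z| ≤ max |a| |b| := fun z => abs_le_max_abs_abs (hy z).1 (hy z).2
  refine LagrangianLWR.tendsto_weakForm (D := max D₁ D₂) hT ?_ ?_ ?_ ?_ ?_ ?_ ?_ ?_ ?_ hφ
  · filter_upwards [hpos] with α hα
    exact ⟨hη.continuous.comp (continuous_uncurry_bcf (hu.flow α hα).cont),
      fun z t => b1 _ (hmem hα t z)⟩
  · filter_upwards [hpos] with α hα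
    have hΨ := hΦ.isKernel_scaled hα
    refine ⟨continuous_uncurry_bcf ((continuous_avgBCF hΨ).comp
      ((BoundedContinuousFunction.continuous_comp hQ).comp (hu.flow α hα).cont)), fun z t => ?_⟩
    exact abs_le.2 (hΨ.avg_mem_Icc (h := fun x => Q (u α t x))
      (hQ.continuous.measurable.comp (hum α t)) (fun x => abs_le.1 (b2 _ (hmem hα t x))) z)
  · filter_upwards [hpos] with α hα
    exact ⟨hη.continuous.measurable.comp (hum α 0), fun z => b1 _ (hmem hα 0 z)⟩
  · exact fun t _ => ⟨hη.continuous.measurable.comp (hwm t), fun z => b1 _ (hwa z t)⟩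
  · exact fun t _ => ⟨hQ.continuous.measurable.comp (hwm t), fun z => b2 _ (hwa z t)⟩
  · exact ⟨hη.continuous.measurable.comp hym, fun z => b1 _ (hy z)⟩
  · intro t ht R hR
    have h0 := (hw t ht R hR).const_mul (K₁ : ℝ)
    rw [mul_zero] at h0
    refine squeeze_zero' (Eventually.of_forall fun _ => integral_nonneg fun z => abs_nonneg _) ?_ h0
    filter_upwards [hpos] with α hα
    exact integral_abs_comp_sub_le hη
      (integrableOn_abs_sub_of_mem (hum α t) (hwm t) (hmem hα t) (fun z => hwa z t) R)
  · intro t ht R hR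
    have h0 := (hsmall (K₂ * C)).add ((hw t ht R hR).const_mul (K₂ : ℝ))
    rw [mul_zero, add_zero] at h0
    refine squeeze_zero' (Eventually.of_forall fun _ => integral_nonneg fun z => abs_nonneg _) ?_ h0
    filter_upwards [hpos] with α hα
    have hQm : Measurable fun z => Q (u α t z) := hQ.continuous.measurable.comp (hum α t)
    obtain ⟨i1, h1⟩ := integral_abs_avg_sub_le hΦ hα hQm (fun z => b2 _ (hmem hα t z))
      (by positivity) (((hu.flow α hα).mem t).2.comp hQ) R
    refine (integral_abs_sub_le_add i1 ?_).trans (add_le_add h1 (integral_abs_comp_sub_le hQ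
      (integrableOn_abs_sub_of_mem (hum α t) (hwm t) (hmem hα t) (fun z => hwa z t) R)))
    exact integrableOn_abs_sub_of_mem (g := fun z => Q (w z t)) hQm
      (hQ.continuous.measurable.comp (hwm t)) (fun z => abs_le.1 (b2 _ (hmem hα t z)))
      (fun z => abs_le.1 (b2 _ (hwa z t))) R
  · intro R hR
    have h0 := (hsmall C).const_mul (K₁ : ℝ)
    rw [mul_zero] at h0
    refine squeeze_zero' (Eventually.of_forall fun _ => integral_nonneg fun z => abs_nonneg _) ?_ h0
    filter_upwards [hpos] with α hα
    obtain ⟨i1, h1⟩ := integral_abs_avg_sub_le hΦ hα hym hyb hC hmod R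
    simp only [hu.initial α hα]
    exact (integral_abs_comp_sub_le hη i1).trans (mul_le_mul_of_nonneg_left h1 K₁.coe_nonneg)

end Family

/-! ### The limit is the entropy solution -/

lemma ae_eq_of_forall_integral_le {f g : ℝ → ℝ} {a b : ℝ} (hf : Measurable f) (hg : Measurable g)
    (hfa : ∀ z, f z ∈ Icc a b) (hga : ∀ z, g z ∈ Icc a b)
    (h : ∀ R > 0, ∀ ε > 0, ∫ z in Icc (-R) R, |f z - g z| ≤ ε) : f =ᵐ[volume] g := by
  have hloc : ∀ n : ℕ, ∀ᵐ z ∂(volume.restrict (Icc (-((n : ℝ) + 1)) (n + 1))), f z = g z := by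
    intro n
    have h0 : ∫ z in Icc (-((n : ℝ) + 1)) (n + 1), |f z - g z| = 0 :=
      le_antisymm (le_of_forall_pos_le_add fun ε hε => by
        rw [zero_add]; exact h _ (by positivity) ε hε) (integral_nonneg fun z => abs_nonneg _)
    rw [integral_eq_zero_iff_of_nonneg (fun z => abs_nonneg _)
      (integrableOn_abs_sub_of_mem hf hg hfa hga _)] at h0
    filter_upwards [h0] with z hz
    exact sub_eq_zero.1 (abs_eq_zero.1 hz)
  have := ae_all_iff.2 fun n => (ae_restrict_iff' measurableSet_Icc).1 (hloc n)
  filter_upwards [this] with z hz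
  obtain ⟨n, hn⟩ := exists_nat_ge |z|
  exact hz n (abs_le.1 (hn.trans (by linarith)))

lemma setLIntegral_enorm_sub_le {f g : ℝ → ℝ} {a b R ε : ℝ} (hf : Measurable f) (hg : Measurable g)
    (hfa : ∀ z, f z ∈ Icc a b) (hga : ∀ z, g z ∈ Icc a b) {K : Set ℝ} (hK : K ⊆ Icc (-R) R)
    (h : ∫ z in Icc (-R) R, |f z - g z| ≤ ε) : ∫⁻ z in K, ‖f z - g z‖ₑ ≤ ENNReal.ofReal ε := by
  refine (lintegral_mono_set hK).trans ?_
  have e := ofReal_integral_norm_eq_lintegral_enorm (integrableOn_abs_sub_of_mem hf hg hfa hga R)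
  simp only [Real.norm_eq_abs, abs_abs, Real.enorm_abs] at e
  rw [← e]
  exact ENNReal.ofReal_le_ofReal h

lemma exists_subset_Icc {K : Set ℝ} (hK : IsCompact K) : ∃ R > 0, K ⊆ Icc (-R) R := by
  obtain ⟨R, hR0, hR⟩ := hK.isBounded.subset_closedBall_lt 0 0
  exact ⟨R, hR0, by rwa [Real.closedBall_eq_Icc, zero_sub, zero_add] at hR⟩

lemma IsBoundedCurve.continuousInL1loc {m M T : ℝ} {v : ℝ → ℝ → ℝ} (hv : IsBoundedCurve m M T v) :
    ContinuousInL1loc T v := by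
  refine ⟨fun t ht => locallyIntegrable_comp (f := id) continuousOn_id (hv.meas t ht) (hv.mem t ht),
    fun K hK t ht => ENNReal.tendsto_nhds_zero.2 fun ε hε => ?_⟩
  obtain ⟨R, hR0, hR⟩ := exists_subset_Icc hK
  obtain ⟨r, hr0, hr⟩ : ∃ r : ℝ, 0 < r ∧ ENNReal.ofReal r ≤ ε := by
    obtain ⟨r, hr0, hr⟩ := ENNReal.lt_iff_exists_nnreal_btwn.1 hε
    exact ⟨r, by exact_mod_cast hr0, by simpa using hr.le⟩
  filter_upwards [hv.cont t ht R hR0 r hr0, self_mem_nhdsWithin] with s hs hsT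
  exact (setLIntegral_enorm_sub_le (hv.meas s hsT) (hv.meas t ht) (hv.mem s hsT) (hv.mem t ht) hR
    hs).trans hr

section Main

variable {V Φ y₀ y : ℝ → ℝ} {T M C : ℝ} {ν : ℝ → Measure ℝ} [∀ α, IsFiniteMeasure (ν α)]
  {u : ℝ → ℝ → ℝ →ᵇ ℝ} {w : ℝ → ℝ → ℝ} {L : ℝ≥0}
  {hG : LipschitzWith L fun x => flux V (clamp 1 M x)}

/-- The weak identity and the entropy inequalities hold for every α > 0 with averaged fluxes and
survive the limit; truncations are invisible on the range [1, M]. -/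
lemma IsFlowFamily.isEntropySolution (hV : ContDiffOn ℝ 1 V (Ici 0))
    (hVa : AntitoneOn V (Ici 0)) (hΦ : IsKernel Φ) (hu : IsFlowFamily Φ y hG 1 M C T ν u)
    (hC : 0 ≤ C) (hT : 0 ≤ T) (hM : 1 ≤ M) (hym : Measurable y) (hy : ∀ z, y z ∈ Icc 1 M)
    (hmod : HasModulus C y) (hyy : y₀ =ᵐ[volume] y)
    (hwm : Measurable fun p : ℝ × ℝ => w p.1 p.2) (hwa : ∀ z t, w z t ∈ Icc 1 M)
    (hw : ∀ R > 0, ∀ ε > 0, ∃ α₀ > 0, ∀ α ∈ Ioc 0 α₀, ∀ t ∈ Icc 0 T,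
      ∫ z in Icc (-R) R, |u α t z - w z t| ≤ ε) :
    IsEntropySolution V y₀ T w := by
  have hwt : ∀ t, Measurable fun z => w z t := fun t =>
    hwm.comp (by fun_prop : Measurable fun z : ℝ => (z, t))
  have hum : ∀ α t, Measurable (u α t) := fun α t => (u α t).continuous.measurable
  have hcw : ∀ (f : ℝ → ℝ) z t, f (clamp 1 M (w z t)) = f (w z t) := fun f z t => by
    rw [clamp_of_mem (hwa z t)]
  have hcu : ∀ (f : ℝ → ℝ) {α}, 0 < α → ∀ t z, f (clamp 1 M (u α t z)) = f (u α t z) :=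
    fun f α hα t z => by rw [clamp_of_mem (((hu.flow α hα).mem t).1 z)]
  have hcurve : IsBoundedCurve 1 M T w := by
    -- Uniform limits of continuous curves are continuous: ε/3 for each of the two approximations
    -- and ε/3 for the flow.
    refine ⟨fun t _ => hwt t, fun t _ z => hwa z t, fun t ht R hR ε hε => ?_⟩
    obtain ⟨α, hα, hα'⟩ := hw R hR (ε / 3) (by positivity)
    have hαI : α ∈ Ioc 0 α := ⟨hα, le_rfl⟩
    have hb := (hu.flow α hα).isBoundedCurve
    have hi : ∀ s, IntegrableOn (fun z => |u α s z - w z s|) (Icc (-R) R) := fun s =>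
      integrableOn_abs_sub_of_mem (hum α s) (hwt s) ((hu.flow α hα).mem s).1 (fun z => hwa z s) R
    filter_upwards [hb.cont t ht R hR (ε / 3) (by positivity), self_mem_nhdsWithin] with s hs hsT
    have i1 := hi s
    have h1 := hα' α hαI s hsT
    simp only [abs_sub_comm (u α s _)] at i1 h1
    have i2 := hb.integrableOn_abs_sub hsT ht R
    have h2 := hα' α hαI t ht
    have h3 := integral_abs_sub_le_add i2 (hi t)
    have i4 : IntegrableOn (fun z => |u α s z - w z t|) (Icc (-R) R) :=
      integrableOn_abs_sub_of_mem (hum α s) (hwt t) ((hu.flow α hα).mem s).1 (fun z => hwa z t) R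
    have h4 := integral_abs_sub_le_add i1 i4
    linarith
  have hlim : ∀ t ∈ Icc 0 T, TendstoL1loc (𝓝[>] 0) (fun α z => u α t z) fun z => w z t := by
    intro t ht R hR
    rw [Metric.tendsto_nhds]
    intro ε hε
    obtain ⟨α₀, hα₀, h⟩ := hw R hR (ε / 2) (half_pos hε)
    filter_upwards [Ioc_mem_nhdsGT hα₀] with α hα
    rw [Real.dist_eq, sub_zero, abs_of_nonneg (integral_nonneg fun z => abs_nonneg _)]
    exact (h α hα t ht).trans_lt (half_lt_self hε)
  have hpos : ∀ᶠ α : ℝ in 𝓝[>] 0, 0 < α := self_mem_nhdsWithin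
  refine ⟨⟨hcurve.continuousInL1loc, ?_, ⟨1, one_pos, ae_of_all _ fun p => (hwa p.1 p.2).1⟩,
    fun φ hφ => ?_⟩, fun η Q hηQ φ hφ hφ0 => ?_⟩
  · exact memLp_top_of_bound hwm.aestronglyMeasurable M
      (ae_of_all _ fun p => abs_le_of_mem_Icc_one (hwa p.1 p.2))
  · have hl := hu.tendsto_weakForm hΦ hC hT hym hy hmod hwt hwa hlim LipschitzWith.id hG hφ
    refine Eq.trans ?_ (tendsto_nhds_unique hl (tendsto_const_nhds.congr' ?_))
    · refine weakForm_congr hT (fun t _ => ae_eq_rfl) (fun t _ => ?_) hyy φ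
      simp only [hcw (flux V)]
      exact ae_eq_rfl
    · filter_upwards [hpos] with α hα
      exact ((hu.flow α hα).weakForm_eq_zero (hΦ.isKernel_scaled hα) (hu.tail α hα) hT hφ).symm
  · obtain ⟨K₁, hK₁⟩ := lipschitzWith_comp_clamp (f := η) one_pos hM
      (fun x _ => (hηQ.smooth.differentiable (by norm_num) x).hasDerivAt)
      (hηQ.smooth.continuous_deriv (by norm_num)).continuousOn
    obtain ⟨K₂, hK₂⟩ := lipschitzWith_comp_clamp one_pos hM hηQ.flux_deriv
      (hηQ.continuousOn_deriv hV)
    have hl := hu.tendsto_weakForm hΦ hC hT hym hy hmod hwt hwa hlim hK₁ hK₂ hφ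
    have e : weakForm T (fun z t => η (w z t)) (fun z t => Q (w z t)) (fun z => η (y₀ z)) φ
        = weakForm T (fun z t => η (clamp 1 M (w z t))) (fun z t => Q (clamp 1 M (w z t)))
          (fun z => η (clamp 1 M (y z))) φ := by
      simp only [hcw η, hcw Q]
      refine weakForm_congr hT (fun t _ => ae_eq_rfl) (fun t _ => ae_eq_rfl) ?_ φ
      filter_upwards [hyy] with z hz
      rw [hz, clamp_of_mem (hy z)]
    rw [e]
    refine ge_of_tendsto hl ?_
    filter_upwards [hpos] with α hα
    simp only [hcu η hα]
    refine (hu.flow α hα).weakForm_nonneg (hΦ.isKernel_scaled hα) (hu.tail α hα) hT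
      (hηQ.smooth.of_le (by norm_num)) hK₂ (fun p hp q hq => ?_) hφ hφ0
    rw [clamp_of_mem hp, clamp_of_mem hq]
    exact entropy_flux_le hV hVa hηQ (zero_lt_one.trans_le hp.1) (zero_lt_one.trans_le hq.1)

/-- Both v and the limit w are within ε/2 of the same flow at a small scale α. -/
lemma IsFlowFamily.ae_eq_of_isEntropySolution (hV : ContDiffOn ℝ 1 V (Ici 0))
    (hVa : AntitoneOn V (Ici 0)) (hΦ : IsKernel Φ) (hu : IsFlowFamily Φ y hG 1 M C T ν u)
    (hC : 0 ≤ C) (hT : 0 < T) (hym : Measurable y) (hy : ∀ z, y z ∈ Icc 1 M)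
    (hmod : HasModulus C y) (hyy : y₀ =ᵐ[volume] y)
    (hwm : ∀ t, Measurable fun z => w z t) (hwa : ∀ z t, w z t ∈ Icc 1 M)
    (hw : ∀ R > 0, ∀ ε > 0, ∃ α₀ > 0, ∀ α ∈ Ioc 0 α₀, ∀ t ∈ Icc 0 T,
      ∫ z in Icc (-R) R, |u α t z - w z t| ≤ ε)
    {v : ℝ → ℝ → ℝ} (hv : IsEntropySolution V y₀ T v) :
    ∀ t ∈ Icc 0 T, (fun z => v z t) =ᵐ[volume] fun z => w z t := by
  obtain ⟨m₀, hm₀, M₀, hmM₀, h⟩ := hv.exists_diniEntropy hV hVa hT hym hy hyy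
  set m := min m₀ 1 with hm
  set M' := max M₀ M with hM'
  have hm0 : 0 < m := lt_min hm₀ one_pos
  have hmM : m ≤ M' := (min_le_left _ _).trans (hmM₀.trans (le_max_left _ _))
  have hsub : Icc 1 M ⊆ Icc m M' := Icc_subset_Icc (min_le_right _ _) (le_max_right _ _)
  obtain ⟨v', hv', hvv, hv0, hve⟩ := h m M' hm0 (min_le_left _ _) (le_max_left _ _)
  obtain ⟨L', hG'⟩ := lipschitzWith_comp_clamp hm0 hmM (hasDerivAt_flux hV)
    (continuousOn_deriv_flux hV)
  have hu' : IsFlowFamily Φ y hG' m M' C T ν u := hu.congr hG' (fun x hx => by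
    rw [clamp_of_mem hx, clamp_of_mem (hsub hx)]) (min_le_right _ _) (le_max_right _ _)
  intro t ht
  refine (hvv t ht).symm.trans (ae_eq_of_forall_integral_le (hv'.meas t ht) (hwm t) (hv'.mem t ht)
    (fun z => hsub (hwa z t)) fun R hR ε hε => ?_)
  obtain ⟨δ, hδ, S, hS, α₁, hα₁, hst⟩ := hu'.stability hΦ (monotone_flux_clamp hVa hm0 hmM) hC hmM
    hT.le hym (fun z => hsub (hy z)) hmod hR (half_pos hε)
  obtain ⟨α₂, hα₂, h2⟩ := hw R hR (ε / 2) (half_pos hε)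
  have h0 : ∫ z in Icc (-S) S, |v' z 0 - y z| = 0 := by
    refine integral_eq_zero_of_ae (ae_restrict_of_ae ?_)
    filter_upwards [hv0] with z hz
    simp [hz]
  set α := min α₁ α₂ with hα
  have hα0 : 0 < α := lt_min hα₁ hα₂
  have b1 := hst 0 v' le_rfl hδ.le hv' hve (h0.le.trans hδ.le) α ⟨hα0, min_le_left _ _⟩ t ht
  have b2 := h2 α ⟨hα0, min_le_right _ _⟩ t ht
  have hum : Measurable (u α t) := (u α t).continuous.measurable
  have humem : ∀ z, u α t z ∈ Icc m M' := ((hu'.flow α hα0).mem t).1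
  have := integral_abs_sub_le_add
    (integrableOn_abs_sub_of_mem (hv'.meas t ht) hum (hv'.mem t ht) humem R)
    (integrableOn_abs_sub_of_mem hum (hwm t) humem (fun z => hsub (hwa z t)) R)
  linarith

end Main

end LagrangianLWR

/-! ### Assembly of the theorem -/

theorem theorem5p5 (V : ℝ → ℝ) (hV : ContDiffOn ℝ 1 V (Ici 0)) (hVanti : AntitoneOn V (Ici 0))
    (Φ : ℝ → ℝ) (hΦ : LagrangianLWR.IsKernel Φ)
    (y₀ : ℝ → ℝ) (hBV : LagrangianLWR.IsBV y₀) (hy₀ : ∀ᵐ z : ℝ, 1 ≤ y₀ z)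
    (T : ℝ) (hT : 0 < T) :
    (∀ α > 0, ∃ u : ℝ → ℝ → ℝ, LagrangianLWR.IsFilteredSolution V Φ y₀ α T u ∧
      ∀ v, LagrangianLWR.IsFilteredSolution V Φ y₀ α T v → ∀ z, ∀ t ∈ Icc 0 T, v z t = u z t) ∧
    ∃ w : ℝ → ℝ → ℝ, LagrangianLWR.IsEntropySolution V y₀ T w ∧
      (∀ v, LagrangianLWR.IsEntropySolution V y₀ T v →
        ∀ t ∈ Icc 0 T, (fun z => v z t) =ᵐ[volume] fun z => w z t) ∧
      ∀ wα : ℝ → ℝ → ℝ → ℝ,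
        (∀ α > 0, LagrangianLWR.IsFilteredSolution V Φ y₀ α T (wα α)) →
        ∀ K : Set ℝ, IsCompact K →
          Tendsto (fun α => ⨆ t ∈ Icc 0 T, ∫⁻ z in K, ‖wα α z t - w z t‖ₑ)
            (𝓝[>] 0) (𝓝 0) := by
  obtain ⟨y, M, C, hM, hC, hym, hy, hmod, hyy⟩ := hBV.exists_representative hy₀
  obtain ⟨L, hG⟩ := LagrangianLWR.lipschitzWith_comp_clamp one_pos hM
    (LagrangianLWR.hasDerivAt_flux hV) (LagrangianLWR.continuousOn_deriv_flux hV)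
  have hmono := LagrangianLWR.monotone_flux_clamp hVanti one_pos hM
  -- For α ≤ 0 the zero measure is a dummy value, so that finiteness is available for all α as an
  -- instance.
  have hν : ∀ α : ℝ, ∃ ν : Measure ℝ, IsFiniteMeasure ν ∧
      (0 < α → LagrangianLWR.IsTailMeasure (LagrangianLWR.scaled Φ α) ν) := fun α => by
    by_cases hα : 0 < α
    · obtain ⟨ν, h1, h2, h3⟩ := (hΦ.isKernel_scaled hα).exists_measure
      exact ⟨ν, h1, fun _ => ⟨h2, h3⟩⟩
    · exact ⟨0, inferInstance, fun h => absurd h hα⟩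
  choose ν hfin htail using hν
  have hflow := fun α (hα : 0 < α) => LagrangianLWR.exists_isFlow_isFilteredSolution hV hVanti hΦ hα
    hT.le hM hym hy hmod hyy (htail α hα) hG
  choose! u hu hu0 husol using hflow
  have hfam : LagrangianLWR.IsFlowFamily Φ y hG 1 M C T ν u := ⟨htail, hu, hu0⟩
  have huniq : ∀ α > 0, ∀ v, LagrangianLWR.IsFilteredSolution V Φ y₀ α T v →
      ∀ z, ∀ t ∈ Icc 0 T, v z t = u α t z := fun α hα v hv =>
    hv.eq_flow hV hΦ hα hT hM hyy (htail α hα) (hu α hα) (hu0 α hα)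
  obtain ⟨w, hwm, hwa, hw⟩ := LagrangianLWR.exists_limit_of_cauchy (T := T)
    (f := fun α z t => u α t z) hM
    (fun α hα => (LagrangianLWR.continuous_uncurry_bcf (hu α hα).cont).measurable)
    (fun α hα z t => ((hu α hα).mem t).1 z)
    (fun R hR η hη => hfam.cauchy hΦ hmono hC hM hT.le hym hy hmod hR hη)
  have hwt : ∀ t, Measurable fun z => w z t := fun t =>
    hwm.comp (by fun_prop : Measurable fun z : ℝ => (z, t))
  refine ⟨fun α hα => ⟨fun z t => u α t z, husol α hα, huniq α hα⟩, w,
    hfam.isEntropySolution hV hVanti hΦ hC hT.le hM hym hy hmod hyy hwm hwa hw,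
    fun v hv => hfam.ae_eq_of_isEntropySolution hV hVanti hΦ hC hT hym hy hmod hyy hwt hwa hw hv,
    fun wα hwα K hK => ENNReal.tendsto_nhds_zero.2 fun ε hε => ?_⟩
  obtain ⟨R, hR0, hR⟩ := LagrangianLWR.exists_subset_Icc hK
  obtain ⟨r, hr0, hr⟩ := ENNReal.lt_iff_exists_nnreal_btwn.1 hε
  obtain ⟨α₀, hα₀, h⟩ := hw R hR0 r (by exact_mod_cast hr0)
  filter_upwards [Ioc_mem_nhdsGT hα₀] with α hα
  refine iSup₂_le fun t ht => ?_
  -- By uniqueness any chosen family of filtered solutions is the family of flows, for which the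
  -- uniform bound is known.
  simp only [huniq α hα.1 (wα α) (hwα α hα.1) _ t ht]
  refine (LagrangianLWR.setLIntegral_enorm_sub_le (u α t).continuous.measurable (hwt t)
    ((hu α hα.1).mem t).1 (fun z => hwa z t) hR (h α hα t ht)).trans ?_
  rw [ENNReal.ofReal_coe_nnreal]
  exact hr.le
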